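/- Let $n\ge 2$. For a complex manifold $Z$ with a distribution (subbundle) $D\subset TZ$, its prolongation is the manifold $\mathbb P D=\{(z,\ell): \ell\subset D(z)\text{ a line}\}$ with the distribution $D^1(z,\ell)=d\pi_{(z,\ell)}^{-1}(\ell)$, where $\pi:\mathbb PD\to Z$ is the projection. The Monster tower $(\mathcal P^k(n),\Delta_k)_{k\ge 0}$ is obtained by prolonging $(\mathbb C^n,T\mathbb C^n)$ $k$ times; $\pi_{k,i}:\mathcal P^k(n)\to\mathcal P^i(n)$ are the projections. A nonconstant analytic integral curve germ $c$ of $D$ has the prolongation $c^1(t)=(c(t),\operatorname{span}\dot c(t))$ (extended analytically through the points with $\dot c=0$), and $\gamma^k$ denotes the $k$-th prolongation of a nonconstant analytic curve germ $\gamma$ at $0$ in $\mathbb C^n$. The fibers $B$ of $\mathcal P^{i}(n)\to\mathcal P^{i-1}(n)$, $i\ge 1$, and, inductively, their prolongations $\{(q,\ell): q\in B,\ \ell\subset \Delta(q)\cap T_qB\}$ at higher levels are the baby Monsters; the hyperplanes $\Delta_m(q)\cap T_qB\subset\Delta_m(q)$, for all such $B\ni q$ at level $m$, are the critical hyperplanes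 at $q$. A line in $\Delta_m(q)$ is critical if it lies in a critical hyperplane, regular otherwise, and vertical if $m\ge1$ and it lies in $\ker d\pi_{m,m-1}$. A point $p=(p',\ell)$ at level $\ge1$ is called regular, critical or vertical if $\ell$ is. The RVT code of $p\in\mathcal P^k(n)$ is the word $w_1\dots w_k$ with $w_i=V$ if $\pi_{k,i}(p)$ is vertical, $w_i=T$ if it is critical but not vertical, $w_i=R$ if it is regular; the RVT class of a word is the set of points with that code. For $p\in\mathcal P^k(n)$, $\mathrm{Germ}(p)$ is the set of nonconstant analytic curve germs $\gamma$ at $0$ in $\mathbb C^n$ such that $\gamma^k(0)=p$, $\gamma^k$ is immersed at $0$, and $d\gamma^k/dt(0)$ spans a regular line; such $\gamma$ are said to realize $p$. A point is a Cartan point if it is realized by an immersed germ; the singular locus at level $k$ is the complement of the set of Cartan points. A curve germ is an $A_{2k}$ singularity if it is the image of $(t^2,t^{2k+1},0,\dots,0)$ under a local analytic diffeomorphism of $\mathbb C^n$, up to an analytic reparametrization of $(\mathbb C,0)$. **Theorem.** (1) Let $k\ge 1$, $q\ge 0$. If $p\in \mathcal P^{k+1+q}(n)$ lies in the class $R^kVR^q$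 and $\gamma\in\mathrm{Germ}(p)$, then $\gamma$ is an $A_{2k}$ singularity. (2) Let $j>k\ge1$. The set of points of $\mathcal P^j(n)$ realized by $A_{2k}$ singularities is exactly the class $R^kVR^{j-k-1}$; it is a (nonempty) smooth quasiprojective hypersurface in $\mathcal P^j(n)$ and is contained in the singular locus. (3) For every $j$, the union over $1\le k<j$ of the sets in (2) is open and dense in the singular locus at level $j$. -/

import Mathlib

open Filter Topology Set
open scoped LinearAlgebra.Projectivization

/-! ### Spaces with an atlas, tangent vectors, distributions

Throughout, the ambient dimension is `n = d + 1`. All spaces are complex analytic manifolds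
presented by a coordinate atlas; every coordinate system takes values in one fixed
finite-dimensional coordinate space `E`. -/

/-- A set of points with an atlas: `chart a` is a coordinate system, meaningful on `dom a`. -/
structure Atlas where
  Pt : Type
  E : Type
  [normed : NormedAddCommGroup E]
  [space : NormedSpace ℂ E]
  ι : Type
  dom : ι → Set Pt
  chart : ι → Pt → E

attribute [instance] Atlas.normed Atlas.space

namespace Atlas

variable (M : Atlas)

/-- The change of coordinates from the chart `a` to the chart `b`. -/
noncomputable def trans (a b : M.ι) : M.E → M.E :=
  Function.extend (fun q : M.dom a => M.chart a q) (fun q : M.dom a => M.chart b q) 0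

/-- The tangent space at `p`: a tangent vector is a family of components, one for each coordinate
system around `p`, that transforms by the Jacobians of the coordinate changes (components in
coordinate systems not containing `p` are set to zero). -/
def tangent (p : M.Pt) : Submodule ℂ (M.ι → M.E) where
  carrier := {v | (∀ a, p ∉ M.dom a → v a = 0) ∧
    ∀ a b, p ∈ M.dom a → p ∈ M.dom b → v b = fderiv ℂ (M.trans a b) (M.chart a p) (v a)}
  zero_mem' := by
    refine ⟨fun _ _ => rfl, fun a b _ _ => ?_⟩
    simp
  add_mem' := by
    rintro v w ⟨hv, hv'⟩ ⟨hw, hw'⟩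
    refine ⟨fun a ha => by simp [hv a ha, hw a ha], fun a b ha hb => ?_⟩
    simp only [Pi.add_apply, map_add]
    rw [hv' a b ha hb, hw' a b ha hb]
  smul_mem' := by
    rintro c v ⟨hv, hv'⟩
    refine ⟨fun a ha => by simp [hv a ha], fun a b ha hb => ?_⟩
    simp only [Pi.smul_apply, map_smul]
    rw [hv' a b ha hb]

/-- The manifold topology: generated by the coordinate open sets. -/
instance topology : TopologicalSpace M.Pt :=
  TopologicalSpace.generateFrom
    {U | ∃ (a : M.ι) (O : Set M.E), IsOpen O ∧ U = {p | p ∈ M.dom a ∧ M.chart a p ∈ O}}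

/-- The curve `c` is analytic at the parameter value `t₀`. -/
def AnalyticCurveAt (c : ℂ → M.Pt) (t₀ : ℂ) : Prop :=
  ∃ a, (∀ᶠ t in 𝓝 t₀, c t ∈ M.dom a) ∧ AnalyticAt ℂ (fun t => M.chart a (c t)) t₀

/-- The curve `c` passes through `q` at the parameter value `t₀`, with velocity `v`. -/
def HasVelocity (c : ℂ → M.Pt) (t₀ : ℂ) (q : M.Pt) (v : M.tangent q) : Prop :=
  c t₀ = q ∧ ∀ a, q ∈ M.dom a →
    HasDerivAt (fun t => M.chart a (c t)) ((v : M.ι → M.E) a) t₀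

/-- The vector `v` at `q` is tangent to the (embedded) submanifold `B`: it is the velocity of an
analytic curve germ contained in `B`. -/
def IsTangentTo (B : Set M.Pt) (q : M.Pt) (v : M.tangent q) : Prop :=
  ∃ c : ℂ → M.Pt, M.AnalyticCurveAt c 0 ∧ (∀ᶠ t in 𝓝 0, c t ∈ B) ∧ M.HasVelocity c 0 q v

/-- The polynomial functions on the coordinate space: the algebra generated by the
linear functionals. -/
def polynomialFunctions : Subalgebra ℂ (M.E → ℂ) :=
  Algebra.adjoin ℂ (Set.range fun φ : M.E →ₗ[ℂ] ℂ => (φ : M.E → ℂ))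

/-- Zariski closed subsets: those which are zero loci of polynomials in every chart. -/
def IsZariskiClosed (Z : Set M.Pt) : Prop :=
  ∀ a, ∃ F : Set (M.E → ℂ), F ⊆ M.polynomialFunctions ∧
    ∀ p ∈ M.dom a, p ∈ Z ↔ ∀ f ∈ F, f (M.chart a p) = 0

/-- `S` is a smooth quasiprojective hypersurface: it is nonempty, Zariski locally closed, and near
each of its points it is cut out, on a Zariski open set, by one polynomial equation `f = 0`
whose differential does not vanish at the point. -/
def IsSmoothQuasiprojectiveHypersurface (S : Set M.Pt) : Prop :=
  S.Nonempty ∧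
  (∃ Z W : Set M.Pt, M.IsZariskiClosed Z ∧ M.IsZariskiClosed W ∧ S = Z \ W) ∧
  ∀ p ∈ S, ∃ a, p ∈ M.dom a ∧ ∃ f ∈ M.polynomialFunctions, ∃ g ∈ M.polynomialFunctions,
    g (M.chart a p) ≠ 0 ∧ fderiv ℂ f (M.chart a p) ≠ 0 ∧
    ∀ q ∈ M.dom a, g (M.chart a q) ≠ 0 → (q ∈ S ↔ f (M.chart a q) = 0)

end Atlas

/-- A manifold with a distribution `D` of rank `d + 1`. For each chart, `coframe a` lists `d + 1`
of the coordinates (linear functions of the coordinate vector) whose differentials, restricted to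
`D`, form a coframe of `D`. -/
structure DistManifold (d : ℕ) extends Atlas where
  D : (p : Pt) → Submodule ℂ (toAtlas.tangent p)
  coframe : ι → E →ₗ[ℂ] (Fin (d + 1) → ℂ)

namespace DistManifold

variable {d : ℕ}

/-- Points of the projectivization `ℙ D`: a point of the manifold and a line in `D` there. -/
structure ProjPt (L : DistManifold d) where
  base : L.Pt
  line : ℙ ℂ (L.D base)

variable (L : DistManifold d)

/-- The values of the coframe of the chart `a` on a vector spanning the line of `q`: homogeneous
coordinates of the line. -/
noncomputable def homCoord (a : L.ι) (q : L.ProjPt) : Fin (d + 1) → ℂ :=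
  L.coframe a (((q.line.rep : L.tangent q.base) : L.ι → L.E) a)

/-- The atlas of `ℙ D`. A chart `(a, i)` consists of a chart `a` of the manifold and a slot `i` of
its coframe; it covers the lines on which the `i`-th form of the coframe does not vanish, and its
coordinates are those of `a` together with the `d` fiber-affine coordinates obtained by dividing
the homogeneous coordinates of the line by the `i`-th one. -/
noncomputable def projAtlas : Atlas where
  Pt := L.ProjPt
  E := L.E × (Fin d → ℂ)
  ι := L.ι × Fin (d + 1)
  dom := fun a => {q | q.base ∈ L.dom a.1 ∧ L.homCoord a.1 q a.2 ≠ 0}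
  chart := fun a q => (L.chart a.1 q.base,
    fun j => L.homCoord a.1 q (a.2.succAbove j) / L.homCoord a.1 q a.2)

/-- `w = dπ (v)` for the projection `π : ℙ D → Z`, a tangent vector `v` at `q` and a tangent vector
`w` at `π q`; in the charts `π` drops the fiber coordinates. -/
def ProjectsTo (q : L.ProjPt) (v : L.projAtlas.tangent q) (w : L.tangent q.base) : Prop :=
  ∀ a : L.ι × Fin (d + 1), q ∈ L.projAtlas.dom a →
    (v.1 a).1 = (w : L.ι → L.E) a.1

/-- The prolonged distribution `D¹ (z, ℓ) = dπ⁻¹ (ℓ)`. -/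
def prolongD (q : L.ProjPt) : Submodule ℂ (L.projAtlas.tangent q) where
  carrier := {v | ∃ w ∈ q.line.submodule, L.ProjectsTo q v w}
  zero_mem' := ⟨0, Submodule.zero_mem _, fun _ _ => rfl⟩
  add_mem' := by
    rintro v v' ⟨w, hw, h⟩ ⟨w', hw', h'⟩
    refine ⟨w + w', Submodule.add_mem _ hw hw', fun a ha => ?_⟩
    have h1 := h a ha
    have h2 := h' a ha
    simp only [Submodule.coe_add, Pi.add_apply]
    rw [← h1, ← h2]
    rfl
  smul_mem' := by
    rintro c v ⟨w, hw, h⟩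
    refine ⟨c • w, Submodule.smul_mem _ c hw, fun a ha => ?_⟩
    have h1 := h a ha
    simp only [Submodule.coe_smul, Pi.smul_apply]
    rw [← h1]
    rfl

/-- The coframe of the prolonged distribution in the chart `(a, i)`: the `i`-th coordinate of the
old coframe stays in its slot, the new fiber coordinates fill the other slots. -/
def prolongCoframe (a : L.ι × Fin (d + 1)) : L.E × (Fin d → ℂ) →ₗ[ℂ] (Fin (d + 1) → ℂ) where
  toFun := fun w => a.2.insertNth (α := fun _ => ℂ) (L.coframe a.1 w.1 a.2) w.2
  map_add' := by
    intro v w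
    funext j
    induction j using a.2.succAboveCases <;> simp
  map_smul' := by
    intro c v
    funext j
    induction j using a.2.succAboveCases <;> simp

/-- The (Cartan) prolongation `(ℙ D, D¹)` of a manifold with distribution `(Z, D)`. -/
noncomputable def prolong : DistManifold d where
  toAtlas := L.projAtlas
  D := L.prolongD
  coframe := L.prolongCoframe

/-- The curve `c₁` in `ℙ D` is, as a germ at `0`, the prolongation of the integral curve `c`: it is
analytic, lies over `c`, and at the regular parameter values near `0` its line is spanned by
the velocity of `c`. (The value at `0` is then the limit of the values at regular points.) -/
def Prolongs (c : ℂ → L.Pt) (c₁ : ℂ → L.ProjPt) : Prop :=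
  L.projAtlas.AnalyticCurveAt c₁ 0 ∧ (∀ᶠ t in 𝓝 0, (c₁ t).base = c t) ∧
  ∀ᶠ t in 𝓝[≠] (0 : ℂ), ∃ (v : L.D (c t)) (hv : v ≠ 0),
    L.HasVelocity c t (c t) v ∧ c₁ t = ⟨c t, Projectivization.mk ℂ v hv⟩

end DistManifold

/-! ### The Monster tower -/

/-- `ℂⁿ`, `n = d + 1`, with its tangent bundle as distribution. -/
noncomputable def affineSpace (d : ℕ) : DistManifold d where
  Pt := Fin (d + 1) → ℂ
  E := Fin (d + 1) → ℂ
  ι := Unit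
  dom := fun _ => Set.univ
  chart := fun _ p => p
  D := fun _ => ⊤
  coframe := fun _ => LinearMap.id

/-- The `k`-th level of the Monster tower over `ℂⁿ`, `n = d + 1`. -/
noncomputable def Monster (d : ℕ) : ℕ → DistManifold d
  | 0 => affineSpace d
  | k + 1 => (Monster d k).prolong

namespace Monster

variable {d : ℕ}

/-- The one-step projection. -/
def down {k : ℕ} (q : (Monster d (k + 1)).Pt) : (Monster d k).Pt :=
  DistManifold.ProjPt.base (L := Monster d k) q

/-- The line `ℓ` of the point `q = (p, ℓ)`. -/
def line {k : ℕ} (q : (Monster d (k + 1)).Pt) : ℙ ℂ ((Monster d k).D (down q)) :=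
  DistManifold.ProjPt.line (L := Monster d k) q

/-- The submanifolds of the baby Monsters: the fibers of the projections, and the prolongations
`{(q, ℓ) : q ∈ B, ℓ ⊂ Δ (q) ∩ T_q B}` of those already obtained. -/
inductive IsBaby : (m : ℕ) → Set (Monster d m).Pt → Prop
  | fiber (i : ℕ) (p : (Monster d (i + 1)).Pt) : IsBaby (i + 1) {q | down q = down p}
  | prolong (m : ℕ) (B : Set (Monster d m).Pt) (hB : IsBaby m B) :
      IsBaby (m + 1) {q | down q ∈ B ∧
        ∀ v ∈ (line q).submodule, (Monster d m).IsTangentTo B (down q) v}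

/-- A direction at `q` is critical if it lies in a critical hyperplane `Δ (q) ∩ T_q B`, where `B` is
a level of a baby Monster through `q`. -/
def IsCriticalDir {m : ℕ} (q : (Monster d m).Pt) (l : ℙ ℂ ((Monster d m).D q)) : Prop :=
  ∃ B, IsBaby m B ∧ q ∈ B ∧ ∀ v ∈ l.submodule, (Monster d m).IsTangentTo B q v

/-- A direction at level `m + 1` is vertical if it lies in the kernel of `dπ`. -/
def IsVerticalDir {m : ℕ} (q : (Monster d (m + 1)).Pt)
    (l : ℙ ℂ ((Monster d (m + 1)).D q)) : Prop :=
  ∀ v ∈ l.submodule, (Monster d m).ProjectsTo q (v : (Monster d (m + 1)).tangent q) 0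

/-- A point is vertical if its line is vertical; points at levels `0` and `1` are not vertical. -/
def IsVertical : (k : ℕ) → (Monster d k).Pt → Prop
  | 0, _ => False
  | 1, _ => False
  | _ + 2, q => IsVerticalDir (down q) (line q)

/-- A point is critical if its line is critical. -/
def IsCritical : (k : ℕ) → (Monster d k).Pt → Prop
  | 0, _ => False
  | _ + 1, q => IsCriticalDir (down q) (line q)

/-- The letters of RVT codes. -/
inductive Letter
  | R
  | V
  | T

open Classical in
/-- The letter of a point: `V` if it is vertical, `T` if it is critical but not vertical,
and `R` if it is regular. -/
noncomputable def letter (k : ℕ) (q : (Monster d k).Pt) : Letter :=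
  if IsVertical k q then Letter.V else if IsCritical k q then Letter.T else Letter.R

/-- The RVT code of a point at level `k`, a word of length `k`. -/
noncomputable def code : (k : ℕ) → (Monster d k).Pt → List Letter
  | 0, _ => []
  | k + 1, q => code k (down q) ++ [letter (k + 1) q]

/-- The RVT class of the word `w` at level `k`. -/
def rvtClass (d k : ℕ) (w : List Letter) : Set (Monster d k).Pt := {q | code k q = w}

/-- The word `R^k V R^q`. -/
def wordRVR (k q : ℕ) : List Letter :=
  List.replicate k Letter.R ++ [Letter.V] ++ List.replicate q Letter.R

/-! ### Curves -/

/-- `Γ` is the `k`-th prolongation of the curve germ `γ` at `0`. -/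
def IsProlongation : (k : ℕ) → (ℂ → Fin (d + 1) → ℂ) → (ℂ → (Monster d k).Pt) → Prop
  | 0, γ, Γ => Γ = γ
  | k + 1, γ, Γ => ∃ Γ', IsProlongation k γ Γ' ∧ (Monster d k).Prolongs Γ' Γ

/-- `Germ p`: the nonconstant analytic curve germs in `ℂⁿ` at `t = 0` whose `k`-th prolongation
passes through `p` at `t = 0`, is immersed there, and has regular direction there. -/
def Germ {k : ℕ} (p : (Monster d k).Pt) : Set (ℂ → Fin (d + 1) → ℂ) :=
  {γ | AnalyticAt ℂ γ 0 ∧ (¬ ∀ᶠ t in 𝓝 0, γ t = γ 0) ∧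
    ∃ Γ, IsProlongation k γ Γ ∧ ∃ (v : (Monster d k).D p) (hv : v ≠ 0),
      (Monster d k).HasVelocity Γ 0 p v ∧ ¬ IsCriticalDir p (Projectivization.mk ℂ v hv)}

/-- A Cartan point is a point realized by an immersed curve germ in `ℂⁿ`. -/
def IsCartan {k : ℕ} (p : (Monster d k).Pt) : Prop := ∃ γ ∈ Germ p, deriv γ 0 ≠ 0

/-- The singular locus at level `k`: the complement of the Cartan points. -/
def singularLocus (d k : ℕ) : Set (Monster d k).Pt := {p | ¬ IsCartan p}

/-- Right-left equivalence of curve germs at `0`: `σ ∘ τ = ψ ∘ γ` for an analytic diffeomorphism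
germ `ψ` at `γ (0)` and a reparameterization germ `τ` of `(ℂ, 0)`. -/
def RLEquiv (γ σ : ℂ → Fin (d + 1) → ℂ) : Prop :=
  ∃ (ψ : (Fin (d + 1) → ℂ) → (Fin (d + 1) → ℂ)) (τ : ℂ → ℂ),
    AnalyticAt ℂ ψ (γ 0) ∧ (fderiv ℂ ψ (γ 0)).IsInvertible ∧
    AnalyticAt ℂ τ 0 ∧ τ 0 = 0 ∧ deriv τ 0 ≠ 0 ∧ ∀ᶠ t in 𝓝 0, σ (τ t) = ψ (γ t)

/-- The curve `(t², t^(2k+1), 0, …, 0)`. -/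
def curveA (d k : ℕ) : ℂ → Fin (d + 1) → ℂ :=
  fun t i => if i.val = 0 then t ^ 2 else if i.val = 1 then t ^ (2 * k + 1) else 0

/-- `γ` is an `A_{2k}` singularity. -/
def IsA2k (k : ℕ) (γ : ℂ → Fin (d + 1) → ℂ) : Prop := RLEquiv (curveA d k) γ

/-- The points at level `j` realized by `A_{2k}` singularities. -/
def locusA (d k j : ℕ) : Set (Monster d j).Pt := {p | ∃ γ ∈ Germ p, IsA2k k γ}

end Monster

/-! Fix a coordinate `x` among the coordinates of ℂⁿ and let `y` denote the others. As long as no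
line is vertical, one slot can be kept in all the affine fiber charts, and prolonging a curve `(x,
y)` amounts to adjoining the derivatives dy/dx, d²y/dx², and so on; at level `k` the distribution is
coframed by `dx` and `dy⁽ᵏ⁾`. A line at level `k` is vertical when `dx` vanishes on it. The next
chart then uses some component of `y⁽ᵏ⁾`, say `z`, as independent variable and `dx/dz` as a fiber
coordinate, which vanishes at the vertical point.

Critical hyperplanes are governed by one observation: a prolonged baby Monster through a point makes
that point critical. Hence over a regular point only the fiber, i.e. the vertical hyperplane,
counts. Directly over the vertical point there is one more, the prolongation of the fiber, which is
the locus `dx/dz = 0` over a fixed point. After one more regular line the situation is again that of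
a regular point. So `RᵏVR^q` says: exactly one vertical line, at level `k+1`, and the line after it
is not tangent to the vertical locus (`OnlyVertical`, `code_eq_wordRVR_iff`).

For a curve realizing such a point, regularity after the V gives z'(0) ≠ 0 and a simple zero of
`dx/dz`. Thus `dx = (dx/dz) dz` has a simple zero, `x` has order two, and `y⁽ᵏ⁾` has order one
modulo constants. Passing from dy/dx back to `y` raises the vanishing order modulo analytic
functions of `x` by two (`halfOrder_iff`), so `y` has order `2k+1` modulo functions of `x`. With `x
= x₀ + s²` and the even-odd splitting of power series this is exactly the `A_{2k}` normal form
(`isA2k_of_halfOrder`). Conversely, an `A_{2k}` germ has these orders (`exists_halfOrder_of_isA2k`),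
and reading the argument backwards recovers the code (`onlyVertical_of_halfOrder`). Realizing curves
exist because coframe coordinates along integral curves can be prescribed freely
(`exists_isIntegralIn`).

Cartan points are the points without vertical lines (`isCartan_iff`). In every chart, verticality at
a given level is either impossible or a linear coordinate equation, whence the smooth hypersurface.
Inside the singular locus the union of the classes is open, since the other degeneracies are closed
conditions, and dense, since the lines above the first vertical one can be moved to generic ones. -/

namespace Atlas

/-! ### Analytic atlases: points, tangent vectors and curves in charts -/

variable (M : Atlas)

/-- The coordinate systems are bijections onto the coordinate space and form an analytic atlas. -/
structure Regular : Prop where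
  finiteDimensional : FiniteDimensional ℂ M.E
  cover : ∀ p, ∃ a, p ∈ M.dom a
  injOn : ∀ a, InjOn (M.chart a) (M.dom a)
  surj : ∀ a x, ∃ p ∈ M.dom a, M.chart a p = x
  isOpen_overlap : ∀ a b, IsOpen (M.chart a '' (M.dom a ∩ M.dom b))
  analyticAt_trans : ∀ a b, ∀ p ∈ M.dom a, p ∈ M.dom b →
    AnalyticAt ℂ (M.trans a b) (M.chart a p)

namespace Regular

variable {M} (hM : M.Regular)
include hM

theorem trans_chart {a b : M.ι} {p : M.Pt} (hp : p ∈ M.dom a) :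
    M.trans a b (M.chart a p) = M.chart b p := by
  have hinj : Function.Injective (fun q : M.dom a => M.chart a q) :=
    fun x y h => Subtype.ext (hM.injOn a x.2 y.2 h)
  exact hinj.extend_apply (fun q : M.dom a => M.chart b q) 0 ⟨p, hp⟩

/-- The point with given coordinates. -/
noncomputable def point (a : M.ι) (x : M.E) : M.Pt := (hM.surj a x).choose

theorem point_mem (a : M.ι) (x : M.E) : hM.point a x ∈ M.dom a := (hM.surj a x).choose_spec.1

theorem chart_point (a : M.ι) (x : M.E) : M.chart a (hM.point a x) = x :=
  (hM.surj a x).choose_spec.2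

theorem point_chart {a : M.ι} {p : M.Pt} (hp : p ∈ M.dom a) : hM.point a (M.chart a p) = p :=
  hM.injOn a (hM.point_mem _ _) hp (hM.chart_point _ _)

theorem eventually_point_mem {a b : M.ι} {p : M.Pt} (ha : p ∈ M.dom a) (hb : p ∈ M.dom b) :
    ∀ᶠ x in 𝓝 (M.chart a p), hM.point a x ∈ M.dom b := by
  filter_upwards [(hM.isOpen_overlap a b).mem_nhds ⟨p, ⟨ha, hb⟩, rfl⟩]
  rintro _ ⟨q, ⟨hqa, hqb⟩, rfl⟩
  rwa [hM.point_chart hqa]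

theorem eventually_trans_trans {a b : M.ι} (c : M.ι) {p : M.Pt} (ha : p ∈ M.dom a)
    (hb : p ∈ M.dom b) :
    ∀ᶠ x in 𝓝 (M.chart a p), M.trans b c (M.trans a b x) = M.trans a c x := by
  filter_upwards [hM.eventually_point_mem ha hb] with x hx
  have h := hM.point_mem a x
  conv_lhs => rw [← hM.chart_point a x]
  conv_rhs => rw [← hM.chart_point a x]
  rw [hM.trans_chart h, hM.trans_chart hx, hM.trans_chart h]

theorem differentiableAt_trans {a b : M.ι} {p : M.Pt} (ha : p ∈ M.dom a) (hb : p ∈ M.dom b) :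
    DifferentiableAt ℂ (M.trans a b) (M.chart a p) :=
  (hM.analyticAt_trans a b p ha hb).differentiableAt

theorem fderiv_trans_comp {a b c : M.ι} {p : M.Pt} (ha : p ∈ M.dom a) (hb : p ∈ M.dom b)
    (hc : p ∈ M.dom c) (e : M.E) :
    fderiv ℂ (M.trans b c) (M.chart b p) (fderiv ℂ (M.trans a b) (M.chart a p) e) =
      fderiv ℂ (M.trans a c) (M.chart a p) e := by
  have h : M.trans a c =ᶠ[𝓝 (M.chart a p)] M.trans b c ∘ M.trans a b :=
    (hM.eventually_trans_trans c ha hb).mono fun x hx => hx.symm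
  have hbc := hM.differentiableAt_trans hb hc
  rw [← hM.trans_chart (b := b) ha] at hbc
  rw [h.fderiv_eq, fderiv_comp _ hbc (hM.differentiableAt_trans ha hb), hM.trans_chart ha]
  rfl

theorem fderiv_trans_self (a : M.ι) (p : M.Pt) (e : M.E) :
    fderiv ℂ (M.trans a a) (M.chart a p) e = e := by
  have h : M.trans a a = id := by
    funext x
    conv_lhs => rw [← hM.chart_point a x]
    rw [hM.trans_chart (hM.point_mem a x), hM.chart_point]
    rfl
  rw [h, fderiv_id]
  rfl

omit hM in
theorem tangent_ext {a : M.ι} {p : M.Pt} (ha : p ∈ M.dom a) {v w : M.tangent p}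
    (h : v.1 a = w.1 a) : v = w := by
  apply Subtype.ext
  funext b
  by_cases hb : p ∈ M.dom b
  · rw [v.2.2 a b ha hb, w.2.2 a b ha hb, h]
  · rw [v.2.1 b hb, w.2.1 b hb]

-- Transporting `e` by the Jacobians is consistent because of the chain rule `fderiv_trans_comp`.
open Classical in
theorem exists_tangent {a : M.ι} {p : M.Pt} (ha : p ∈ M.dom a) (e : M.E) :
    ∃ v : M.tangent p, v.1 a = e := by
  refine ⟨⟨fun b => if p ∈ M.dom b then fderiv ℂ (M.trans a b) (M.chart a p) e else 0,
    fun b hb => if_neg hb, fun b c hb hc => ?_⟩, ?_⟩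
  · simp only [if_pos hb, if_pos hc]
    exact (hM.fderiv_trans_comp ha hb hc e).symm
  · simp only [if_pos ha]
    exact hM.fderiv_trans_self a _ e

theorem eventually_mem_of_analytic {c : ℂ → M.Pt} {t₀ : ℂ} {a b : M.ι}
    (hc : ∀ᶠ t in 𝓝 t₀, c t ∈ M.dom a) (hc' : ContinuousAt (fun t => M.chart a (c t)) t₀)
    (hb : c t₀ ∈ M.dom b) : ∀ᶠ t in 𝓝 t₀, c t ∈ M.dom b := by
  filter_upwards [hc, hc'.eventually (hM.eventually_point_mem hc.self_of_nhds hb)] with t h1 h2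
  rwa [hM.point_chart h1] at h2

theorem analytic_of_analytic {c : ℂ → M.Pt} {t₀ : ℂ} {a b : M.ι}
    (hc : ∀ᶠ t in 𝓝 t₀, c t ∈ M.dom a) (hc' : AnalyticAt ℂ (fun t => M.chart a (c t)) t₀)
    (hb : c t₀ ∈ M.dom b) : AnalyticAt ℂ (fun t => M.chart b (c t)) t₀ := by
  have ha := hc.self_of_nhds
  have h := AnalyticAt.comp (g := M.trans a b) (f := fun t => M.chart a (c t)) (x := t₀)
    (hM.analyticAt_trans a b _ ha hb) hc'
  refine h.congr ?_
  filter_upwards [hc] with t ht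
  exact hM.trans_chart ht

theorem eventually_mem {c : ℂ → M.Pt} {t₀ : ℂ} (h : M.AnalyticCurveAt c t₀)
    {b : M.ι} (hb : c t₀ ∈ M.dom b) : ∀ᶠ t in 𝓝 t₀, c t ∈ M.dom b := by
  obtain ⟨a, h1, h2⟩ := h
  exact hM.eventually_mem_of_analytic h1 h2.continuousAt hb

theorem analyticAt_chart {c : ℂ → M.Pt} {t₀ : ℂ} (h : M.AnalyticCurveAt c t₀)
    {b : M.ι} (hb : c t₀ ∈ M.dom b) : AnalyticAt ℂ (fun t => M.chart b (c t)) t₀ := by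
  obtain ⟨a, h1, h2⟩ := h
  exact hM.analytic_of_analytic h1 h2 hb

/-- The transformation rule of tangent vectors is the chain rule for coordinate curves, so a
velocity can be checked in a single chart. -/
theorem hasVelocity_of_chart {c : ℂ → M.Pt} {t₀ : ℂ} {q : M.Pt} {v : M.tangent q} {a : M.ι}
    (hq : c t₀ = q) (ha : ∀ᶠ t in 𝓝 t₀, c t ∈ M.dom a)
    (hv : HasDerivAt (fun t => M.chart a (c t)) (v.1 a) t₀) : M.HasVelocity c t₀ q v := by
  refine ⟨hq, fun b hb => ?_⟩
  subst hq
  have h0 := ha.self_of_nhds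
  have h := (hM.differentiableAt_trans h0 hb).hasFDerivAt.comp_hasDerivAt t₀ hv
  rw [v.2.2 a b h0 hb]
  refine h.congr_of_eventuallyEq ?_
  filter_upwards [ha] with t ht
  exact (hM.trans_chart ht).symm

omit hM in
theorem isOpen_preimage_chart (a : M.ι) {O : Set M.E} (hO : IsOpen O) :
    IsOpen {p | p ∈ M.dom a ∧ M.chart a p ∈ O} :=
  TopologicalSpace.isOpen_generateFrom_of_mem ⟨a, O, hO, rfl⟩

/-- Overlaps are open and transitions continuous, which is what a generating open set of another
chart requires. Open sets of the manifold can thus be pulled back to coordinate space, where the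
perturbations of the density argument take place. -/
theorem continuous_point (a : M.ι) : Continuous (hM.point a) := by
  refine continuous_generateFrom_iff.2 ?_
  rintro _ ⟨b, O, hO, rfl⟩
  rw [isOpen_iff_mem_nhds]
  rintro x ⟨hx, hxO⟩
  have ha := hM.point_mem a x
  have h1 := hM.eventually_point_mem ha hx
  have h2 := (hM.analyticAt_trans a b _ ha hx).continuousAt
  rw [ContinuousAt, hM.trans_chart ha, hM.chart_point] at h2
  rw [hM.chart_point] at h1
  filter_upwards [h1, h2 (hO.mem_nhds hxO)] with y hy hy'
  refine ⟨hy, ?_⟩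
  have h3 := hM.trans_chart (b := b) (hM.point_mem a y)
  rw [hM.chart_point] at h3
  rw [← h3]
  exact hy'

theorem continuous_of_mem_polynomialFunctions {f : M.E → ℂ} (hf : f ∈ M.polynomialFunctions) :
    Continuous f := by
  have := hM.finiteDimensional
  refine Algebra.adjoin_induction (p := fun f _ => Continuous f) ?_ ?_ ?_ ?_ hf
  · rintro _ ⟨φ, rfl⟩
    exact φ.continuous_of_finiteDimensional
  · intro r
    exact continuous_const
  · intro f g _ _ hf hg
    exact hf.add hg
  · intro f g _ _ hf hg
    exact hf.mul hg

theorem isClosed_of_isZariskiClosed {Z : Set M.Pt} (hZ : M.IsZariskiClosed Z) : IsClosed Z := by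
  rw [← isOpen_compl_iff, isOpen_iff_forall_mem_open]
  intro p hp
  obtain ⟨a, ha⟩ := hM.cover p
  obtain ⟨F, hF, h⟩ := hZ a
  have h1 : ∃ f ∈ F, f (M.chart a p) ≠ 0 := by
    by_contra! hcon
    exact hp ((h p ha).2 hcon)
  obtain ⟨f, hfF, hfp⟩ := h1
  refine ⟨_, ?_, isOpen_preimage_chart a (O := {x | f x ≠ 0}) ?_, ha, hfp⟩
  · rintro q ⟨hq, hfq⟩ hqZ
    exact hfq ((h q hq).1 hqZ f hfF)
  · exact isOpen_ne_fun (hM.continuous_of_mem_polynomialFunctions (hF hfF)) continuous_const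

end Regular

variable {M}

theorem linear_mem_polynomialFunctions (φ : M.E →ₗ[ℂ] ℂ) : (φ : M.E → ℂ) ∈ M.polynomialFunctions :=
  Algebra.subset_adjoin ⟨φ, rfl⟩

/-- The union is cut out by the pairwise products of the equations. -/
theorem IsZariskiClosed.union {Z W : Set M.Pt} (hZ : M.IsZariskiClosed Z)
    (hW : M.IsZariskiClosed W) : M.IsZariskiClosed (Z ∪ W) := by
  intro a
  obtain ⟨F, hF, h⟩ := hZ a
  obtain ⟨G, hG, h'⟩ := hW a
  refine ⟨{k | ∃ f ∈ F, ∃ g ∈ G, k = f * g}, ?_, fun p hp => ⟨?_, fun H => ?_⟩⟩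
  · rintro _ ⟨f, hf, g, hg, rfl⟩
    exact mul_mem (hF hf) (hG hg)
  · rintro (hp' | hp') _ ⟨f, hf, g, hg, rfl⟩
    · simp [(h p hp).1 hp' f hf]
    · simp [(h' p hp).1 hp' g hg]
  · by_contra hcon
    rw [mem_union, not_or, h p hp, h' p hp] at hcon
    push Not at hcon
    obtain ⟨⟨f, hf, hf'⟩, g, hg, hg'⟩ := hcon
    exact mul_ne_zero hf' hg' (H _ ⟨f, hf, g, hg, rfl⟩)

theorem isZariskiClosed_empty : M.IsZariskiClosed ∅ :=
  fun _ => ⟨{1}, by simp, fun p _ => by simp⟩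

/-- A set which in every chart is empty or a linear hyperplane is Zariski closed. -/
theorem isZariskiClosed_of_linear {Z : Set M.Pt}
    (h : ∀ a, (∀ p ∈ M.dom a, p ∉ Z) ∨
      ∃ φ : M.E →ₗ[ℂ] ℂ, ∀ p ∈ M.dom a, p ∈ Z ↔ φ (M.chart a p) = 0) : M.IsZariskiClosed Z := by
  intro a
  rcases h a with h | ⟨φ, h⟩
  · exact ⟨{1}, by simp, fun p hp => by simp [h p hp]⟩
  · refine ⟨{(φ : M.E → ℂ)}, by simpa using linear_mem_polynomialFunctions φ, fun p hp => ?_⟩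
    simp [h p hp]

end Atlas

/-! ### Frames dual to the coframes, and their prolongation -/

theorem analyticAt_clm_apply {E F G : Type*} [NormedAddCommGroup E] [NormedSpace ℂ E]
    [NormedAddCommGroup F] [NormedSpace ℂ F] [NormedAddCommGroup G] [NormedSpace ℂ G]
    {f : G → E →L[ℂ] F} {g : G → E} {x : G} (hf : AnalyticAt ℂ f x) (hg : AnalyticAt ℂ g x) :
    AnalyticAt ℂ (fun y => f y (g y)) x :=
  AnalyticAt.comp (g := fun p : (E →L[ℂ] F) × E => p.1 p.2) (f := fun y => (f y, g y))
    ((ContinuousLinearMap.id ℂ (E →L[ℂ] F)).analyticAt_bilinear (f x, g x)) (hf.prod hg)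

namespace DistManifold

variable {d : ℕ}

/-- The vector of homogeneous coordinates with `i`-th entry `1` and other entries `u`. -/
def affineVec (i : Fin (d + 1)) (u : Fin d → ℂ) : Fin (d + 1) → ℂ :=
  i.insertNth (α := fun _ => ℂ) 1 u

@[simp] theorem affineVec_self (i : Fin (d + 1)) (u : Fin d → ℂ) : affineVec i u i = 1 := by
  simp [affineVec]

@[simp] theorem affineVec_succAbove (i : Fin (d + 1)) (u : Fin d → ℂ) (j : Fin d) :
    affineVec i u (i.succAbove j) = u j := by
  simp [affineVec]

theorem affineVec_ne_zero (i : Fin (d + 1)) (u : Fin d → ℂ) : affineVec i u ≠ 0 := fun h => by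
  simpa using congrFun h i

theorem analyticAt_affineVec (i : Fin (d + 1)) (u : Fin d → ℂ) : AnalyticAt ℂ (affineVec i) u := by
  refine AnalyticAt.pi fun j => ?_
  induction j using i.succAboveCases with
  | x => simpa using analyticAt_const
  | p j =>
    simp only [affineVec_succAbove]
    exact (ContinuousLinearMap.proj (R := ℂ) (φ := fun _ : Fin d => ℂ) j).analyticAt u

theorem eq_smul_affineVec {i : Fin (d + 1)} {f : Fin (d + 1) → ℂ} (hf : f i ≠ 0) :
    f = f i • affineVec i fun j => f (i.succAbove j) / f i := by
  funext j
  induction j using i.succAboveCases with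
  | x => simp
  | p j => simp [mul_div_cancel₀ _ hf]

/-- Coordinate systems of the underlying space, together with analytic frames `lift` of the
distribution, dual to the coframes. -/
structure Framed (L : DistManifold d) where
  regular : L.toAtlas.Regular
  lift : L.ι → L.E → (Fin (d + 1) → ℂ) →L[ℂ] L.E
  analyticAt_lift : ∀ a x, AnalyticAt ℂ (lift a) x
  coframe_lift : ∀ a x f, L.coframe a (lift a x f) = f
  mem_D : ∀ a p (v : L.tangent p), p ∈ L.dom a →
    (v ∈ L.D p ↔ v.1 a = lift a (L.chart a p) (L.coframe a (v.1 a)))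

namespace Framed

variable {L : DistManifold d} (h : L.Framed)
include h

theorem D_ext {a : L.ι} {p : L.Pt} (ha : p ∈ L.dom a) {v w : L.D p}
    (hvw : L.coframe a (v.1.1 a) = L.coframe a (w.1.1 a)) : v = w := by
  apply Subtype.ext
  apply Atlas.Regular.tangent_ext ha
  rw [(h.mem_D a p v.1 ha).1 v.2, (h.mem_D a p w.1 ha).1 w.2, hvw]

theorem exists_D {a : L.ι} {p : L.Pt} (ha : p ∈ L.dom a) (f : Fin (d + 1) → ℂ) :
    ∃ v : L.D p, v.1.1 a = h.lift a (L.chart a p) f ∧ L.coframe a (v.1.1 a) = f := by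
  obtain ⟨v, hv⟩ := h.regular.exists_tangent ha (h.lift a (L.chart a p) f)
  exact ⟨⟨v, (h.mem_D a p v ha).2 (by rw [hv, h.coframe_lift])⟩, hv, by rw [hv, h.coframe_lift]⟩

theorem coframe_ne_zero {a : L.ι} {p : L.Pt} (ha : p ∈ L.dom a) {v : L.D p} (hv : v ≠ 0) :
    L.coframe a (v.1.1 a) ≠ 0 := fun H =>
  hv (h.D_ext ha (by rw [H]; exact (map_zero (L.coframe a)).symm))

theorem homCoord_ne_zero {a : L.ι} {q : L.ProjPt} (ha : q.base ∈ L.dom a) : L.homCoord a q ≠ 0 :=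
  h.coframe_ne_zero ha q.line.rep_nonzero

theorem apply_rep {a : L.ι} {q : L.ProjPt} (ha : q.base ∈ L.dom a) :
    q.line.rep.1.1 a = h.lift a (L.chart a q.base) (L.homCoord a q) :=
  (h.mem_D a _ q.line.rep.1 ha).1 q.line.rep.2

omit h in
theorem exists_smul_homCoord {q : L.ProjPt} {v : L.D q.base} (hv : v ∈ q.line.submodule) :
    ∃ c : ℂ, v = c • q.line.rep ∧ ∀ a, L.coframe a (v.1.1 a) = c • L.homCoord a q := by
  rw [Projectivization.submodule_eq, Submodule.mem_span_singleton] at hv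
  obtain ⟨c, rfl⟩ := hv
  exact ⟨c, rfl, fun a => map_smul (L.coframe a) c _⟩

theorem mem_line_iff {a : L.ι} {q : L.ProjPt} (ha : q.base ∈ L.dom a) {v : L.D q.base} :
    v ∈ q.line.submodule ↔ ∃ c : ℂ, L.coframe a (v.1.1 a) = c • L.homCoord a q := by
  refine ⟨fun hv => ?_, ?_⟩
  · obtain ⟨c, -, hc⟩ := exists_smul_homCoord hv
    exact ⟨c, hc a⟩
  · rintro ⟨c, hc⟩
    rw [Projectivization.submodule_eq, Submodule.mem_span_singleton]
    refine ⟨c, h.D_ext ha ?_⟩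
    rw [hc]
    exact map_smul (L.coframe a) c _

-- Homogeneous coordinates are computed from a chosen representative of the line. The choice costs
-- one nonzero scalar, which is the same in all charts.
omit h in
theorem exists_homCoord_mk {p : L.Pt} {v : L.D p} (hv : v ≠ 0) :
    ∃ c : ℂ, c ≠ 0 ∧ ∀ a, L.homCoord a ⟨p, Projectivization.mk ℂ v hv⟩ =
      c • L.coframe a (v.1.1 a) := by
  obtain ⟨c, hc⟩ := Projectivization.exists_smul_eq_mk_rep ℂ v hv
  refine ⟨c, c.ne_zero, fun a => ?_⟩
  unfold homCoord
  rw [← hc]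
  exact map_smul (L.coframe a) (c : ℂ) _

theorem exists_projPt {a : L.ι} {p : L.Pt} (ha : p ∈ L.dom a) {f : Fin (d + 1) → ℂ}
    (hf : f ≠ 0) : ∃ q : L.ProjPt, q.base = p ∧ ∃ c : ℂ, c ≠ 0 ∧ L.homCoord a q = c • f := by
  obtain ⟨v, -, hv⟩ := h.exists_D ha f
  have hv0 : v ≠ 0 := by
    rintro rfl
    exact hf (hv.symm.trans (map_zero (L.coframe a)))
  obtain ⟨c, hc, hc'⟩ := exists_homCoord_mk hv0
  exact ⟨⟨p, Projectivization.mk ℂ v hv0⟩, rfl, c, hc, by rw [hc' a, hv]⟩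

theorem projPt_ext {a : L.ι} {q q' : L.ProjPt} (ha : q.base ∈ L.dom a) (hb : q.base = q'.base)
    {c : ℂ} (hc : L.homCoord a q' = c • L.homCoord a q) : q = q' := by
  obtain ⟨p, l⟩ := q
  obtain ⟨p', l'⟩ := q'
  dsimp only at hb ha
  subst hb
  congr 1
  have hc0 : c ≠ 0 := by
    rintro rfl
    exact h.homCoord_ne_zero (q := ⟨p, l'⟩) ha (by rw [hc, zero_smul])
  rw [← Projectivization.mk_rep l, ← Projectivization.mk_rep l',
    Projectivization.mk_eq_mk_iff' _ _ _ l.rep_nonzero l'.rep_nonzero]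
  refine ⟨c⁻¹, h.D_ext ha ?_⟩
  refine (map_smul (L.coframe a) c⁻¹ _).trans ?_
  change c⁻¹ • L.homCoord a ⟨p, l'⟩ = L.homCoord a ⟨p, l⟩
  rw [hc, smul_smul, inv_mul_cancel₀ hc0, one_smul]

theorem homCoord_trans {a b : L.ι} {q : L.ProjPt} (ha : q.base ∈ L.dom a)
    (hb : q.base ∈ L.dom b) :
    L.homCoord b q = L.coframe b (fderiv ℂ (L.trans a b) (L.chart a q.base)
      (h.lift a (L.chart a q.base) (L.homCoord a q))) := by
  rw [← h.apply_rep ha, ← q.line.rep.1.2.2 a b ha hb]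
  rfl

/-- Homogeneous coordinates, with respect to the chart `b`, of the line with affine coordinates
`u` in the `i`-th chart over `a`. -/
noncomputable def changeLine (a b : L.ι) (i : Fin (d + 1)) (z : L.E × (Fin d → ℂ)) :
    Fin (d + 1) → ℂ :=
  L.coframe b (fderiv ℂ (L.trans a b) z.1 (h.lift a z.1 (affineVec i z.2)))

theorem analyticAt_changeLine {a b : L.ι} (i : Fin (d + 1)) {p : L.Pt} (ha : p ∈ L.dom a)
    (hb : p ∈ L.dom b) (u : Fin d → ℂ) :
    AnalyticAt ℂ (h.changeLine a b i) (L.chart a p, u) := by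
  have := h.regular.finiteDimensional
  have : CompleteSpace L.E := FiniteDimensional.complete ℂ L.E
  have hT := (h.regular.analyticAt_trans a b p ha hb).fderiv
  have h1 : AnalyticAt ℂ (fun z : L.E × (Fin d → ℂ) => fderiv ℂ (L.trans a b) z.1)
      (L.chart a p, u) :=
    AnalyticAt.comp (g := fderiv ℂ (L.trans a b)) (f := Prod.fst) hT analyticAt_fst
  have h2 : AnalyticAt ℂ (fun z : L.E × (Fin d → ℂ) => h.lift a z.1) (L.chart a p, u) :=
    AnalyticAt.comp (g := h.lift a) (f := Prod.fst) (h.analyticAt_lift a _) analyticAt_fst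
  have h3 : AnalyticAt ℂ (fun z : L.E × (Fin d → ℂ) => affineVec i z.2) (L.chart a p, u) :=
    AnalyticAt.comp (g := affineVec i) (f := Prod.snd) (analyticAt_affineVec i _) analyticAt_snd
  exact AnalyticAt.comp (g := (LinearMap.toContinuousLinearMap (L.coframe b)))
    (ContinuousLinearMap.analyticAt _ _) (analyticAt_clm_apply h1 (analyticAt_clm_apply h2 h3))

omit h in
theorem homCoord_eq {a : L.ι} {i : Fin (d + 1)} {q : L.ProjPt}
    (hq : q ∈ L.projAtlas.dom (a, i)) :
    L.homCoord a q = L.homCoord a q i • affineVec i (L.projAtlas.chart (a, i) q).2 :=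
  eq_smul_affineVec hq.2

theorem homCoord_trans' {a b : L.ι} {i : Fin (d + 1)} {q : L.ProjPt}
    (hq : q ∈ L.projAtlas.dom (a, i)) (hb : q.base ∈ L.dom b) :
    L.homCoord b q =
      L.homCoord a q i • h.changeLine a b i (L.projAtlas.chart (a, i) q) := by
  rw [h.homCoord_trans hq.1 hb, homCoord_eq hq]
  simp only [map_smul, affineVec_self, Pi.smul_apply, smul_eq_mul, mul_one]
  rfl

theorem exists_projPt_chart (a : L.ι) (i : Fin (d + 1)) (z : L.E × (Fin d → ℂ)) :
    ∃ q ∈ L.projAtlas.dom (a, i), L.projAtlas.chart (a, i) q = z := by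
  obtain ⟨p, hp, hpz⟩ := h.regular.surj a z.1
  obtain ⟨q, rfl, c, hc, hcq⟩ := h.exists_projPt hp (affineVec_ne_zero i z.2)
  refine ⟨q, ⟨hp, ?_⟩, Prod.ext hpz (funext fun j => ?_)⟩
  · simpa [hcq] using hc
  · change L.homCoord a q (i.succAbove j) / L.homCoord a q i = _
    simp [hcq, hc]

theorem injOn_projChart (a : L.ι) (i : Fin (d + 1)) :
    InjOn (L.projAtlas.chart (a, i)) (L.projAtlas.dom (a, i)) := by
  intro q hq q' hq' H
  have h1 : q.base = q'.base := h.regular.injOn a hq.1 hq'.1 (congrArg Prod.fst H)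
  refine h.projPt_ext (c := L.homCoord a q' i / L.homCoord a q i) hq.1 h1 ?_
  rw [homCoord_eq hq', homCoord_eq hq, H]
  simp only [affineVec_self, Pi.smul_apply, smul_eq_mul, mul_one, smul_smul]
  rw [div_mul_cancel₀ _ hq.2]

/-- This turns openness of the overlaps upstairs into openness below together with the nonvanishing
of a continuous function. -/
theorem overlap_eq (a b : L.ι) (i j : Fin (d + 1)) :
    L.projAtlas.chart (a, i) '' (L.projAtlas.dom (a, i) ∩ L.projAtlas.dom (b, j)) =
      {z : L.E × (Fin d → ℂ) | z.1 ∈ L.chart a '' (L.dom a ∩ L.dom b) ∧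
        h.changeLine a b i z j ≠ 0} := by
  apply Subset.antisymm
  · rintro _ ⟨q, ⟨hq, hq'⟩, rfl⟩
    refine ⟨⟨q.base, ⟨hq.1, hq'.1⟩, rfl⟩, fun H => hq'.2 ?_⟩
    simp [h.homCoord_trans' hq hq'.1, H]
  · rintro z ⟨⟨p, ⟨hpa, hpb⟩, hpz⟩, hz⟩
    obtain ⟨q, hq, rfl⟩ := h.exists_projPt_chart a i z
    have hqp : q.base = p := h.regular.injOn a hq.1 hpa hpz.symm
    subst hqp
    refine ⟨q, ⟨hq, hpb, ?_⟩, rfl⟩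
    change L.homCoord b q j ≠ 0
    rw [h.homCoord_trans' hq hpb]
    exact mul_ne_zero hq.2 hz

theorem isOpen_overlap_proj (a b : L.ι) (i j : Fin (d + 1)) :
    IsOpen (X := L.E × (Fin d → ℂ))
      (L.projAtlas.chart (a, i) '' (L.projAtlas.dom (a, i) ∩ L.projAtlas.dom (b, j))) := by
  suffices H : IsOpen {z : L.E × (Fin d → ℂ) | z.1 ∈ L.chart a '' (L.dom a ∩ L.dom b) ∧
      h.changeLine a b i z j ≠ 0} from
    (congrArg (IsOpen (X := L.E × (Fin d → ℂ))) (h.overlap_eq a b i j)).mpr H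
  rw [isOpen_iff_mem_nhds]
  rintro ⟨x, u⟩ ⟨⟨p, ⟨hpa, hpb⟩, rfl⟩, hz⟩
  have hc := (h.analyticAt_changeLine i hpa hpb u).continuousAt
  have hc' := (continuous_apply j).continuousAt.comp hc
  refine Filter.inter_mem ?_ (hc'.eventually_ne hz)
  exact continuousAt_fst ((h.regular.isOpen_overlap a b).mem_nhds ⟨p, ⟨hpa, hpb⟩, rfl⟩)

-- Only injectivity of the charts enters: the regularity of `projAtlas` is not yet available, and
-- this identity is used to prove it.
omit h in
theorem projAtlas_trans_chart (h : L.Framed) {a b : L.ι} {i j : Fin (d + 1)} {q : L.ProjPt}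
    (hq : q ∈ L.projAtlas.dom (a, i)) :
    L.projAtlas.trans (a, i) (b, j) (L.projAtlas.chart (a, i) q) = L.projAtlas.chart (b, j) q := by
  have hinj : Function.Injective
      (fun q : L.projAtlas.dom (a, i) => L.projAtlas.chart (a, i) q) :=
    fun x y hxy => Subtype.ext (h.injOn_projChart a i x.2 y.2 hxy)
  exact hinj.extend_apply (fun q : L.projAtlas.dom (a, i) => L.projAtlas.chart (b, j) q) 0 ⟨q, hq⟩

/-- The unknown scale of the representative cancels in the quotients, leaving a formula that is
visibly analytic. -/
theorem eventually_projTrans {a b : L.ι} {i j : Fin (d + 1)} {q : L.ProjPt}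
    (hq : q ∈ L.projAtlas.dom (a, i)) (hq' : q ∈ L.projAtlas.dom (b, j)) :
    ∀ᶠ z : L.E × (Fin d → ℂ) in 𝓝 (L.projAtlas.chart (a, i) q),
      L.projAtlas.trans (a, i) (b, j) z = (L.trans a b z.1, fun k =>
        h.changeLine a b i z (j.succAbove k) / h.changeLine a b i z j) := by
  filter_upwards [(h.isOpen_overlap_proj a b i j).mem_nhds ⟨q, ⟨hq, hq'⟩, rfl⟩]
  rintro _ ⟨r, ⟨hr, hr'⟩, rfl⟩
  rw [projAtlas_trans_chart h hr]
  refine Prod.ext (h.regular.trans_chart hr.1).symm (funext fun k => ?_)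
  change L.homCoord b r (j.succAbove k) / L.homCoord b r j = _
  rw [h.homCoord_trans' hr hr'.1]
  simp only [Pi.smul_apply, smul_eq_mul]
  exact mul_div_mul_left _ _ hr.2

theorem regular_prolong : L.projAtlas.Regular where
  finiteDimensional := by
    have := h.regular.finiteDimensional
    exact (inferInstance : FiniteDimensional ℂ (L.E × (Fin d → ℂ)))
  cover q := by
    obtain ⟨a, ha⟩ := h.regular.cover q.base
    obtain ⟨i, hi⟩ := Function.ne_iff.1 (h.homCoord_ne_zero ha)
    exact ⟨(a, i), ha, hi⟩
  injOn := fun a => h.injOn_projChart a.1 a.2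
  surj := fun a => h.exists_projPt_chart a.1 a.2
  isOpen_overlap := fun a b => h.isOpen_overlap_proj a.1 b.1 a.2 b.2
  analyticAt_trans := by
    rintro ⟨a, i⟩ ⟨b, j⟩ q hq hq'
    have hne : h.changeLine a b i (L.projAtlas.chart (a, i) q) j ≠ 0 := fun H => hq'.2 (by
      change L.homCoord b q j = 0
      rw [h.homCoord_trans' hq hq'.1, Pi.smul_apply, H, smul_zero])
    have hcl := h.analyticAt_changeLine i hq.1 hq'.1 (L.projAtlas.chart (a, i) q).2
    have hcl' := analyticAt_pi_iff.1 hcl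
    have h1 : AnalyticAt ℂ (fun z : L.E × (Fin d → ℂ) => L.trans a b z.1)
        (L.chart a q.base, (L.projAtlas.chart (a, i) q).2) :=
      AnalyticAt.comp (g := L.trans a b) (f := Prod.fst)
        (h.regular.analyticAt_trans a b _ hq.1 hq'.1) analyticAt_fst
    have h2 : AnalyticAt ℂ (fun z : L.E × (Fin d → ℂ) => fun k =>
        h.changeLine a b i z (j.succAbove k) / h.changeLine a b i z j)
        (L.chart a q.base, (L.projAtlas.chart (a, i) q).2) :=
      AnalyticAt.pi fun k => (hcl' _).div (hcl' _) hne
    exact (h1.prod h2).congr ((h.eventually_projTrans hq hq').mono fun z hz => hz.symm)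

/-- The frame of the prolonged distribution. -/
noncomputable def liftProlong (a : L.ι) (i : Fin (d + 1)) (z : L.E × (Fin d → ℂ)) :
    (Fin (d + 1) → ℂ) →L[ℂ] L.E × (Fin d → ℂ) :=
  ((ContinuousLinearMap.proj i).smulRight (h.lift a z.1 (affineVec i z.2))).prod
    (ContinuousLinearMap.pi fun j => ContinuousLinearMap.proj (i.succAbove j))

theorem liftProlong_apply (a : L.ι) (i : Fin (d + 1)) (z : L.E × (Fin d → ℂ))
    (f : Fin (d + 1) → ℂ) :
    h.liftProlong a i z f = (h.lift a z.1 (f i • affineVec i z.2), fun j => f (i.succAbove j)) := by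
  rw [map_smul]
  rfl

theorem analyticAt_liftProlong (a : L.ι) (i : Fin (d + 1)) (z : L.E × (Fin d → ℂ)) :
    AnalyticAt ℂ (h.liftProlong a i) z := by
  have h2 : AnalyticAt ℂ (fun z : L.E × (Fin d → ℂ) => h.lift a z.1) z :=
    AnalyticAt.comp (g := h.lift a) (f := Prod.fst) (h.analyticAt_lift a _) analyticAt_fst
  have h3 : AnalyticAt ℂ (fun z : L.E × (Fin d → ℂ) => affineVec i z.2) z :=
    AnalyticAt.comp (g := affineVec i) (f := Prod.snd) (analyticAt_affineVec i _) analyticAt_snd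
  let Λ : L.E →L[ℂ] ((Fin (d + 1) → ℂ) →L[ℂ] L.E × (Fin d → ℂ)) :=
    (ContinuousLinearMap.compL ℂ (Fin (d + 1) → ℂ) L.E (L.E × (Fin d → ℂ))
      (ContinuousLinearMap.inl ℂ L.E (Fin d → ℂ))).comp
      (ContinuousLinearMap.smulRightL ℂ (Fin (d + 1) → ℂ) L.E (ContinuousLinearMap.proj i))
  let C : (Fin (d + 1) → ℂ) →L[ℂ] L.E × (Fin d → ℂ) :=
    (ContinuousLinearMap.inr ℂ L.E (Fin d → ℂ)).comp
      (ContinuousLinearMap.pi fun j => ContinuousLinearMap.proj (i.succAbove j))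
  have h4 : h.liftProlong a i = fun z => Λ (h.lift a z.1 (affineVec i z.2)) + C := by
    funext z
    ext1 f
    simp [liftProlong, Λ, C]
  rw [h4]
  exact (AnalyticAt.comp (g := Λ) (Λ.analyticAt _) (analyticAt_clm_apply h2 h3)).add
    analyticAt_const

/-- The base part of a transition depends on the base coordinates alone. Hence `ProjectsTo` can be
tested in one chart. -/
theorem fst_trans_tangent {q : L.ProjPt} (v : L.projAtlas.tangent q) {a b : L.ι}
    {i j : Fin (d + 1)} (hq : q ∈ L.projAtlas.dom (a, i)) (hq' : q ∈ L.projAtlas.dom (b, j)) :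
    (v.1 (b, j)).1 = fderiv ℂ (L.trans a b) (L.chart a q.base) (v.1 (a, i)).1 := by
  rw [v.2.2 (a, i) (b, j) hq hq']
  have hd : DifferentiableAt ℂ (E := L.E × (Fin d → ℂ)) (F := L.E × (Fin d → ℂ))
      (L.projAtlas.trans (a, i) (b, j)) (L.projAtlas.chart (a, i) q) :=
    h.regular_prolong.differentiableAt_trans hq hq'
  have hev : (fun z : L.E × (Fin d → ℂ) => (L.projAtlas.trans (a, i) (b, j) z).1)
      =ᶠ[𝓝 (L.projAtlas.chart (a, i) q)] fun z => L.trans a b z.1 :=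
    (h.eventually_projTrans hq hq').mono fun z hz => congrArg Prod.fst hz
  have h1 := hd.hasFDerivAt.fst
  have h2 : HasFDerivAt (fun z : L.E × (Fin d → ℂ) => L.trans a b z.1) _
      (L.projAtlas.chart (a, i) q) :=
    HasFDerivAt.comp (g := L.trans a b) (f := Prod.fst) (x := L.projAtlas.chart (a, i) q)
      (h.regular.differentiableAt_trans hq.1 hq'.1).hasFDerivAt hasFDerivAt_fst
  have h3 := h1.unique (h2.congr_of_eventuallyEq hev)
  exact congrArg (fun T : (L.E × (Fin d → ℂ)) →L[ℂ] L.E => T (v.1 (a, i))) h3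

theorem projectsTo_iff {q : L.ProjPt} {a : L.ι} {i : Fin (d + 1)}
    (hq : q ∈ L.projAtlas.dom (a, i)) {v : L.projAtlas.tangent q} {w : L.tangent q.base} :
    L.ProjectsTo q v w ↔ (v.1 (a, i)).1 = w.1 a := by
  refine ⟨fun H => H (a, i) hq, fun H => ?_⟩
  rintro ⟨b, j⟩ hb
  rw [h.fst_trans_tangent v hq hb, H, w.2.2 a b hq.1 hb.1]

/-- The prolongation of a framed manifold. -/
noncomputable def prolong : L.prolong.Framed where
  regular := h.regular_prolong
  lift := fun a => h.liftProlong a.1 a.2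
  analyticAt_lift := fun a => h.analyticAt_liftProlong a.1 a.2
  coframe_lift := by
    rintro ⟨a, i⟩ z f
    refine (congrArg (L.prolongCoframe (a, i)) (h.liftProlong_apply a i z f)).trans ?_
    funext j
    induction j using i.succAboveCases with
    | x => simp [prolongCoframe, h.coframe_lift]
    | p j => simp [prolongCoframe]
  mem_D := by
    rintro ⟨a, i⟩ (q : L.ProjPt) (v : L.projAtlas.tangent q) hq
    have hq' : q ∈ L.projAtlas.dom (a, i) := hq
    change v ∈ L.prolongD q ↔ _
    have key : L.prolongCoframe (a, i) (v.1 (a, i)) i = L.coframe a (v.1 (a, i)).1 i := by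
      simp [prolongCoframe]
    have key2 : ∀ j, L.prolongCoframe (a, i) (v.1 (a, i)) (i.succAbove j) = (v.1 (a, i)).2 j := by
      simp [prolongCoframe]
    change (∃ w ∈ q.line.submodule, L.ProjectsTo q v w) ↔
      v.1 (a, i) = h.liftProlong a i (L.projAtlas.chart (a, i) q)
        (L.prolongCoframe (a, i) (v.1 (a, i)))
    have key3 := h.liftProlong_apply a i (L.projAtlas.chart (a, i) q)
      (L.prolongCoframe (a, i) (v.1 (a, i)))
    simp only [key, key2] at key3
    refine Iff.trans ?_ (Eq.congr_right key3).symm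
    simp only [h.projectsTo_iff hq']
    constructor
    · rintro ⟨w, hw, H⟩
      obtain ⟨c, hc⟩ := (h.mem_line_iff hq'.1).1 hw
      refine Prod.ext ?_ rfl
      rw [homCoord_eq hq', smul_smul] at hc
      have hc' := congrFun hc i
      simp only [Pi.smul_apply, affineVec_self, smul_eq_mul, mul_one] at hc'
      -- The `i`-th entry of `affineVec` is one, so the unknown multiple is the slot value itself.
      rw [← hc'] at hc
      change (v.1 (a, i)).1 = h.lift a (L.chart a q.base) _
      rw [H, ← hc]
      exact (h.mem_D a _ w.1 hq'.1).1 w.2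
    · intro H
      obtain ⟨w, hw, hw'⟩ := h.exists_D hq'.1
        (L.coframe a (v.1 (a, i)).1 i • affineVec i (L.projAtlas.chart (a, i) q).2)
      refine ⟨w, (h.mem_line_iff hq'.1).2 ?_, ?_⟩
      · refine ⟨L.coframe a (v.1 (a, i)).1 i / L.homCoord a q i, ?_⟩
        rw [hw', homCoord_eq hq', smul_smul]
        simp only [affineVec_self, Pi.smul_apply, smul_eq_mul, mul_one]
        rw [div_mul_cancel₀ _ hq'.2]
      · rw [hw]
        exact congrArg Prod.fst H

end Framed

end DistManifold

/-! ### Tangency to submanifolds that are linear in a chart -/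

namespace Atlas.Regular

variable {M : Atlas} (hM : M.Regular)
include hM

/-- The baby Monsters that matter are linear in suitable charts, so a straight coordinate line
serves as the curve witnessing tangency. -/
theorem isTangentTo_of_line {B : Set M.Pt} {q : M.Pt} {a : M.ι} (hq : q ∈ M.dom a)
    {v : M.tangent q} (hB : ∀ t : ℂ, hM.point a (M.chart a q + t • v.1 a) ∈ B) :
    M.IsTangentTo B q v := by
  have hd : ∀ t : ℂ, HasDerivAt (fun t : ℂ => M.chart a q + t • v.1 a) (v.1 a) t := fun t => by
    simpa using ((hasDerivAt_id t).smul_const (v.1 a)).const_add (M.chart a q)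
  have hchart : (fun t : ℂ => M.chart a (hM.point a (M.chart a q + t • v.1 a))) =
      fun t => M.chart a q + t • v.1 a := funext fun t => hM.chart_point a _
  refine ⟨fun t => hM.point a (M.chart a q + t • v.1 a),
    ⟨a, .of_forall fun t => hM.point_mem a _, ?_⟩, .of_forall hB,
    hM.hasVelocity_of_chart ?_ (.of_forall fun t => hM.point_mem a _) ?_⟩
  · rw [hchart]
    exact analyticAt_const.add (analyticAt_id.smul analyticAt_const)
  · simp [hM.point_chart hq]
  · rw [hchart]
    exact hd 0

theorem apply_eq_zero_of_isTangentTo {B : Set M.Pt} {q : M.Pt} {a : M.ι} (hq : q ∈ M.dom a)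
    {v : M.tangent q} (hv : M.IsTangentTo B q v) {F : Type*} [NormedAddCommGroup F]
    [NormedSpace ℂ F] (φ : M.E →L[ℂ] F) (hφ : ∀ r ∈ B, r ∈ M.dom a → φ (M.chart a r) =
      φ (M.chart a q)) : φ (v.1 a) = 0 := by
  obtain ⟨c, hc, hcB, rfl, hcv⟩ := hv
  have h1 := (φ.hasFDerivAt.comp_hasDerivAt (0 : ℂ) (hcv a hq))
  refine h1.unique ((hasDerivAt_const (0 : ℂ) (φ (M.chart a (c 0)))).congr_of_eventuallyEq ?_)
  filter_upwards [hcB, hM.eventually_mem hc hq] with t ht ht'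
  exact hφ _ ht ht'

end Atlas.Regular

theorem Atlas.isZariskiClosed_of_linear_pair {M : Atlas} {Z : Set M.Pt}
    (h : ∀ a, (∀ p ∈ M.dom a, p ∉ Z) ∨ ∃ φ ψ : M.E →ₗ[ℂ] ℂ, ∀ p ∈ M.dom a,
      p ∈ Z ↔ φ (M.chart a p) = 0 ∧ ψ (M.chart a p) = 0) : M.IsZariskiClosed Z := by
  intro a
  rcases h a with h | ⟨φ, ψ, h⟩
  · exact ⟨{1}, by simp, fun p hp => by simp [h p hp]⟩
  · refine ⟨{(φ : M.E → ℂ), (ψ : M.E → ℂ)}, ?_, fun p hp => by simp [h p hp]⟩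
    rintro _ (rfl | rfl)
    · exact linear_mem_polynomialFunctions φ
    · exact linear_mem_polynomialFunctions ψ

/-! ### Vertical and tangent directions in homogeneous coordinates -/

namespace DistManifold

variable {d : ℕ}

theorem prolongCoframe_self {L : DistManifold d} (a : L.ι × Fin (d + 1))
    (z : L.E × (Fin d → ℂ)) : L.prolongCoframe a z a.2 = L.coframe a.1 z.1 a.2 := by
  simp [prolongCoframe]

theorem prolongCoframe_succAbove {L : DistManifold d} (a : L.ι × Fin (d + 1))
    (z : L.E × (Fin d → ℂ)) (j : Fin d) : L.prolongCoframe a z (a.2.succAbove j) = z.2 j := by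
  simp [prolongCoframe]

/-- A line at a point of a prolongation is vertical if it projects to zero. -/
def ProjPt.Vertical {L : DistManifold d} (r : L.prolong.ProjPt) : Prop :=
  ∀ v ∈ r.line.submodule, L.ProjectsTo r.base v.1 0

namespace Framed

variable {L : DistManifold d} (h : L.Framed)
include h

omit h in
theorem isZariskiClosed_preimage_base {Z : Set L.Pt} (hZ : L.IsZariskiClosed Z) :
    L.projAtlas.IsZariskiClosed {q : L.ProjPt | q.base ∈ Z} := by
  rintro ⟨a, i⟩
  obtain ⟨F, hF, hFZ⟩ := hZ a
  refine ⟨{g | ∃ f ∈ F, g = fun z : L.E × (Fin d → ℂ) => f z.1}, ?_, fun q hq => ?_⟩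
  · rintro _ ⟨f, hf, rfl⟩
    have H : ∀ f ∈ L.polynomialFunctions,
        (fun z : L.E × (Fin d → ℂ) => f z.1) ∈ L.projAtlas.polynomialFunctions := by
      intro f hf
      refine Algebra.adjoin_induction (p := fun f _ => (fun z : L.E × (Fin d → ℂ) => f z.1) ∈
        L.projAtlas.polynomialFunctions) ?_ ?_ ?_ ?_ hf
      · rintro _ ⟨φ, rfl⟩
        exact Atlas.linear_mem_polynomialFunctions (M := L.projAtlas)
          (φ ∘ₗ LinearMap.fst ℂ L.E (Fin d → ℂ))
      · intro r
        exact algebraMap_mem L.projAtlas.polynomialFunctions r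
      · intro f g _ _ hf hg
        exact add_mem hf hg
      · intro f g _ _ hf hg
        exact mul_mem hf hg
    exact H f (hF hf)
  · refine (hFZ _ hq.1).trans ⟨?_, fun H f hf => H _ ⟨f, hf, rfl⟩⟩
    rintro H _ ⟨f, hf, rfl⟩
    exact H f hf

omit h in
theorem homCoord_eq_zero_iff {a : L.ι} {i s : Fin (d + 1)} {q : L.ProjPt}
    (hq : q ∈ L.projAtlas.dom (a, i)) :
    L.homCoord a q s = 0 ↔ affineVec i (L.projAtlas.chart (a, i) q).2 s = 0 := by
  rw [homCoord_eq hq]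
  simp [hq.2]

theorem fst_apply {q : L.ProjPt} {a : L.ι} {i : Fin (d + 1)} (hq : q ∈ L.projAtlas.dom (a, i))
    (v : L.prolongD q) : (v.1.1 (a, i)).1 = h.lift a (L.chart a q.base)
      (L.prolongCoframe (a, i) (v.1.1 (a, i)) i • affineVec i (L.projAtlas.chart (a, i) q).2) := by
  have h1 := (h.prolong.mem_D (a, i) q v.1 hq).1 v.2
  exact (congrArg Prod.fst h1).trans (congrArg Prod.fst (h.liftProlong_apply a i _ _))

theorem projectsTo_zero_iff {q : L.ProjPt} {a : L.ι} {i : Fin (d + 1)}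
    (hq : q ∈ L.projAtlas.dom (a, i)) (v : L.prolongD q) :
    L.ProjectsTo q v.1 0 ↔ L.prolongCoframe (a, i) (v.1.1 (a, i)) i = 0 := by
  rw [h.projectsTo_iff hq]
  refine ⟨fun H => ?_, fun H => ?_⟩
  · refine (prolongCoframe_self (a, i) _).trans ?_
    have : (v.1.1 (a, i)).1 = 0 := H
    refine (congrArg (fun e => L.coframe a e i) this).trans ?_
    simp
  · rw [h.fst_apply hq, H, zero_smul, map_zero]
    rfl

/-- Slot `i` of the prolonged coframe is the pulled back `i`-th form, which is nonzero on the line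
`r.base`. A vector of the prolonged distribution projects into that line, so it projects to zero
exactly when this form kills it. -/
theorem vertical_iff {r : L.prolong.ProjPt} {a : L.ι} {i : Fin (d + 1)}
    (hr : r.base ∈ L.projAtlas.dom (a, i)) :
    r.Vertical ↔ L.prolong.homCoord (a, i) r i = 0 := by
  refine ⟨fun H => ?_, fun H v hv => (h.projectsTo_zero_iff hr v).2 ?_⟩
  · refine (h.projectsTo_zero_iff hr r.line.rep).1 (H _ ?_)
    rw [Projectivization.submodule_eq]
    exact Submodule.mem_span_singleton_self _
  · obtain ⟨c, -, hc⟩ := exists_smul_homCoord hv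
    have := congrFun (hc (a, i)) i
    exact this.trans (by rw [Pi.smul_apply, H, smul_zero])

theorem isTangentTo_fiber_iff {q : L.ProjPt} (v : L.projAtlas.tangent q) :
    L.projAtlas.IsTangentTo {q' | q'.base = q.base} q v ↔ L.ProjectsTo q v 0 := by
  obtain ⟨⟨a, i⟩, ha⟩ := h.regular_prolong.cover q
  rw [h.projectsTo_iff ha]
  refine ⟨fun H => ?_, fun H => ?_⟩
  · refine h.regular_prolong.apply_eq_zero_of_isTangentTo ha H
      (ContinuousLinearMap.fst ℂ L.E (Fin d → ℂ)) fun r hr hr' => ?_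
    change L.chart a r.base = L.chart a q.base
    rw [show r.base = q.base from hr]
  · refine h.regular_prolong.isTangentTo_of_line ha fun t => ?_
    have hm := h.regular_prolong.point_mem (a, i) (L.projAtlas.chart (a, i) q + t • v.1 (a, i))
    refine h.regular.injOn a hm.1 ha.1 ?_
    refine (congrArg Prod.fst (h.regular_prolong.chart_point (a, i)
      (L.projAtlas.chart (a, i) q + t • v.1 (a, i)))).trans ?_
    change L.chart a q.base + t • (v.1 (a, i)).1 = L.chart a q.base
    rw [H]
    change L.chart a q.base + t • (0 : L.E) = L.chart a q.base
    simp

/-- At a vertical point the last slot `i'` differs from `i`, so the `i`-th homogeneous coordinate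
divided by the `i'`-th is a genuine fiber coordinate, and the vertical locus is its zero set.
Staying over the same point two levels below costs nothing to first order; the vanishing of the
differential of that coordinate is the only condition. -/
theorem isTangentTo_vertical_iff {r : L.prolong.ProjPt} {a : L.ι} {i i' : Fin (d + 1)}
    (hr : r ∈ L.prolong.projAtlas.dom ((a, i), i')) (hV : r.Vertical) (v : L.prolong.prolongD r) :
    L.prolong.projAtlas.IsTangentTo {r' | r'.base.base = r.base.base ∧ r'.Vertical} r v.1 ↔
      L.prolong.prolongCoframe ((a, i), i') (v.1.1 ((a, i), i')) i = 0 := by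
  have hV0 := (h.vertical_iff hr.1).1 hV
  have hii : i' ≠ i := by
    rintro rfl
    exact hr.2 hV0
  obtain ⟨j, rfl⟩ := Fin.exists_succAbove_eq hii.symm
  have hcoord : ∀ r' : L.prolong.ProjPt, r' ∈ L.prolong.projAtlas.dom ((a, i'.succAbove j), i') →
      (r'.Vertical ↔ (L.prolong.projAtlas.chart ((a, i'.succAbove j), i') r').2 j = 0) := by
    intro r' hr'
    rw [h.vertical_iff hr'.1, homCoord_eq_zero_iff hr', affineVec_succAbove]
  have hj0 := (hcoord r hr).1 hV
  have hself := prolongCoframe_succAbove (L := L.prolong) ((a, i'.succAbove j), i')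
    (v.1.1 ((a, i'.succAbove j), i')) j
  refine Iff.trans ?_ (Eq.congr_left hself).symm
  refine ⟨fun H => ?_, fun H => ?_⟩
  · refine h.prolong.regular_prolong.apply_eq_zero_of_isTangentTo hr H
      ((ContinuousLinearMap.proj j).comp
        (ContinuousLinearMap.snd ℂ (L.E × (Fin d → ℂ)) (Fin d → ℂ))) ?_
    intro r' hr' hr''
    exact ((hcoord r' hr'').1 hr'.2).trans hj0.symm
  · refine h.prolong.regular_prolong.isTangentTo_of_line hr fun t => ?_
    have hm := h.prolong.regular_prolong.point_mem ((a, i'.succAbove j), i')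
      (L.prolong.projAtlas.chart ((a, i'.succAbove j), i') r + t • v.1.1 ((a, i'.succAbove j), i'))
    have hc := h.prolong.regular_prolong.chart_point ((a, i'.succAbove j), i')
      (L.prolong.projAtlas.chart ((a, i'.succAbove j), i') r + t • v.1.1 ((a, i'.succAbove j), i'))
    have h1 := h.prolong.fst_apply hr v
    -- The vector projects to a multiple of the vertical line `r`, and that projects to zero.
    have h2 : (v.1.1 ((a, i'.succAbove j), i')).1.1 = (0 : L.E) := by
      rw [h1]
      have h3 := h.liftProlong_apply a (i'.succAbove j) (L.projAtlas.chart (a, i'.succAbove j)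
        r.base) (L.prolong.prolongCoframe ((a, i'.succAbove j), i')
          (v.1.1 ((a, i'.succAbove j), i')) i' • affineVec i'
            (L.prolong.projAtlas.chart ((a, i'.succAbove j), i') r).2)
      refine (congrArg Prod.fst h3).trans ?_
      simp only [Pi.smul_apply, affineVec_succAbove, hj0, smul_zero, zero_smul, map_zero]
    constructor
    · refine h.regular.injOn a hm.1.1 hr.1.1 ?_
      refine (congrArg (fun z : (L.E × (Fin d → ℂ)) × (Fin d → ℂ) => z.1.1) hc).trans ?_
      change L.chart a r.base.base + t • (v.1.1 ((a, i'.succAbove j), i')).1.1 =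
        L.chart a r.base.base
      rw [h2]
      simp
    · rw [hcoord _ hm]
      refine (congrArg (fun z : (L.E × (Fin d → ℂ)) × (Fin d → ℂ) => z.2 j) hc).trans ?_
      change (L.prolong.projAtlas.chart ((a, i'.succAbove j), i') r).2 j +
        t * (v.1.1 ((a, i'.succAbove j), i')).2 j = 0
      rw [hj0, H]
      simp

end Framed

end DistManifold

/-- The standard framing of `ℂⁿ`. -/
noncomputable def affineSpaceFramed (d : ℕ) : (affineSpace d).Framed where
  regular :=
    { finiteDimensional := (inferInstance : FiniteDimensional ℂ (Fin (d + 1) → ℂ))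
      cover := fun _ => ⟨(), trivial⟩
      injOn := fun _ => injOn_id _
      surj := fun _ x => ⟨x, trivial, rfl⟩
      isOpen_overlap := fun _ _ => by
        have : (fun p : Fin (d + 1) → ℂ => p) '' (univ ∩ univ) = univ := by simp
        exact (congrArg (IsOpen (X := Fin (d + 1) → ℂ)) this).mpr isOpen_univ
      analyticAt_trans := fun a b p _ _ => by
        have : (affineSpace d).trans a b = (id : (Fin (d + 1) → ℂ) → (Fin (d + 1) → ℂ)) := by
          funext x
          have hinj : Function.Injective (fun q : (univ : Set (Fin (d + 1) → ℂ)) => q.1) :=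
            Subtype.val_injective
          exact hinj.extend_apply (fun q : (univ : Set (Fin (d + 1) → ℂ)) => q.1) 0 ⟨x, trivial⟩
        rw [this]
        exact analyticAt_id }
  lift := fun _ _ => ContinuousLinearMap.id ℂ (Fin (d + 1) → ℂ)
  analyticAt_lift := fun _ _ => analyticAt_const
  coframe_lift := fun _ _ _ => rfl
  mem_D := fun _ _ _ _ => ⟨fun _ => rfl, fun _ => trivial⟩

namespace Monster

variable {d : ℕ}

/-- The levels of the Monster tower are framed. -/
noncomputable def framed (d : ℕ) : (k : ℕ) → (Monster d k).Framed
  | 0 => affineSpaceFramed d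
  | k + 1 => (framed d k).prolong

end Monster

/-! ### Critical directions and the words `RᵏVR^q` -/

namespace Monster

open DistManifold DistManifold.Framed

variable {d : ℕ}

theorem isVertical_iff_homCoord {m : ℕ} {q : (Monster d (m + 2)).Pt} {a : (Monster d m).ι}
    {i : Fin (d + 1)} (hq : down q ∈ (Monster d (m + 1)).dom (a, i)) :
    IsVertical (m + 2) q ↔ (Monster d (m + 1)).homCoord (a, i) q i = 0 :=
  (framed d m).vertical_iff (r := q) hq

/-- The line of the point is tangent to the locus of vertical points over a fiber. -/
def IsTan : (m : ℕ) → (Monster d m).Pt → Prop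
  | 0, _ => False
  | 1, _ => False
  | 2, _ => False
  | m + 3, q => IsVertical (m + 2) (down q) ∧ ∀ v ∈ (line q).submodule,
      (Monster d (m + 2)).IsTangentTo
        {r | down (down r) = down (down (down q)) ∧ IsVertical (m + 2) r} (down q) v

theorem isTan_iff_homCoord {m : ℕ} {q : (Monster d (m + 3)).Pt} {a : (Monster d m).ι}
    {i i' : Fin (d + 1)} (hq : down q ∈ (Monster d (m + 2)).dom ((a, i), i')) :
    IsTan (m + 3) q ↔ (Monster d (m + 1)).homCoord (a, i) (down q) i = 0 ∧
      (Monster d (m + 2)).homCoord ((a, i), i') q i = 0 := by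
  have hV := isVertical_iff_homCoord (q := down q) (a := a) (i := i) hq.1
  rw [← hV]
  refine and_congr_right fun hv => ?_
  have key := fun v => (framed d m).isTangentTo_vertical_iff (r := down q) hq hv v
  refine ⟨fun H => ?_, fun H v hvl => (key v).2 ?_⟩
  · refine (key (line q).rep).1 (H _ ?_)
    rw [Projectivization.submodule_eq]
    exact Submodule.mem_span_singleton_self _
  · obtain ⟨c, -, hc⟩ := exists_smul_homCoord hvl
    have := congrFun (hc ((a, i), i')) i
    exact this.trans (by rw [Pi.smul_apply]; exact (congrArg (c • ·) H).trans (smul_zero c))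

theorem IsTan.vertical {m : ℕ} {q : (Monster d (m + 1)).Pt} (h : IsTan (m + 1) q) :
    IsVertical m (down q) := by
  rcases m with _ | _ | m
  · exact h
  · exact h
  · exact h.1

theorem IsVertical.isCritical {m : ℕ} {q : (Monster d m).Pt} (h : IsVertical m q) :
    IsCritical m q := by
  rcases m with _ | _ | m
  · exact h
  · exact h.elim
  · exact ⟨_, IsBaby.fiber m (down q), rfl, fun v hv =>
      ((framed d m).isTangentTo_fiber_iff (q := down q) v.1).2 (h v hv)⟩

/-- Membership of `p` in a prolonged baby says that the line of `p` lies in a critical hyperplane.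
-/
theorem isBaby_eq_fiber {m : ℕ} {p : (Monster d (m + 1)).Pt} (hp : ¬ IsCritical (m + 1) p)
    {B : Set (Monster d (m + 1)).Pt} (hB : IsBaby (m + 1) B) (hpB : p ∈ B) :
    B = {q | down q = down p} := by
  cases hB with
  | fiber i p' =>
    have : down p = down p' := hpB
    rw [this]
  | prolong m B hB => exact (hp ⟨B, hB, hpB⟩).elim

theorem not_isBaby_zero {B : Set (Monster d 0).Pt} (hB : IsBaby 0 B) : False := by
  cases hB

theorem isCritical_iff_isVertical {m : ℕ} {q : (Monster d (m + 2)).Pt}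
    (hq : ¬ IsCritical (m + 1) (down q)) : IsCritical (m + 2) q ↔ IsVertical (m + 2) q := by
  refine ⟨?_, IsVertical.isCritical⟩
  rintro ⟨B, hB, hqB, H⟩
  rw [isBaby_eq_fiber hq hB hqB] at H
  exact fun v hv => ((framed d m).isTangentTo_fiber_iff (q := down q) v.1).1 (H v hv)

/-- Lines tangent to a fiber are the vertical lines; this matches the inductive definition of babies
with the locus in `IsTan`. -/
theorem setOf_prolong_fiber {m : ℕ} (p : (Monster d (m + 1)).Pt) :
    {r : (Monster d (m + 2)).Pt | down r ∈ {q | down q = down p} ∧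
      ∀ v ∈ (line r).submodule, (Monster d (m + 1)).IsTangentTo {q | down q = down p} (down r) v} =
    {r | down (down r) = down p ∧ IsVertical (m + 2) r} := by
  ext r
  refine and_congr_right fun hr => ?_
  have hr' : down (down r) = down p := hr
  rw [← hr']
  exact forall₂_congr fun v _ => (framed d m).isTangentTo_fiber_iff (q := down r) v.1

/-- Two levels above a regular point a baby is a fiber or the prolongation of a baby through the
regular point, which must be the fiber there. If the intermediate point is itself regular, only
verticality remains. -/
theorem isCritical_iff {m : ℕ} {q : (Monster d (m + 3)).Pt}
    (hq : ¬ IsCritical (m + 1) (down (down q))) :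
    IsCritical (m + 3) q ↔ IsVertical (m + 3) q ∨ IsTan (m + 3) q := by
  constructor
  · intro H
    by_cases hc : IsCritical (m + 2) (down q)
    · have hv := (isCritical_iff_isVertical hq).1 hc
      obtain ⟨B, hB, hqB, H⟩ := H
      change IsBaby (m + 2) B at hB
      cases hB with
      | fiber i p' =>
        left
        have : down (down q) = down p' := hqB
        rw [← this] at H
        exact fun v hv => ((framed d (m + 1)).isTangentTo_fiber_iff (q := down q) v.1).1 (H v hv)
      | prolong _ B hB =>
        right
        refine ⟨hv, ?_⟩
        have h1 := isBaby_eq_fiber hq hB hqB.1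
        subst h1
        have h2 := setOf_prolong_fiber (down (down q))
        intro v hv
        have := H v hv
        rwa [h2] at this
    · exact .inl ((isCritical_iff_isVertical hc).1 H)
  · rintro (H | ⟨hv, H⟩)
    · exact H.isCritical
    · rw [← setOf_prolong_fiber (down (down q))] at H
      exact ⟨_, IsBaby.prolong _ _ (IsBaby.fiber m (down (down q))),
        ⟨rfl, fun v hvl => ((framed d m).isTangentTo_fiber_iff (q := down (down q)) v.1).2
          (hv v hvl)⟩, H⟩

theorem letter_eq_R {k : ℕ} {q : (Monster d k).Pt} :
    letter k q = Letter.R ↔ ¬ IsCritical k q := by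
  unfold letter
  by_cases h : IsVertical k q
  · simp [h, h.isCritical]
  · by_cases h' : IsCritical k q <;> simp [h, h']

theorem letter_eq_V {k : ℕ} {q : (Monster d k).Pt} : letter k q = Letter.V ↔ IsVertical k q := by
  unfold letter
  by_cases h : IsVertical k q
  · simp [h]
  · by_cases h' : IsCritical k q <;> simp [h, h']

/-- No point below is vertical. -/
def NonVertical : (m : ℕ) → (Monster d m).Pt → Prop
  | 0, _ => True
  | m + 1, q => NonVertical m (down q) ∧ ¬ IsVertical (m + 1) q

/-- Over a regular point critical means vertical, so by induction the letter T cannot appear before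
a V. -/
theorem NonVertical.not_isCritical {m : ℕ} {q : (Monster d m).Pt} (h : NonVertical m q) :
    ¬ IsCritical m q := by
  induction m with
  | zero => exact id
  | succ m ih =>
    rcases m with _ | m
    · rintro ⟨B, hB, -⟩
      exact not_isBaby_zero hB
    · rw [isCritical_iff_isVertical (ih h.1)]
      exact h.2

/-- Only the point at level `k + 1` is vertical, and the next line is not tangent to the vertical
locus. -/
def OnlyVertical (k : ℕ) : (m : ℕ) → (Monster d m).Pt → Prop
  | 0, _ => False
  | m + 1, q => (m = k ∧ NonVertical m (down q) ∧ IsVertical (m + 1) q) ∨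
      (OnlyVertical k m (down q) ∧ ¬ IsVertical (m + 1) q ∧ ¬ IsTan (m + 1) q)

theorem OnlyVertical.lt {k m : ℕ} {q : (Monster d m).Pt} (h : OnlyVertical k m q) : k < m := by
  induction m with
  | zero => exact h.elim
  | succ m ih =>
    rcases h with ⟨rfl, -⟩ | ⟨h, -⟩
    · exact Nat.lt_succ_self _
    · exact (ih h).trans (Nat.lt_succ_self _)

theorem OnlyVertical.pos {k m : ℕ} {q : (Monster d m).Pt} (h : OnlyVertical k m q) : 1 ≤ k := by
  induction m with
  | zero => exact h.elim
  | succ m ih =>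
    rcases h with ⟨rfl, -, h⟩ | ⟨h, -⟩
    · rcases m with _ | m
      · exact h.elim
      · exact Nat.succ_pos _
    · exact ih h

/-- Directly after the V this is `Monster.isCritical_iff`. Later the point below is regular, and
tangency is impossible since it needs a vertical point immediately below. -/
theorem OnlyVertical.isCritical_iff {k m : ℕ} {q : (Monster d (m + 1)).Pt}
    (h : OnlyVertical k m (down q)) :
    IsCritical (m + 1) q ↔ IsVertical (m + 1) q ∨ IsTan (m + 1) q := by
  induction m with
  | zero => exact h.elim
  | succ m ih =>
    rcases h with ⟨rfl, h, hv⟩ | ⟨h, hv, ht⟩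
    · rcases m with _ | m
      · exact hv.elim
      · exact Monster.isCritical_iff h.not_isCritical
    · have hc : ¬ IsCritical (m + 1) (down q) := by
        rw [ih h]
        exact not_or.2 ⟨hv, ht⟩
      rw [isCritical_iff_isVertical hc]
      refine (or_iff_left fun ht' => hv ht'.vertical).symm

theorem code_eq_replicate_iff {m : ℕ} {q : (Monster d m).Pt} :
    code m q = List.replicate m Letter.R ↔ NonVertical m q := by
  induction m with
  | zero => exact ⟨fun _ => trivial, fun _ => rfl⟩
  | succ m ih =>
    rw [List.replicate_succ']
    change code m (down q) ++ [letter (m + 1) q] = _ ↔ NonVertical m (down q) ∧ _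
    rw [← List.concat_eq_append, ← List.concat_eq_append, List.concat_inj, ih, letter_eq_R]
    refine and_congr_right fun h => not_congr ⟨fun hc => ?_, IsVertical.isCritical⟩
    by_contra hv
    exact NonVertical.not_isCritical (q := q) (m := m + 1) ⟨h, hv⟩ hc

theorem length_code {m : ℕ} {q : (Monster d m).Pt} : (code m q).length = m := by
  induction m with
  | zero => rfl
  | succ m ih => simp [code, ih]

/-- The level is kept free, so that the last letter can be peeled off in an induction on `m`. -/
theorem code_eq_wordRVR_iff {k m r : ℕ} {q : (Monster d m).Pt} :
    code m q = wordRVR k r ↔ m = k + 1 + r ∧ OnlyVertical k m q := by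
  induction m generalizing r with
  | zero =>
    refine ⟨fun h => ?_, fun h => h.2.elim⟩
    have := congrArg List.length h
    simp [wordRVR, code] at this
  | succ m ih =>
    change code m (down q) ++ [letter (m + 1) q] = _ ↔ m + 1 = _ ∧ (_ ∧ NonVertical m (down q) ∧ _ ∨
      OnlyVertical k m (down q) ∧ _ ∧ _)
    rcases r with _ | r
    · rw [show wordRVR k 0 = (List.replicate k Letter.R).concat Letter.V by simp [wordRVR],
        ← List.concat_eq_append, List.concat_inj, letter_eq_V]
      constructor
      · rintro ⟨h1, h2⟩
        obtain rfl : m = k := by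
          have := congrArg List.length h1
          rwa [length_code, List.length_replicate] at this
        exact ⟨rfl, .inl ⟨rfl, code_eq_replicate_iff.1 h1, h2⟩⟩
      · rintro ⟨h1, ⟨rfl, h2, h3⟩ | ⟨h2, -⟩⟩
        · exact ⟨code_eq_replicate_iff.2 h2, h3⟩
        · have := h2.lt
          omega
    · rw [show wordRVR k (r + 1) = (wordRVR k r).concat Letter.R by
          simp [wordRVR, List.replicate_succ'], ← List.concat_eq_append, List.concat_inj, ih,
          letter_eq_R]
      constructor
      · rintro ⟨⟨h1, h2⟩, h3⟩
        rw [h2.isCritical_iff, not_or] at h3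
        exact ⟨by omega, .inr ⟨h2, h3⟩⟩
      · rintro ⟨h1, ⟨rfl, -⟩ | ⟨h2, h3⟩⟩
        · omega
        · rw [h2.isCritical_iff, not_or]
          exact ⟨⟨by omega, h2⟩, h3⟩

/-! ### The class as a smooth locally closed hypersurface -/

/-- The point at level `k + 1` below is vertical. -/
def VerticalAt (k : ℕ) : (m : ℕ) → (Monster d m).Pt → Prop
  | 0, _ => False
  | m + 1, q => (m = k ∧ IsVertical (m + 1) q) ∨ VerticalAt k m (down q)

/-- Some point below, not at level `k + 1`, is vertical, or some line below is tangent to the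
vertical locus. -/
def OtherVertical (k : ℕ) : (m : ℕ) → (Monster d m).Pt → Prop
  | 0, _ => False
  | m + 1, q => OtherVertical k m (down q) ∨ (m ≠ k ∧ IsVertical (m + 1) q) ∨ IsTan (m + 1) q

theorem VerticalAt.lt {k m : ℕ} {q : (Monster d m).Pt} (h : VerticalAt k m q) : k < m := by
  induction m with
  | zero => exact h.elim
  | succ m ih =>
    rcases h with ⟨rfl, -⟩ | h
    · exact Nat.lt_succ_self _
    · exact (ih h).trans (Nat.lt_succ_self _)

theorem NonVertical.not_isVertical {m : ℕ} {q : (Monster d m).Pt} (h : NonVertical m q) :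
    ¬ IsVertical m q := by
  cases m with
  | zero => exact id
  | succ m => exact h.2

theorem NonVertical.not_otherVertical {k m : ℕ} {q : (Monster d m).Pt} (h : NonVertical m q) :
    ¬ OtherVertical k m q := by
  induction m with
  | zero => exact id
  | succ m ih =>
    rintro (H | ⟨-, H⟩ | H)
    · exact ih h.1 H
    · exact h.2 H
    · exact h.1.not_isVertical H.vertical

/-- On points with some vertical line, excluding the other degeneracies already forces the vertical
line to sit at level `k+1`. This is why the class is open in the singular locus. -/
theorem verticalAt_of_not {k m : ℕ} {q : (Monster d m).Pt} (h : ¬ NonVertical m q)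
    (h' : ¬ OtherVertical k m q) : VerticalAt k m q := by
  induction m with
  | zero => exact (h trivial).elim
  | succ m ih =>
    simp only [OtherVertical, not_or, not_and] at h'
    by_cases h0 : NonVertical m (down q)
    · have hv : IsVertical (m + 1) q := by
        by_contra hv
        exact h ⟨h0, hv⟩
      left
      refine ⟨?_, hv⟩
      by_contra hmk
      exact h'.2.1 hmk hv
    · exact .inr (ih h0 h'.1)

theorem OnlyVertical.verticalAt {k m : ℕ} {q : (Monster d m).Pt} (h : OnlyVertical k m q) :
    VerticalAt k m q := by
  induction m with
  | zero => exact h.elim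
  | succ m ih =>
    rcases h with ⟨rfl, -, h⟩ | ⟨h, -⟩
    · exact .inl ⟨rfl, h⟩
    · exact .inr (ih h)

/-- The class is written as a difference of two Zariski closed sets. -/
theorem onlyVertical_iff {k m : ℕ} {q : (Monster d m).Pt} :
    OnlyVertical k m q ↔ VerticalAt k m q ∧ ¬ OtherVertical k m q := by
  refine ⟨fun h => ⟨h.verticalAt, ?_⟩, fun H => ?_⟩
  · induction m with
    | zero => exact id
    | succ m ih =>
      rcases h with ⟨rfl, h1, h2⟩ | ⟨h1, h2, h3⟩
      · rintro (H | ⟨H, -⟩ | H)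
        · exact h1.not_otherVertical H
        · exact H rfl
        · exact h1.not_isVertical H.vertical
      · rintro (H | ⟨-, H⟩ | H)
        · exact ih h1 H
        · exact h2 H
        · exact h3 H
  · obtain ⟨h, h'⟩ := H
    induction m with
    | zero => exact h.elim
    | succ m ih =>
      simp only [OtherVertical, not_or, not_and] at h'
      rcases h with ⟨rfl, h⟩ | h
      · left
        refine ⟨rfl, ?_, h⟩
        by_contra hn
        exact lt_irrefl _ (verticalAt_of_not hn h'.1).lt
      · exact .inr ⟨ih h h'.1, h'.2.1 h.lt.ne', h'.2.2⟩

theorem OnlyVertical.not_nonVertical {k m : ℕ} {q : (Monster d m).Pt} (h : OnlyVertical k m q) :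
    ¬ NonVertical m q := by
  induction m with
  | zero => exact h.elim
  | succ m ih =>
    rcases h with ⟨rfl, -, h⟩ | ⟨h, -⟩
    · exact fun H => H.2 h
    · exact fun H => ih h H.1

/-- Up to scale the homogeneous coordinates are one in the slot of the chart and the affine fiber
coordinates elsewhere. -/
theorem exists_linear_homCoord {m : ℕ} (a : (Monster d (m + 1)).ι) (s : Fin (d + 1)) :
    (∀ q ∈ (Monster d (m + 1)).dom a, (Monster d m).homCoord a.1 q s ≠ 0) ∨
    ∃ φ : (Monster d (m + 1)).E →ₗ[ℂ] ℂ, φ ≠ 0 ∧ ∀ q ∈ (Monster d (m + 1)).dom a,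
      (Monster d m).homCoord a.1 q s = 0 ↔ φ ((Monster d (m + 1)).chart a q) = 0 := by
  obtain ⟨a, i⟩ := a
  by_cases hs : s = i
  · subst hs
    exact .inl fun q hq => hq.2
  · obtain ⟨j, rfl⟩ := Fin.exists_succAbove_eq hs
    refine .inr ⟨LinearMap.proj (R := ℂ) (φ := fun _ : Fin d => ℂ) j ∘ₗ
      LinearMap.snd ℂ (Monster d m).E (Fin d → ℂ), fun H => ?_, fun q hq => ?_⟩
    · have h1 := congrArg (fun T : (Monster d m).E × (Fin d → ℂ) →ₗ[ℂ] ℂ => T (0, fun _ => 1)) H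
      exact one_ne_zero (α := ℂ) h1
    · refine (homCoord_eq_zero_iff (L := Monster d m) hq).trans ?_
      rw [affineVec_succAbove]
      rfl

theorem isZariskiClosed_isVertical (m : ℕ) :
    (Monster d m).IsZariskiClosed {q | IsVertical m q} := by
  rcases m with _ | _ | m
  · exact Atlas.isZariskiClosed_empty
  · exact Atlas.isZariskiClosed_empty
  · refine Atlas.isZariskiClosed_of_linear ?_
    rintro ⟨⟨a, i⟩, i'⟩
    rcases exists_linear_homCoord (m := m + 1) ((a, i), i') i with H | ⟨φ, -, H⟩
    · exact .inl fun q hq hv => H q hq ((isVertical_iff_homCoord hq.1).1 hv)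
    · exact .inr ⟨φ, fun q hq => (isVertical_iff_homCoord hq.1).trans (H q hq)⟩

theorem isZariskiClosed_isTan (m : ℕ) : (Monster d m).IsZariskiClosed {q | IsTan m q} := by
  rcases m with _ | _ | _ | m
  · exact Atlas.isZariskiClosed_empty
  · exact Atlas.isZariskiClosed_empty
  · exact Atlas.isZariskiClosed_empty
  · refine Atlas.isZariskiClosed_of_linear_pair ?_
    rintro ⟨⟨⟨a, i⟩, i'⟩, i''⟩
    rcases exists_linear_homCoord (m := m + 1) ((a, i), i') i with H | ⟨φ, -, H⟩
    · exact .inl fun q hq hv => H _ hq.1 ((isTan_iff_homCoord hq.1).1 hv).1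
    rcases exists_linear_homCoord (m := m + 2) (((a, i), i'), i'') i with H' | ⟨ψ, -, H'⟩
    · exact .inl fun q hq hv => H' _ hq ((isTan_iff_homCoord hq.1).1 hv).2
    · exact .inr ⟨φ ∘ₗ LinearMap.fst ℂ (Monster d (m + 2)).E (Fin d → ℂ), ψ, fun q hq =>
        (isTan_iff_homCoord hq.1).trans (and_congr (H _ hq.1) (H' _ hq))⟩

theorem isZariskiClosed_setOf_and {M : Atlas} (P : Prop) {Z : Set M.Pt}
    (hZ : M.IsZariskiClosed Z) : M.IsZariskiClosed {q | P ∧ q ∈ Z} := by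
  by_cases hP : P
  · simpa [hP] using hZ
  · simpa [hP] using Atlas.isZariskiClosed_empty

theorem isZariskiClosed_verticalAt (k m : ℕ) :
    (Monster d m).IsZariskiClosed {q | VerticalAt k m q} := by
  induction m with
  | zero => exact Atlas.isZariskiClosed_empty
  | succ m ih =>
    exact (isZariskiClosed_setOf_and _ (isZariskiClosed_isVertical (m + 1))).union
      (isZariskiClosed_preimage_base ih)

theorem isZariskiClosed_otherVertical (k m : ℕ) :
    (Monster d m).IsZariskiClosed {q | OtherVertical k m q} := by
  induction m with
  | zero => exact Atlas.isZariskiClosed_empty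
  | succ m ih =>
    exact (isZariskiClosed_preimage_base (L := Monster d m) ih).union
      ((isZariskiClosed_setOf_and _ (isZariskiClosed_isVertical (m + 1))).union
        (isZariskiClosed_isTan (m + 1)))

/-- At level `k+1` the equation is a single fiber coordinate; at higher levels it is pulled back
along the projections, which are linear in the charts. -/
theorem VerticalAt.exists_linear {k m : ℕ} {q : (Monster d m).Pt} (h : VerticalAt k m q) :
    ∃ a, q ∈ (Monster d m).dom a ∧ ∃ φ : (Monster d m).E →ₗ[ℂ] ℂ, φ ≠ 0 ∧
      ∀ r ∈ (Monster d m).dom a, VerticalAt k m r ↔ φ ((Monster d m).chart a r) = 0 := by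
  induction m with
  | zero => exact h.elim
  | succ m ih =>
    rcases h with ⟨rfl, h⟩ | h
    · rcases m with _ | m
      · exact h.elim
      obtain ⟨⟨⟨a, i⟩, i'⟩, ha⟩ := (framed d (m + 2)).regular.cover q
      have hv := (isVertical_iff_homCoord ha.1).1 h
      rcases exists_linear_homCoord (m := m + 1) ((a, i), i') i with H | ⟨φ, hφ, H⟩
      · exact (H q ha hv).elim
      · refine ⟨((a, i), i'), ha, φ, hφ, fun r hr => ?_⟩
        rw [← H r hr]
        refine Iff.trans ⟨?_, fun hr' => .inl ⟨rfl, hr'⟩⟩ (isVertical_iff_homCoord hr.1)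
        rintro (⟨-, h1⟩ | h1)
        · exact h1
        · exact (lt_irrefl _ h1.lt).elim
    · obtain ⟨a, ha, φ, hφ, H⟩ := ih h
      obtain ⟨i, hi⟩ := Function.ne_iff.1 ((framed d m).homCoord_ne_zero (q := q) ha)
      refine ⟨(a, i), ⟨ha, hi⟩, φ ∘ₗ LinearMap.fst ℂ (Monster d m).E (Fin d → ℂ), fun H => ?_,
        fun r hr => ?_⟩
      · refine hφ (LinearMap.ext fun e => ?_)
        exact congrArg (fun T : (Monster d m).E × (Fin d → ℂ) →ₗ[ℂ] ℂ => T (e, 0)) H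
      · refine Iff.trans ⟨?_, fun hr' => .inr hr'⟩ (H r.base hr.1)
        rintro (⟨h1, -⟩ | h1)
        · exact (h.lt.ne' h1).elim
        · exact h1

/-- Verticality and tangency each force some homogeneous coordinate to vanish, so fiber coordinates
that are all nonzero avoid both, and such coordinates are dense. The open set `U` allows the line to
be taken close to a given one. -/
theorem exists_regular_lift {m : ℕ} {a : (Monster d m).ι} {p : (Monster d m).Pt}
    (ha : p ∈ (Monster d m).dom a) (i : Fin (d + 1)) {U : Set (Fin d → ℂ)} (hU : IsOpen U)
    (hU' : U.Nonempty) : ∃ q : (Monster d (m + 1)).Pt, q ∈ (Monster d (m + 1)).dom (a, i) ∧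
      down q = p ∧ ((Monster d m).projAtlas.chart (a, i) q).2 ∈ U ∧
      ¬ IsVertical (m + 1) q ∧ ¬ IsTan (m + 1) q := by
  have hdense : Dense {u : Fin d → ℂ | ∀ j, u j ≠ 0} := by
    have h1 : {u : Fin d → ℂ | ∀ j, u j ≠ 0} = Set.pi univ fun _ => {0}ᶜ := by
      ext u
      simp
    rw [h1]
    exact dense_pi _ fun _ _ => dense_compl_singleton 0
  obtain ⟨u, huU, hu⟩ := hdense.inter_open_nonempty U hU hU'
  obtain ⟨q, hq, hqz⟩ := (framed d m).exists_projPt_chart a i ((Monster d m).chart a p, u)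
  have hqp : down q = p := (framed d m).regular.injOn a hq.1 ha (congrArg Prod.fst hqz)
  have hne : ∀ s, (Monster d m).homCoord a q s ≠ 0 := by
    intro s
    rw [Ne, homCoord_eq_zero_iff hq, hqz]
    induction s using i.succAboveCases with
    | x => simp
    | p j => simpa using hu j
  refine ⟨q, hq, hqp, by rw [hqz]; exact huU, fun hv => ?_, fun ht => ?_⟩
  · rcases m with _ | m
    · exact hv
    · obtain ⟨a, i'⟩ := a
      exact hne i' ((isVertical_iff_homCoord hq.1).1 hv)
  · rcases m with _ | _ | m
    · exact ht
    · exact ht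
    · obtain ⟨⟨a, i'⟩, i''⟩ := a
      exact hne i' ((isTan_iff_homCoord hq.1).1 ht).2

theorem exists_nonVertical (d m : ℕ) : ∃ q : (Monster d m).Pt, NonVertical m q := by
  induction m with
  | zero => exact ⟨(0 : Fin (d + 1) → ℂ), trivial⟩
  | succ m ih =>
    obtain ⟨p, hp⟩ := ih
    obtain ⟨a, ha⟩ := (framed d m).regular.cover p
    obtain ⟨q, -, rfl, -, hv, -⟩ := exists_regular_lift ha 0 isOpen_univ univ_nonempty
    exact ⟨q, hp, hv⟩

theorem exists_onlyVertical (hd : 1 ≤ d) {k j : ℕ} (hk : 1 ≤ k) (hkj : k < j) :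
    ∃ q : (Monster d j).Pt, OnlyVertical k j q := by
  induction j with
  | zero => omega
  | succ j ih =>
    rcases eq_or_lt_of_le (Nat.lt_succ_iff.1 hkj) with rfl | hlt
    · obtain ⟨p, hp⟩ := exists_nonVertical d k
      obtain ⟨k, rfl⟩ := Nat.exists_eq_succ_of_ne_zero (Nat.one_le_iff_ne_zero.1 hk)
      obtain ⟨⟨a, i⟩, ha⟩ := (framed d (k + 1)).regular.cover p
      have : Nontrivial (Fin (d + 1)) := Fin.nontrivial_iff_two_le.2 (by omega)
      -- Here n ≥ 2 is needed: the origin of the fiber chart with slot `i' ≠ i` has vanishing `i`-th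
      -- homogeneous coordinate, hence is vertical.
      obtain ⟨i', hi'⟩ := exists_ne i
      obtain ⟨q, hq, hqz⟩ := (framed d (k + 1)).exists_projPt_chart (a, i) i'
        ((Monster d (k + 1)).chart (a, i) p, 0)
      have hqp : down q = p := (framed d (k + 1)).regular.injOn (a, i) hq.1 ha
        (congrArg Prod.fst hqz)
      refine ⟨q, .inl ⟨rfl, by rwa [hqp], (isVertical_iff_homCoord hq.1).2 ?_⟩⟩
      obtain ⟨l, rfl⟩ := Fin.exists_succAbove_eq hi'.symm
      refine (homCoord_eq_zero_iff hq).2 ?_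
      rw [affineVec_succAbove]
      exact congrFun (congrArg Prod.snd hqz) l
    · obtain ⟨p, hp⟩ := ih hlt
      obtain ⟨a, ha⟩ := (framed d j).regular.cover p
      obtain ⟨q, -, rfl, -, hv, ht⟩ := exists_regular_lift ha 0 isOpen_univ univ_nonempty
      exact ⟨q, .inr ⟨hp, hv, ht⟩⟩

/-- The projection of `p` to its first vertical level already lies in a class there. Only the lines
above that level are moved, to nearby regular ones. -/
theorem exists_onlyVertical_mem {m : ℕ} {p : (Monster d m).Pt} (hp : ¬ NonVertical m p)
    {U : Set (Monster d m).Pt} (hU : IsOpen U) (hpU : p ∈ U) :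
    ∃ q ∈ U, ∃ k, OnlyVertical k m q := by
  induction m with
  | zero => exact (hp trivial).elim
  | succ m ih =>
    by_cases h0 : NonVertical m (down p)
    · refine ⟨p, hpU, m, .inl ⟨rfl, h0, ?_⟩⟩
      by_contra hv
      exact hp ⟨h0, hv⟩
    · obtain ⟨⟨a, i⟩, ha⟩ := (framed d (m + 1)).regular.cover p
      have hcont := (framed d (m + 1)).regular.continuous_point (a, i)
      have hopen : IsOpen (X := (Monster d m).E × (Fin d → ℂ))
        ((framed d (m + 1)).regular.point (a, i) ⁻¹' U) := hU.preimage hcont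
      obtain ⟨O₁, O₂, hO₁, hO₂, hx₁, hx₂, hO⟩ := isOpen_prod_iff.1 hopen
        ((Monster d m).chart a (down p)) ((Monster d m).projAtlas.chart (a, i) p).2 (by
          have := (framed d (m + 1)).regular.point_chart ha
          exact (congrArg (· ∈ U) this).mpr hpU)
      obtain ⟨p', ⟨hp'a, hp'O⟩, k, hk⟩ := ih h0
        (Atlas.Regular.isOpen_preimage_chart a hO₁) ⟨ha.1, hx₁⟩
      obtain ⟨q, hq, rfl, hqU, hv, ht⟩ := exists_regular_lift hp'a i hO₂ ⟨_, hx₂⟩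
      refine ⟨q, ?_, k, .inr ⟨hk, hv, ht⟩⟩
      have h1 := (framed d (m + 1)).regular.point_chart hq
      rw [← h1]
      exact hO (show (_, _) ∈ O₁ ×ˢ O₂ from ⟨hp'O, hqU⟩)

end Monster

/-! ### Integral curves and their prolongations in charts -/

namespace DistManifold

variable {d : ℕ}

/-- The coframe coordinates, in the chart `a`, along the curve `c`. -/
noncomputable def frameCoord (L : DistManifold d) (a : L.ι) (c : ℂ → L.Pt) (t : ℂ) :
    Fin (d + 1) → ℂ :=
  L.coframe a (L.chart a (c t))

/-- The line `q` is the tangent line at `0` of the immersed curve `c`. -/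
def TangentLine (L : DistManifold d) (c : ℂ → L.Pt) (q : L.ProjPt) : Prop :=
  q.base = c 0 ∧ ∀ a, c 0 ∈ L.dom a →
    ∃ k : ℂ, k ≠ 0 ∧ L.homCoord a q = k • deriv (L.frameCoord a c) 0

/-- The curve `c` is analytic and integral near `0`, as seen in the chart `a`. -/
def IsIntegralIn {L : DistManifold d} (h : L.Framed) (a : L.ι) (c : ℂ → L.Pt) : Prop :=
  (∀ᶠ t in 𝓝 0, c t ∈ L.dom a) ∧ AnalyticAt ℂ (fun t => L.chart a (c t)) 0 ∧
  ∀ᶠ t in 𝓝 0, deriv (fun t => L.chart a (c t)) t =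
    h.lift a (L.chart a (c t)) (deriv (L.frameCoord a c) t)

namespace Framed

variable {L : DistManifold d} (h : L.Framed)
include h

theorem completeSpace : CompleteSpace L.E :=
  have := h.regular.finiteDimensional
  FiniteDimensional.complete ℂ L.E

theorem hasDerivAt_frameCoord {a : L.ι} {c : ℂ → L.Pt} {t : ℂ} {e : L.E}
    (hc : HasDerivAt (fun t => L.chart a (c t)) e t) :
    HasDerivAt (L.frameCoord a c) (L.coframe a e) t := by
  have := h.regular.finiteDimensional
  exact (LinearMap.toContinuousLinearMap (L.coframe a)).hasFDerivAt.comp_hasDerivAt t hc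

theorem analyticAt_frameCoord {a : L.ι} {c : ℂ → L.Pt} {t : ℂ}
    (hc : AnalyticAt ℂ (fun t => L.chart a (c t)) t) : AnalyticAt ℂ (L.frameCoord a c) t := by
  have := h.regular.finiteDimensional
  exact AnalyticAt.comp (g := (LinearMap.toContinuousLinearMap (L.coframe a)))
    (ContinuousLinearMap.analyticAt _ _) hc

theorem eventually_mem_of_prolongs {c : ℂ → L.Pt} {c₁ : ℂ → L.ProjPt} (hp : L.Prolongs c c₁)
    {a : L.ι} {i : Fin (d + 1)} (ha : c₁ 0 ∈ L.projAtlas.dom (a, i)) :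
    ∀ᶠ t in 𝓝 0, c₁ t ∈ L.projAtlas.dom (a, i) :=
  h.regular_prolong.eventually_mem hp.1 ha

omit h in
theorem base_eq_of_prolongs {c : ℂ → L.Pt} {c₁ : ℂ → L.ProjPt} (hp : L.Prolongs c c₁) :
    (c₁ 0).base = c 0 := hp.2.1.self_of_nhds

theorem analyticAt_frameCoord_prolong {c : ℂ → L.Pt} {c₁ : ℂ → L.ProjPt} (hp : L.Prolongs c c₁)
    {a : L.ι} {i : Fin (d + 1)} (ha : c₁ 0 ∈ L.projAtlas.dom (a, i)) :
    AnalyticAt ℂ (L.prolong.frameCoord (a, i) c₁) 0 :=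
  h.prolong.analyticAt_frameCoord (h.regular_prolong.analyticAt_chart hp.1 ha)

theorem analyticAt_chart_base {c : ℂ → L.Pt} {c₁ : ℂ → L.ProjPt} (hp : L.Prolongs c c₁)
    {a : L.ι} {i : Fin (d + 1)} (ha : c₁ 0 ∈ L.projAtlas.dom (a, i)) :
    AnalyticAt ℂ (fun t => L.chart a (c t)) 0 := by
  have h1 : AnalyticAt ℂ (fun t => (L.projAtlas.chart (a, i) (c₁ t)).1) 0 :=
    AnalyticAt.comp (g := (Prod.fst : L.E × (Fin d → ℂ) → L.E)) analyticAt_fst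
      (h.regular_prolong.analyticAt_chart hp.1 ha)
  exact h1.congr (hp.2.1.mono fun t ht => congrArg (L.chart a) ht)

theorem analyticAt_frameCoord_base {c : ℂ → L.Pt} {c₁ : ℂ → L.ProjPt} (hp : L.Prolongs c c₁)
    {a : L.ι} {i : Fin (d + 1)} (ha : c₁ 0 ∈ L.projAtlas.dom (a, i)) :
    AnalyticAt ℂ (L.frameCoord a c) 0 :=
  h.analyticAt_frameCoord (h.analyticAt_chart_base hp ha)

omit h in
theorem frameCoord_self_of_prolongs {c : ℂ → L.Pt} {c₁ : ℂ → L.ProjPt} (hp : L.Prolongs c c₁)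
    (a : L.ι) (i : Fin (d + 1)) :
    ∀ᶠ t in 𝓝 0, L.prolong.frameCoord (a, i) c₁ t i = L.frameCoord a c t i := by
  filter_upwards [hp.2.1] with t ht
  refine (prolongCoframe_self (a, i) _).trans ?_
  change L.coframe a (L.chart a (c₁ t).base) i = _
  rw [ht]
  rfl

omit h in
theorem frameCoord_prolong_succAbove (a : L.ι) (i : Fin (d + 1)) (c₁ : ℂ → L.ProjPt) (t : ℂ)
    (j : Fin d) : L.prolong.frameCoord (a, i) c₁ t (i.succAbove j) =
      (L.projAtlas.chart (a, i) (c₁ t)).2 j :=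
  prolongCoframe_succAbove (a, i) _ j

theorem eventually_deriv_of_prolongs_punctured {c : ℂ → L.Pt} {c₁ : ℂ → L.ProjPt}
    (hp : L.Prolongs c c₁) {a : L.ι} {i : Fin (d + 1)} (ha : c₁ 0 ∈ L.projAtlas.dom (a, i)) :
    ∀ᶠ t in 𝓝[≠] 0, deriv (L.frameCoord a c) t i ≠ 0 ∧ deriv (L.frameCoord a c) t =
      deriv (L.frameCoord a c) t i • affineVec i (L.projAtlas.chart (a, i) (c₁ t)).2 := by
  filter_upwards [(h.eventually_mem_of_prolongs hp ha).filter_mono nhdsWithin_le_nhds, hp.2.2]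
    with t ht htv
  obtain ⟨v, hv, hvel, hct⟩ := htv
  rw [hct] at ht ⊢
  obtain ⟨k, hk, hk'⟩ := exists_homCoord_mk hv
  have hder : deriv (L.frameCoord a c) t = L.coframe a (v.1.1 a) :=
    (h.hasDerivAt_frameCoord (hvel.2 a ht.1)).deriv
  have hne : deriv (L.frameCoord a c) t i ≠ 0 := by
    intro H
    refine ht.2 ?_
    change L.homCoord a _ i = 0
    rw [hk' a, ← hder, Pi.smul_apply, H, smul_zero]
  refine ⟨hne, ?_⟩
  have h1 := homCoord_eq ht
  rw [hk' a, ← hder] at h1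
  have h2 := congrArg (fun f => k⁻¹ • f) h1
  simp only [smul_smul, Pi.smul_apply, smul_eq_mul, inv_mul_cancel₀ hk, one_smul,
    inv_mul_cancel_left₀ hk] at h2
  exact h2

/-- This is the contact relation: each derivative along the curve is the fiber coordinate times the
derivative of the slot coordinate. It holds off `0` by definition of the prolongation, and at `0` by
the identity theorem for analytic functions. -/
theorem eventually_deriv_of_prolongs {c : ℂ → L.Pt} {c₁ : ℂ → L.ProjPt}
    (hp : L.Prolongs c c₁) {a : L.ι} {i : Fin (d + 1)} (ha : c₁ 0 ∈ L.projAtlas.dom (a, i)) :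
    ∀ᶠ t in 𝓝 0, deriv (L.frameCoord a c) t =
      deriv (L.frameCoord a c) t i • affineVec i (L.projAtlas.chart (a, i) (c₁ t)).2 := by
  have hF := (h.analyticAt_frameCoord_base hp ha).deriv
  have hu : AnalyticAt ℂ (fun t => (L.projAtlas.chart (a, i) (c₁ t)).2) 0 :=
    AnalyticAt.comp (g := (Prod.snd : L.E × (Fin d → ℂ) → (Fin d → ℂ))) analyticAt_snd
      (h.regular_prolong.analyticAt_chart hp.1 ha)
  have hv : AnalyticAt ℂ (fun t => affineVec i (L.projAtlas.chart (a, i) (c₁ t)).2) 0 :=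
    AnalyticAt.comp (g := affineVec i) (analyticAt_affineVec i _) hu
  have hr := (analyticAt_pi_iff.1 hF i).smul hv
  refine (hF.frequently_eq_iff_eventually_eq hr).1 ?_
  exact ((h.eventually_deriv_of_prolongs_punctured hp ha).mono fun t ht => ht.2).frequently

theorem tangentLine_of_prolongs {c : ℂ → L.Pt} {c₁ : ℂ → L.ProjPt}
    (hp : L.Prolongs c c₁) (hi : ∀ a, c 0 ∈ L.dom a → deriv (L.frameCoord a c) 0 ≠ 0) :
    L.TangentLine c (c₁ 0) := by
  have hb := base_eq_of_prolongs hp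
  refine ⟨hb, fun a ha => ?_⟩
  rw [← hb] at ha
  obtain ⟨i, hi'⟩ := Function.ne_iff.1 (h.homCoord_ne_zero ha)
  have hm : c₁ 0 ∈ L.projAtlas.dom (a, i) := ⟨ha, hi'⟩
  have h1 := (h.eventually_deriv_of_prolongs hp hm).self_of_nhds
  have h2 : deriv (L.frameCoord a c) 0 i ≠ 0 := by
    intro H
    rw [H, zero_smul] at h1
    exact hi a (hb ▸ ha) h1
  refine ⟨L.homCoord a (c₁ 0) i / deriv (L.frameCoord a c) 0 i, div_ne_zero hi' h2, ?_⟩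
  rw [h1, homCoord_eq hm, smul_smul]
  simp only [Pi.smul_apply, affineVec_self, smul_eq_mul, mul_one]
  rw [div_mul_cancel₀ _ h2]

omit h in
theorem deriv_frameCoord_apply {a : L.ι} {c : ℂ → L.Pt} {t : ℂ}
    (hF : AnalyticAt ℂ (L.frameCoord a c) t) (s : Fin (d + 1)) :
    deriv (L.frameCoord a c) t s = deriv (fun t => L.frameCoord a c t s) t :=
  ((hasDerivAt_pi.1 hF.differentiableAt.hasDerivAt s).deriv).symm

theorem deriv_frameCoord_self {c : ℂ → L.Pt} {c₁ : ℂ → L.ProjPt}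
    (hp : L.Prolongs c c₁) {a : L.ι} {i : Fin (d + 1)} (ha : c₁ 0 ∈ L.projAtlas.dom (a, i)) :
    deriv (L.prolong.frameCoord (a, i) c₁) 0 i = deriv (L.frameCoord a c) 0 i := by
  rw [deriv_frameCoord_apply (h.analyticAt_frameCoord_prolong hp ha),
    deriv_frameCoord_apply (h.analyticAt_frameCoord_base hp ha)]
  exact EventuallyEq.deriv_eq (frameCoord_self_of_prolongs hp a i)

/-- An immersed curve prolongs to a curve whose derivative along the slot of the new chart does not
vanish. -/
theorem deriv_frameCoord_ne_zero_of_prolongs {c : ℂ → L.Pt} {c₁ : ℂ → L.ProjPt}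
    (hp : L.Prolongs c c₁) (hi : ∀ a, c 0 ∈ L.dom a → deriv (L.frameCoord a c) 0 ≠ 0)
    {a : L.ι} {i : Fin (d + 1)} (ha : c₁ 0 ∈ L.projAtlas.dom (a, i)) :
    deriv (L.prolong.frameCoord (a, i) c₁) 0 i ≠ 0 := by
  rw [h.deriv_frameCoord_self hp ha]
  obtain ⟨k, hk, hk'⟩ := (h.tangentLine_of_prolongs hp hi).2 a (base_eq_of_prolongs hp ▸ ha.1)
  intro H
  refine ha.2 ?_
  change L.homCoord a _ i = 0
  rw [hk', Pi.smul_apply, H, smul_zero]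

theorem immersed_of_prolongs {c : ℂ → L.Pt} {c₁ : ℂ → L.ProjPt}
    (hp : L.Prolongs c c₁) (hi : ∀ a, c 0 ∈ L.dom a → deriv (L.frameCoord a c) 0 ≠ 0)
    (a : L.prolong.ι) (ha : c₁ 0 ∈ L.prolong.dom a) :
    deriv (L.prolong.frameCoord a c₁) 0 ≠ 0 := fun H =>
  h.deriv_frameCoord_ne_zero_of_prolongs hp hi (a := a.1) (i := a.2) ha (congrFun H a.2)

/-- The slot coordinate is inherited by the prolongation together with its nonzero derivative, so an
immersed curve never becomes vertical. -/
theorem not_vertical_of_prolongs {c : ℂ → L.Pt} {c₁ : ℂ → L.ProjPt} {c₂ : ℂ → L.prolong.ProjPt}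
    (hp : L.Prolongs c c₁) (hp' : L.prolong.Prolongs c₁ c₂)
    (hi : ∀ a, c 0 ∈ L.dom a → deriv (L.frameCoord a c) 0 ≠ 0) : ¬ (c₂ 0).Vertical := by
  obtain ⟨⟨a, i⟩, ha⟩ := h.regular_prolong.cover (c₁ 0)
  have hb : (c₂ 0).base = c₁ 0 := base_eq_of_prolongs hp'
  rw [h.vertical_iff (a := a) (i := i) (hb ▸ ha)]
  obtain ⟨k, hk, hk'⟩ := (h.prolong.tangentLine_of_prolongs hp'
    (h.immersed_of_prolongs hp hi)).2 (a, i) ha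
  rw [hk']
  exact mul_ne_zero hk (h.deriv_frameCoord_ne_zero_of_prolongs hp hi ha)

/-- If the tangent line of the prolonged curve is not vertical, the curve itself is immersed and
its tangent line is the point of the prolonged curve. -/
theorem tangentLine_descend {c : ℂ → L.Pt} {c₁ : ℂ → L.ProjPt} (hp : L.Prolongs c c₁)
    {q : L.prolong.ProjPt} (hq : L.prolong.TangentLine c₁ q) (hv : ¬ q.Vertical) :
    L.TangentLine c (c₁ 0) := by
  have hb := base_eq_of_prolongs hp
  refine h.tangentLine_of_prolongs hp fun a ha => ?_
  rw [← hb] at ha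
  obtain ⟨i, hi'⟩ := Function.ne_iff.1 (h.homCoord_ne_zero ha)
  have hm : c₁ 0 ∈ L.projAtlas.dom (a, i) := ⟨ha, hi'⟩
  obtain ⟨k, hk, hk'⟩ := hq.2 (a, i) hm
  rw [h.vertical_iff (a := a) (i := i) (by rw [hq.1]; exact hm), hk', Pi.smul_apply,
    h.deriv_frameCoord_self hp hm] at hv
  intro H
  rw [H] at hv
  exact hv (smul_zero k)

/-- The base component of the frame upstairs is the lift of the line, scaled by the slot derivative.
Applying the coframe below turns this into the contact relation. -/
theorem isIntegralIn_base {a : L.ι} {i : Fin (d + 1)} {c₁ : ℂ → L.ProjPt}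
    (hc : IsIntegralIn h.prolong (a, i) c₁) :
    IsIntegralIn h a (fun t => (c₁ t).base) ∧ ∀ᶠ t in 𝓝 0,
      deriv (L.frameCoord a fun t => (c₁ t).base) t =
        deriv (L.frameCoord a fun t => (c₁ t).base) t i •
          affineVec i (L.projAtlas.chart (a, i) (c₁ t)).2 := by
  obtain ⟨h1, h2, h3⟩ := hc
  have := h.completeSpace
  have := h.prolong.completeSpace
  have h2' : AnalyticAt ℂ (fun t => L.chart a (c₁ t).base) 0 :=
    AnalyticAt.comp (g := (Prod.fst : L.E × (Fin d → ℂ) → L.E)) analyticAt_fst h2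
  have h4 : ∀ᶠ t in 𝓝 0, deriv (fun t => L.chart a (c₁ t).base) t =
      h.lift a (L.chart a (c₁ t).base) (deriv (L.frameCoord a fun t => (c₁ t).base) t i •
          affineVec i (L.projAtlas.chart (a, i) (c₁ t)).2) := by
    filter_upwards [h3, h2.eventually_analyticAt, h2'.eventually_analyticAt] with t ht hat hat'
    have hd : HasDerivAt (fun t => L.chart a (c₁ t).base) _ t :=
      (ContinuousLinearMap.fst ℂ L.E (Fin d → ℂ)).hasFDerivAt.comp_hasDerivAt t
        hat.differentiableAt.hasDerivAt
    have hslot : deriv (L.prolong.frameCoord (a, i) c₁) t i =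
        deriv (L.frameCoord a fun t => (c₁ t).base) t i := by
      rw [deriv_frameCoord_apply (h.prolong.analyticAt_frameCoord hat),
        deriv_frameCoord_apply (h.analyticAt_frameCoord hat')]
      congr 1
      funext t
      exact prolongCoframe_self (a, i) _
    refine (hd.deriv.trans (congrArg Prod.fst ht)).trans ?_
    refine (congrArg Prod.fst (h.liftProlong_apply a i _ _)).trans ?_
    rw [hslot]
    rfl
  have h5 : ∀ᶠ t in 𝓝 0, deriv (L.frameCoord a fun t => (c₁ t).base) t =
        deriv (L.frameCoord a fun t => (c₁ t).base) t i •
          affineVec i (L.projAtlas.chart (a, i) (c₁ t)).2 := by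
    filter_upwards [h4, h2'.eventually_analyticAt] with t ht hat'
    have hd := h.hasDerivAt_frameCoord (c := fun t => (c₁ t).base)
      hat'.differentiableAt.hasDerivAt
    conv_lhs => rw [hd.deriv, ht, h.coframe_lift]
  refine ⟨⟨h1.mono fun t ht => ht.1, h2', ?_⟩, h5⟩
  filter_upwards [h4, h5] with t ht ht'
  rw [ht, ← ht']

/-- An integral curve of the prolonged distribution is the prolongation of its projection, if the
latter has nonvanishing velocity away from `0`. -/
theorem prolongs_of_isIntegralIn {a : L.ι} {i : Fin (d + 1)} {c₁ : ℂ → L.ProjPt}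
    (hc : IsIntegralIn h.prolong (a, i) c₁)
    (hne : ∀ᶠ t in 𝓝[≠] 0, deriv (L.frameCoord a fun t => (c₁ t).base) t i ≠ 0) :
    L.Prolongs (fun t => (c₁ t).base) c₁ := by
  obtain ⟨⟨h1, h2, h3⟩, h4⟩ := h.isIntegralIn_base hc
  have := h.completeSpace
  refine ⟨⟨(a, i), hc.1, hc.2.1⟩, .of_forall fun _ => rfl, ?_⟩
  filter_upwards [hne, (eventually_eventually_nhds.2 h1).filter_mono nhdsWithin_le_nhds,
    h2.eventually_analyticAt.filter_mono nhdsWithin_le_nhds, h3.filter_mono nhdsWithin_le_nhds,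
    h4.filter_mono nhdsWithin_le_nhds, hc.1.filter_mono nhdsWithin_le_nhds]
    with t t1 t2 t3 t4 t5 t6
  obtain ⟨v, hv, hv'⟩ := h.exists_D t2.self_of_nhds (deriv (L.frameCoord a fun t => (c₁ t).base) t)
  have hv0 : v ≠ 0 := by
    rintro rfl
    rw [show ((0 : L.D (c₁ t).base).1.1 a) = 0 from rfl, map_zero] at hv'
    exact t1 (by rw [← hv']; rfl)
  refine ⟨v, hv0, h.regular.hasVelocity_of_chart rfl t2 ?_, ?_⟩
  · rw [hv, ← t4]
    exact t3.differentiableAt.hasDerivAt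
  · obtain ⟨k, hk, hk'⟩ := exists_homCoord_mk hv0
    have key := hk' a
    rw [hv', t5, smul_smul] at key
    have h0 := homCoord_eq (q := c₁ t) t6
    refine h.projPt_ext (a := a)
      (c := k * deriv (L.frameCoord a fun t => (c₁ t).base) t i / L.homCoord a (c₁ t) i) t6.1 rfl ?_
    rw [key, h0, smul_smul]
    simp only [Pi.smul_apply, affineVec_self, smul_eq_mul, mul_one]
    rw [div_mul_cancel₀ _ t6.2]

end Framed

end DistManifold

/-! ### Vanishing orders modulo analytic functions of a coordinate of order two -/

section Analysis

variable {F : Type*} [NormedAddCommGroup F] [NormedSpace ℂ F] [CompleteSpace F]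

theorem exists_primitive {f : ℂ → F} {x : ℂ} (hf : AnalyticAt ℂ f x) (y : F) :
    ∃ g : ℂ → F, AnalyticAt ℂ g x ∧ g x = y ∧ ∀ᶠ z in 𝓝 x, HasDerivAt g (f z) z := by
  obtain ⟨r, hr, hfr⟩ := Metric.eventually_nhds_iff_ball.1 hf.eventually_analyticAt
  have hd : DifferentiableOn ℂ f (Metric.ball x r) :=
    fun z hz => (hfr z hz).differentiableAt.differentiableWithinAt
  obtain ⟨g, hg, hg'⟩ := hd.isExactOn_ball.with_val_at x y
  have hball : Metric.ball x r ∈ 𝓝 x := Metric.ball_mem_nhds x hr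
  refine ⟨g, ?_, hg, eventually_of_mem hball hg'⟩
  have : DifferentiableOn ℂ g (Metric.ball x r) :=
    fun z hz => (hg' z hz).differentiableAt.differentiableWithinAt
  exact this.analyticAt hball

-- Every `s` near `0` has a square root near `0`, so convergence in `z` yields convergence of the
-- series in `s = z²`.
omit [CompleteSpace F] in
theorem eventually_exists_sq {P : ℂ → Prop} (hP : ∀ᶠ z in 𝓝 0, P z) :
    ∀ᶠ s in 𝓝 (0 : ℂ), ∃ z, z ^ 2 = s ∧ P z := by
  obtain ⟨r, hr, h⟩ := Metric.eventually_nhds_iff.1 hP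
  refine Metric.eventually_nhds_iff.2 ⟨r ^ 2, by positivity, fun s hs => ?_⟩
  obtain ⟨z, rfl⟩ := IsAlgClosed.exists_pow_nat_eq s (n := 2) two_pos
  refine ⟨z, rfl, h ?_⟩
  rw [dist_zero_right] at hs ⊢
  rw [norm_pow] at hs
  exact lt_of_pow_lt_pow_left₀ 2 hr.le hs

omit [CompleteSpace F] in
theorem exists_analyticAt_of_summable {c : ℕ → F}
    (hc : ∀ᶠ z : ℂ in 𝓝 0, Summable fun n => z ^ (2 * n) • c n) :
    ∃ a : ℂ → F, AnalyticAt ℂ a 0 ∧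
      ∀ᶠ z : ℂ in 𝓝 0, HasSum (fun n => z ^ (2 * n) • c n) (a (z ^ 2)) := by
  let p : FormalMultilinearSeries ℂ ℂ F := fun n =>
    ContinuousMultilinearMap.mkPiRing ℂ (Fin n) (c n)
  have hp : ∀ n, p.coeff n = c n := fun n => by simp [p, FormalMultilinearSeries.coeff]
  refine ⟨fun s => ∑' n, s ^ n • c n, ⟨p, hasFPowerSeriesAt_iff.2 ?_⟩, ?_⟩
  · filter_upwards [eventually_exists_sq hc] with s hs
    obtain ⟨z, rfl, hz⟩ := hs
    simp only [hp, zero_add]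
    refine Summable.hasSum ?_
    simpa only [pow_mul] using hz
  · filter_upwards [hc] with z hz
    have := hz.hasSum
    simpa only [pow_mul] using this

theorem exists_even_add_odd {f : ℂ → F} (hf : AnalyticAt ℂ f 0) :
    ∃ a b : ℂ → F, AnalyticAt ℂ a 0 ∧ AnalyticAt ℂ b 0 ∧
      ∀ᶠ z in 𝓝 0, f z = a (z ^ 2) + z • b (z ^ 2) := by
  obtain ⟨p, hp⟩ := hf
  have hs := hasFPowerSeriesAt_iff.1 hp
  simp only [zero_add] at hs
  have h1 : ∀ᶠ z : ℂ in 𝓝 0, Summable fun n => z ^ (2 * n) • p.coeff (2 * n) :=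
    hs.mono fun z hz => hz.summable.comp_injective (i := fun n => 2 * n)
      fun m n h => by simpa using h
  have h2 : ∀ᶠ z : ℂ in 𝓝 0, Summable fun n => z ^ (2 * n) • p.coeff (2 * n + 1) := by
    filter_upwards [hs] with z hz
    -- Off zero the odd part of the series can be divided by `z`; at zero only the constant term
    -- survives.
    by_cases hz0 : z = 0
    · subst hz0
      refine summable_of_ne_finset_zero (s := {0}) fun n hn => ?_
      have : n ≠ 0 := by simpa using hn
      simp [this]
    · have h3 := hz.summable.comp_injective (i := fun n => 2 * n + 1) fun m n h => by simpa using h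
      have h4 := h3.const_smul z⁻¹
      refine h4.congr fun n => ?_
      simp only [Function.comp, smul_smul, pow_succ']
      rw [inv_mul_cancel_left₀ hz0]
  obtain ⟨a, ha, ha'⟩ := exists_analyticAt_of_summable h1
  obtain ⟨b, hb, hb'⟩ := exists_analyticAt_of_summable h2
  refine ⟨a, b, ha, hb, ?_⟩
  filter_upwards [hs, ha', hb'] with z hz hza hzb
  have h5 : HasSum (fun n => z ^ (2 * n + 1) • p.coeff (2 * n + 1)) (z • b (z ^ 2)) := by
    have := hzb.const_smul z
    simpa only [smul_smul, ← pow_succ'] using this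
  exact hz.unique (HasSum.even_add_odd (f := fun n => z ^ n • p.coeff n) hza h5)

-- Writing `f = tⁿ g` with `g 0 ≠ 0`, the quotient of `f` by `t ^ N` tends to `v ≠ 0`; either strict
-- inequality between `n` and `N` would force `g 0` or `v` to be zero.
omit [CompleteSpace F] in
theorem analyticOrderAt_eq_of_isLittleO {f : ℂ → F} (hf : AnalyticAt ℂ f 0) {N : ℕ} {v : F}
    (hv : v ≠ 0) (h : (fun t : ℂ => f t - t ^ N • v) =o[𝓝 0] fun t => t ^ N) :
    analyticOrderAt f 0 = N := by
  have hlim : Tendsto (fun t : ℂ => (t ^ N)⁻¹ • f t) (𝓝[≠] 0) (𝓝 v) := by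
    have h1 := (h.mono (nhdsWithin_le_nhds (s := {0}ᶜ))).tendsto_inv_smul_nhds_zero
    have h2 := h1.add_const v
    rw [zero_add] at h2
    refine h2.congr' ?_
    filter_upwards [self_mem_nhdsWithin] with t ht
    have : t ^ N ≠ 0 := pow_ne_zero N ht
    rw [smul_sub, inv_smul_smul₀ this, sub_add_cancel]
  have htop : analyticOrderAt f 0 ≠ ⊤ := by
    intro H
    rw [analyticOrderAt_eq_top] at H
    refine hv (tendsto_nhds_unique hlim (tendsto_const_nhds.congr' ?_))
    filter_upwards [H.filter_mono nhdsWithin_le_nhds] with t ht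
    rw [ht, smul_zero]
  obtain ⟨n, hn⟩ := ENat.ne_top_iff_exists.1 htop
  obtain ⟨g, hg, hg0, hfg⟩ := (hf.analyticOrderAt_eq_natCast).1 hn.symm
  simp only [sub_zero] at hfg
  have hgl : Tendsto g (𝓝[≠] 0) (𝓝 (g 0)) := hg.continuousAt.tendsto.mono_left nhdsWithin_le_nhds
  have hpow : ∀ m : ℕ, m ≠ 0 → Tendsto (fun t : ℂ => t ^ m) (𝓝[≠] 0) (𝓝 0) := fun m hm => by
    have : Tendsto (fun t : ℂ => t ^ m) (𝓝 0) (𝓝 (0 ^ m)) := (continuous_pow m).tendsto 0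
    rw [zero_pow hm] at this
    exact this.mono_left nhdsWithin_le_nhds
  rw [← hn]
  rcases lt_trichotomy n N with hlt | rfl | hlt
  · exfalso
    have h3 := (hpow (N - n) (by omega)).smul hlim
    rw [zero_smul] at h3
    refine hg0 (tendsto_nhds_unique hgl (h3.congr' ?_))
    filter_upwards [hfg.filter_mono nhdsWithin_le_nhds, self_mem_nhdsWithin] with t ht ht0
    have ht0' : t ≠ 0 := ht0
    rw [ht, smul_smul, smul_smul]
    have : t ^ (N - n) * (t ^ N)⁻¹ * t ^ n = 1 := by
      rw [mul_right_comm, ← pow_add, Nat.sub_add_cancel hlt.le]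
      exact mul_inv_cancel₀ (pow_ne_zero N ht0')
    rw [this, one_smul]
  · rfl
  · exfalso
    have h3 := (hpow (n - N) (by omega)).smul hgl
    rw [zero_smul] at h3
    refine hv (tendsto_nhds_unique hlim (h3.congr' ?_))
    filter_upwards [hfg.filter_mono nhdsWithin_le_nhds, self_mem_nhdsWithin] with t ht ht0
    have ht0' : t ≠ 0 := ht0
    rw [ht, smul_smul]
    congr 1
    have : t ^ n = t ^ (n - N) * t ^ N := by rw [← pow_add, Nat.sub_add_cancel hlt.le]
    rw [this, mul_comm, mul_assoc, mul_inv_cancel₀ (pow_ne_zero N ht0'), mul_one]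

/-- Writing `x - x 0 = t² g`, the function `t √g` is a local coordinate, and `τ` is its inverse. -/
theorem exists_sqrt {x : ℂ → ℂ} (hx : AnalyticAt ℂ x 0)
    (h2 : analyticOrderAt (fun t => x t - x 0) 0 = 2) :
    ∃ τ : ℂ → ℂ, AnalyticAt ℂ τ 0 ∧ τ 0 = 0 ∧ deriv τ 0 ≠ 0 ∧
      ∀ᶠ s in 𝓝 0, x (τ s) = x 0 + s ^ 2 := by
  obtain ⟨g, hg, hg0, hxg⟩ := ((hx.sub analyticAt_const).analyticOrderAt_eq_natCast (n := 2)).1 h2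
  obtain ⟨w, hw⟩ := IsAlgClosed.exists_pow_nat_eq (g 0) (n := 2) two_pos
  have hw0 : w ≠ 0 := by
    rintro rfl
    exact hg0 (by rw [← hw]; simp)
  have hdiv : AnalyticAt ℂ (fun t => g t / g 0) 0 := hg.div analyticAt_const hg0
  have hlog : AnalyticAt ℂ (fun t => Complex.log (g t / g 0)) 0 :=
    hdiv.clog (by simp [div_self hg0])
  -- Normalizing by `g 0` keeps the argument of the logarithm near `1`, where it is analytic; `w`
  -- restores the factor.
  let r : ℂ → ℂ := fun t => w * Complex.exp (Complex.log (g t / g 0) / 2)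
  have hr : AnalyticAt ℂ r 0 := analyticAt_const.mul (hlog.div analyticAt_const two_ne_zero).cexp
  have hr0 : r 0 = w := by simp [r, div_self hg0]
  have hr2 : ∀ᶠ t in 𝓝 0, r t ^ 2 = g t := by
    filter_upwards [hg.continuousAt.eventually_ne hg0] with t ht
    simp only [r]
    rw [mul_pow, hw, ← Complex.exp_nat_mul, Nat.cast_two, mul_div_cancel₀ _ two_ne_zero,
      Complex.exp_log (div_ne_zero ht hg0), mul_div_cancel₀ _ hg0]
  let σ : ℂ → ℂ := fun t => t * r t
  have hσ : AnalyticAt ℂ σ 0 := analyticAt_id.mul hr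
  have hσ' : HasDerivAt σ w 0 := by
    have := (hasDerivAt_id (0 : ℂ)).mul hr.differentiableAt.hasDerivAt
    simp only [id, one_mul, zero_mul, add_zero, hr0] at this
    exact this
  have hσd : deriv σ 0 ≠ 0 := by rwa [hσ'.deriv]
  have hσ0 : σ 0 = 0 := by simp [σ]
  have hinv := hσ.analyticAt_localInverse hσd
  have hτ0 : hσ.hasStrictDerivAt.localInverse σ (deriv σ 0) 0 hσd (σ 0) = 0 :=
    HasStrictFDerivAt.localInverse_apply_image (hσ.hasStrictDerivAt.hasStrictFDerivAt_equiv hσd)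
  have hright := hσ.hasStrictDerivAt.eventually_right_inverse hσd
  have hτd := (hσ.hasStrictDerivAt.to_localInverse hσd).hasDerivAt
  rw [hσ0] at hinv hright hτ0 hτd
  refine ⟨_, hinv, hτ0, ?_, ?_⟩
  · rw [hτd.deriv]
    exact inv_ne_zero hσd
  · have hc := hinv.continuousAt.tendsto
    rw [hτ0] at hc
    filter_upwards [hright, hc.eventually hr2, hc.eventually hxg] with s h3 h4 h5
    simp only [sub_zero, smul_eq_mul] at h5
    rw [← h4, ← mul_pow] at h5
    change _ = σ _ ^ 2 at h5
    rw [h3] at h5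
    rw [← h5]
    exact (add_sub_cancel _ _).symm

/-- The vanishing order of `Y`, modulo analytic functions of `x`, is `N`. -/
def HalfOrder (x : ℂ → ℂ) (Y : ℂ → F) (N : ℕ) : Prop :=
  ∃ a : ℂ → F, AnalyticAt ℂ a (x 0) ∧ analyticOrderAt (fun t => Y t - a (x t)) 0 = N

theorem analyticOrderAt_deriv_eq_one {x : ℂ → ℂ} (hx : AnalyticAt ℂ x 0)
    (h2 : analyticOrderAt (fun t => x t - x 0) 0 = 2) : analyticOrderAt (deriv x) 0 = 1 := by
  rw [← hx.analyticOrderAt_deriv_add_one, ← one_add_one_eq_two] at h2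
  exact (ENat.add_left_injective_of_ne_top (ENat.natCast_ne_top 1)) h2

/-- The derivative of `Y - A(x)` is `x'` times `Z - A'(x)`. One unit of order comes from the simple
zero of `x'`, the other from integrating a function with value zero at `0`. -/
theorem analyticOrderAt_sub_comp {x : ℂ → ℂ} {Y Z A : ℂ → F} (hx : AnalyticAt ℂ x 0)
    (h2 : analyticOrderAt (fun t => x t - x 0) 0 = 2) (hY : AnalyticAt ℂ Y 0)
    (hZ : AnalyticAt ℂ Z 0) (hYZ : ∀ᶠ t in 𝓝 0, deriv Y t = deriv x t • Z t)
    (hA : AnalyticAt ℂ A (x 0)) (h0 : Y 0 = A (x 0)) :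
    analyticOrderAt (fun t => Y t - A (x t)) 0 =
      analyticOrderAt (fun t => Z t - deriv A (x t)) 0 + 2 := by
  have hR : AnalyticAt ℂ (fun t => Y t - A (x t)) 0 := hY.sub (hA.comp hx)
  have h1 := hR.analyticOrderAt_deriv_add_one
  simp only [h0, sub_self, sub_zero] at h1
  have h3 : deriv (fun t => Y t - A (x t)) =ᶠ[𝓝 0] deriv x • fun t => Z t - deriv A (x t) := by
    filter_upwards [hYZ, hx.eventually_analyticAt, hY.eventually_analyticAt,
      hx.continuousAt.eventually hA.eventually_analyticAt] with t t1 t2 t3 t4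
    have h5 := t3.differentiableAt.hasDerivAt.sub
      (t4.differentiableAt.hasDerivAt.scomp t t2.differentiableAt.hasDerivAt)
    refine h5.deriv.trans ?_
    rw [t1, ← smul_sub]
    rfl
  have hZA : AnalyticAt ℂ (fun t => Z t - deriv A (x t)) 0 := hZ.sub (hA.deriv.comp hx)
  rw [← h1, analyticOrderAt_congr h3, analyticOrderAt_smul hx.deriv hZA,
    analyticOrderAt_deriv_eq_one hx h2, add_comm 1, add_assoc, one_add_one_eq_two]

/-- The effect of one prolongation: the correction for `Y` is a primitive of the one for `Z =
dY/dx`, and the order shifts by two. -/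
theorem halfOrder_iff {x : ℂ → ℂ} {Y Z : ℂ → F} (hx : AnalyticAt ℂ x 0)
    (h2 : analyticOrderAt (fun t => x t - x 0) 0 = 2) (hY : AnalyticAt ℂ Y 0)
    (hZ : AnalyticAt ℂ Z 0) (hYZ : ∀ᶠ t in 𝓝 0, deriv Y t = deriv x t • Z t) (N : ℕ) :
    HalfOrder x Z N ↔ HalfOrder x Y (N + 2) := by
  constructor
  · rintro ⟨a, ha, hN⟩
    obtain ⟨A, hA, hA0, hAa⟩ := exists_primitive ha (Y 0)
    refine ⟨A, hA, ?_⟩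
    rw [analyticOrderAt_sub_comp hx h2 hY hZ hYZ hA hA0.symm]
    push_cast
    rw [← hN]
    congr 1
    refine analyticOrderAt_congr ?_
    filter_upwards [hx.continuousAt.eventually hAa] with t ht
    rw [ht.deriv]
  · rintro ⟨A, hA, hN⟩
    -- The order `N + 2` is positive, so the initial values agree.
    have h0 : Y 0 - A (x 0) = 0 := apply_eq_zero_of_analyticOrderAt_ne_zero
      (f := fun t => Y t - A (x t)) (by rw [hN]; exact_mod_cast (Nat.succ_ne_zero (N + 1)))
    rw [analyticOrderAt_sub_comp hx h2 hY hZ hYZ hA (sub_eq_zero.1 h0)] at hN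
    refine ⟨deriv A, hA.deriv, ?_⟩
    push_cast at hN
    exact (ENat.add_left_injective_of_ne_top (ENat.natCast_ne_top 2)) hN

end Analysis

/-! ### `A_{2k}` singularities characterized by half-orders -/

namespace Monster

theorem analyticAt_curveA (d k : ℕ) : AnalyticAt ℂ (curveA d k) 0 := by
  refine AnalyticAt.pi fun i => ?_
  unfold curveA
  split_ifs
  · exact analyticAt_id.pow 2
  · exact analyticAt_id.pow _
  · exact analyticAt_const

theorem curveA_zero (d k : ℕ) : curveA d k 0 = 0 := by
  funext i
  simp [curveA]

theorem curveA_eq (d k : ℕ) (t : ℂ) : curveA (d + 1) k t =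
    t ^ 2 • (Pi.single 0 1 : Fin (d + 2) → ℂ) + t ^ (2 * k + 1) • Pi.single 1 1 := by
  funext i
  by_cases h0 : i = 0
  · subst h0
    simp [curveA]
  · by_cases h1 : i = 1
    · subst h1
      simp [curveA]
    · have h0' : i.val ≠ 0 := fun h => h0 (Fin.ext h)
      have h1' : i.val ≠ 1 := fun h => h1 (Fin.ext h)
      simp [curveA, h0, h1, h0', h1']

theorem analyticAt_insertNth {E : Type*} [NormedAddCommGroup E] [NormedSpace ℂ E] {d : ℕ}
    (i : Fin (d + 1)) {f : E → ℂ} {g : E → Fin d → ℂ} {x : E} (hf : AnalyticAt ℂ f x)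
    (hg : AnalyticAt ℂ g x) :
    AnalyticAt ℂ (fun y => i.insertNth (α := fun _ => ℂ) (f y) (g y)) x := by
  refine AnalyticAt.pi fun j => ?_
  induction j using i.succAboveCases with
  | x => simpa using hf
  | p j => simpa using analyticAt_pi_iff.1 hg j

theorem hasFDerivAt_comp_smulRight {E F : Type*} [NormedAddCommGroup E] [NormedSpace ℂ E]
    [NormedAddCommGroup F] [NormedSpace ℂ F] {b : ℂ → F} {w : F} {p : E → ℂ} {p' : E →L[ℂ] ℂ}
    {x : E} {z : ℂ} (hb : HasDerivAt b w z) (hp : HasFDerivAt p p' x) (hz : p x = z) :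
    HasFDerivAt (fun y => b (p y)) (p'.smulRight w) x := by
  subst hz
  refine (hb.hasFDerivAt.comp x hp).congr_fderiv ?_
  ext1 y
  simp

/-- The normal form of the diffeomorphism bringing a curve into `A_{2k}` form: with a regular first
coordinate, and of maximal rank transversally. -/
theorem isInvertible_fderiv_insertNth {d : ℕ} (i : Fin (d + 2)) {b c : ℂ → Fin (d + 1) → ℂ}
    (hb : AnalyticAt ℂ b 0) (hc : AnalyticAt ℂ c 0) (hc0 : c 0 = 0) (x₀ : ℂ)
    (Λ : (Fin (d + 1) → ℂ) ≃L[ℂ] (Fin (d + 1) → ℂ)) :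
    AnalyticAt ℂ (fun X : Fin (d + 2) → ℂ => i.insertNth (α := fun _ => ℂ) (x₀ + X 0)
      (b (X 0) + X 1 • c (X 0) + Λ (Fin.tail X))) 0 ∧
    (fderiv ℂ (fun X : Fin (d + 2) → ℂ => i.insertNth (α := fun _ => ℂ) (x₀ + X 0)
      (b (X 0) + X 1 • c (X 0) + Λ (Fin.tail X))) 0).IsInvertible := by
  let p0 : (Fin (d + 2) → ℂ) →L[ℂ] ℂ := ContinuousLinearMap.proj 0
  let p1 : (Fin (d + 2) → ℂ) →L[ℂ] ℂ := ContinuousLinearMap.proj 1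
  let pt : (Fin (d + 2) → ℂ) →L[ℂ] (Fin (d + 1) → ℂ) :=
    ContinuousLinearMap.pi fun j => ContinuousLinearMap.proj j.succ
  have hb' : AnalyticAt ℂ (fun X : Fin (d + 2) → ℂ => b (X 0)) 0 :=
    AnalyticAt.comp (g := b) (f := p0) hb (p0.analyticAt 0)
  have hc' : AnalyticAt ℂ (fun X : Fin (d + 2) → ℂ => c (X 0)) 0 :=
    AnalyticAt.comp (g := c) (f := p0) hc (p0.analyticAt 0)
  have hΛ : AnalyticAt ℂ (fun X : Fin (d + 2) → ℂ => Λ (Fin.tail X)) 0 :=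
    (Λ.toContinuousLinearMap.comp pt).analyticAt 0
  have hY := (hb'.add ((p1.analyticAt 0).smul hc')).add hΛ
  have hx : AnalyticAt ℂ (fun X : Fin (d + 2) → ℂ => x₀ + X 0) 0 :=
    analyticAt_const.add (p0.analyticAt 0)
  have han := analyticAt_insertNth i hx hY
  refine ⟨han, ?_⟩
  obtain ⟨w, hw⟩ : ∃ w, HasDerivAt b w 0 := ⟨_, hb.differentiableAt.hasDerivAt⟩
  have hbd : HasFDerivAt (fun X : Fin (d + 2) → ℂ => b (X 0)) (p0.smulRight w) 0 :=
    hasFDerivAt_comp_smulRight (p := p0) (x := 0) hw p0.hasFDerivAt rfl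
  -- Both factors vanish at the origin, so the product contributes nothing and the derivative is
  -- block triangular.
  have hcd : HasFDerivAt (fun X : Fin (d + 2) → ℂ => X 1 • c (X 0))
      (0 : (Fin (d + 2) → ℂ) →L[ℂ] (Fin (d + 1) → ℂ)) 0 := by
    have h1 := (p1.hasFDerivAt (x := (0 : Fin (d + 2) → ℂ))).smul hc'.differentiableAt.hasFDerivAt
    refine h1.congr_fderiv ?_
    ext1 X
    simp [p1, hc0]
  have hΛd : HasFDerivAt (fun X : Fin (d + 2) → ℂ => Λ (Fin.tail X))
      (Λ.toContinuousLinearMap.comp pt) 0 :=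
    (Λ.toContinuousLinearMap.comp pt).hasFDerivAt
  have hYd := (hbd.add hcd).add hΛd
  have hxd : HasFDerivAt (fun X : Fin (d + 2) → ℂ => x₀ + X 0) p0 0 :=
    p0.hasFDerivAt.const_add x₀
  set D := fderiv ℂ (fun X : Fin (d + 2) → ℂ => i.insertNth (α := fun _ => ℂ) (x₀ + X 0)
      (b (X 0) + X 1 • c (X 0) + Λ (Fin.tail X))) 0 with hD
  have hDi := hasFDerivAt_pi'.1 han.differentiableAt.hasFDerivAt
  have hDself : ∀ X, D X i = X 0 := by
    intro X
    have h1 := hDi i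
    simp only [Fin.insertNth_apply_same] at h1
    exact congrArg (fun T : (Fin (d + 2) → ℂ) →L[ℂ] ℂ => T X) (h1.unique hxd)
  have hDother : ∀ X j, D X (i.succAbove j) = X 0 * w j + Λ (Fin.tail X) j := by
    intro X j
    have h1 := hDi (i.succAbove j)
    simp only [Fin.insertNth_apply_succAbove] at h1
    have h2 := congrArg (fun T : (Fin (d + 2) → ℂ) →L[ℂ] ℂ => T X)
      (h1.unique (hasFDerivAt_pi'.1 hYd j))
    refine h2.trans ?_
    simp [p0, pt]
    rfl
  have hinj : Function.Injective D := by
    refine (injective_iff_map_eq_zero D).2 fun X hX => ?_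
    have h0 : X 0 = 0 := by rw [← hDself X, hX]; rfl
    have h1 : Λ (Fin.tail X) = 0 := by
      funext j
      have := hDother X j
      rw [hX, h0, zero_mul, zero_add] at this
      exact this.symm
    have h2 : Fin.tail X = 0 := by simpa using h1
    funext j
    induction j using Fin.cases with
    | zero => exact h0
    | succ j => exact congrFun h2 j
  exact ⟨(LinearEquiv.ofInjectiveEndo D.toLinearMap hinj).toContinuousLinearEquiv, by ext1 X; rfl⟩

/-- A curve with a coordinate of order two, whose other coordinates are of order `2k+1` modulo
functions of the first one, is an `A_{2k}` singularity. -/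
theorem isA2k_of_halfOrder {d k : ℕ} (hd : 1 ≤ d) {γ : ℂ → Fin (d + 1) → ℂ} {i : Fin (d + 1)}
    (hγ : AnalyticAt ℂ γ 0) (h2 : analyticOrderAt (fun t => γ t i - γ 0 i) 0 = 2)
    (hY : HalfOrder (fun t => γ t i) (fun t j => γ t (i.succAbove j)) (2 * k + 1)) :
    IsA2k k γ := by
  obtain ⟨d, rfl⟩ := Nat.exists_eq_add_of_le' hd
  have hx : AnalyticAt ℂ (fun t => γ t i) 0 := analyticAt_pi_iff.1 hγ i
  have hYan : AnalyticAt ℂ (fun t j => γ t (i.succAbove j)) 0 :=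
    AnalyticAt.pi fun j => analyticAt_pi_iff.1 hγ _
  obtain ⟨τ, hτ, hτ0, hτd, hxτ⟩ := exists_sqrt hx h2
  obtain ⟨a, ha, hord⟩ := hY
  have hR : AnalyticAt ℂ (fun t => (fun j => γ t (i.succAbove j)) - a (γ t i)) 0 :=
    hYan.sub (AnalyticAt.comp (g := a) (f := fun t => γ t i) ha hx)
  have hcomp := analyticOrderAt_comp_of_deriv_ne_zero
    (f := fun t => (fun j => γ t (i.succAbove j)) - a (γ t i)) hτ hτd
  rw [hτ0, hord] at hcomp
  have hRτ : AnalyticAt ℂ ((fun t => (fun j => γ t (i.succAbove j)) - a (γ t i)) ∘ τ) 0 :=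
    AnalyticAt.comp_of_eq hR hτ hτ0
  obtain ⟨g, hg, hg0, hRg⟩ := hRτ.analyticOrderAt_eq_natCast.1 hcomp
  -- The remainder is `s ^ (2k+1) g₁(s²) + s ^ (2k+2) g₂(s²)`. The second term is a function of `s²`
  -- and is absorbed into the graph correction `b`; the first is linear in the coordinate `s ^
  -- (2k+1)`.
  obtain ⟨g₁, g₂, hg₁, hg₂, hgg⟩ := exists_even_add_odd hg
  have hg₁0 : g₁ 0 = g 0 := by
    have := hgg.self_of_nhds
    simpa using this.symm
  have hsingle : (Pi.single 0 1 : Fin (d + 1) → ℂ) ≠ 0 := by simp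
  -- The leading coefficient `g₁ 0 = g 0 ≠ 0` is the image of the second axis, and `Λ` completes it
  -- to an isomorphism.
  obtain ⟨Λ, hΛ⟩ := SeparatingDual.exists_continuousLinearEquiv_apply_eq (R := ℂ) hsingle
    (hg₁0 ▸ hg0)
  have hb : AnalyticAt ℂ (fun z => a (γ 0 i + z) + z ^ (k + 1) • g₂ z) 0 := by
    have h1 : AnalyticAt ℂ (fun z => a (γ 0 i + z)) 0 :=
      AnalyticAt.comp_of_eq (g := a) (f := fun z => γ 0 i + z) ha
        (analyticAt_const.add analyticAt_id) (by simp)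
    exact h1.add ((analyticAt_id.pow (k + 1)).smul hg₂)
  have hc : AnalyticAt ℂ (fun z => g₁ z - g₁ 0) 0 := hg₁.sub analyticAt_const
  obtain ⟨han, hinv⟩ := isInvertible_fderiv_insertNth i hb hc (by simp) (γ 0 i) Λ
  refine ⟨_, τ, by rw [curveA_zero]; exact han, by rw [curveA_zero]; exact hinv, hτ, hτ0, hτd, ?_⟩
  have hsq : Tendsto (fun s : ℂ => s ^ 2) (𝓝 0) (𝓝 0) := by
    simpa using (continuous_pow 2).tendsto (0 : ℂ)
  filter_upwards [hxτ, hRg, hgg] with s h3 h4 h5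
  have h0 : curveA (d + 1) k s 0 = s ^ 2 := by simp [curveA]
  have h1 : curveA (d + 1) k s 1 = s ^ (2 * k + 1) := by simp [curveA]
  have ht : Fin.tail (curveA (d + 1) k s) = s ^ (2 * k + 1) • Pi.single 0 1 := by
    funext j
    induction j using Fin.cases with
    | zero => simp [Fin.tail, curveA]
    | succ j => simp [Fin.tail, curveA]
  rw [h0, h1, ht, map_smul, hΛ]
  have h6 : (fun j => γ (τ s) (i.succAbove j)) = a (γ 0 i + s ^ 2) +
      s ^ (2 * k + 1) • (g₁ (s ^ 2) + s • g₂ (s ^ 2)) := by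
    simp only [Function.comp, sub_zero] at h4
    rw [← h5, ← h4, ← h3]
    simp
  funext l
  induction l using i.succAboveCases with
  | x => simpa using h3
  | p j =>
    have h7 := congrFun h6 j
    simp only [Fin.insertNth_apply_succAbove]
    rw [h7]
    simp only [Pi.add_apply, Pi.smul_apply, Pi.sub_apply, smul_eq_mul]
    ring

/-- The diffeomorphism maps the first axis to a curve that is a graph over some coordinate `i`, with
graph function `a`. The defect `G` from that graph vanishes along the axis, and its derivative is
nonzero on the second basis vector, so along the model curve it has order `2k+1`. -/
theorem exists_halfOrder_of_isA2k {d k : ℕ} (hd : 1 ≤ d) (hk : 1 ≤ k)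
    {γ : ℂ → Fin (d + 1) → ℂ} (hγ : AnalyticAt ℂ γ 0) (h : IsA2k k γ) :
    ∃ i, analyticOrderAt (fun t => γ t i - γ 0 i) 0 = 2 ∧
      HalfOrder (fun t => γ t i) (fun t j => γ t (i.succAbove j)) (2 * k + 1) := by
  obtain ⟨d, rfl⟩ := Nat.exists_eq_add_of_le' hd
  obtain ⟨ψ, τ, hψ, hinv, hτ, hτ0, hτd, hγψ⟩ := h
  rw [curveA_zero] at hψ hinv
  have hψ0 : ψ 0 = γ 0 := by
    have := hγψ.self_of_nhds
    rw [curveA_zero, hτ0] at this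
    exact this.symm
  have hcA := analyticAt_curveA (d + 1) k
  have hcA0 := curveA_zero (d + 1) k
  set e0 : Fin (d + 2) → ℂ := Pi.single 0 1 with he0
  set e1 : Fin (d + 2) → ℂ := Pi.single 1 1 with he1
  set D := fderiv ℂ ψ 0 with hD
  have hinj : Function.Injective D := by
    obtain ⟨M, hM⟩ := hinv
    rw [← hM]
    exact M.injective
  have hDe0 : D e0 ≠ 0 := fun H => by
    have : e0 = 0 := hinj (by rw [H, map_zero])
    simp [he0] at this
  obtain ⟨i, hi⟩ := Function.ne_iff.1 hDe0
  have hi' : D e0 i ≠ 0 := hi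
  have hψd : HasStrictFDerivAt ψ D 0 := hψ.hasStrictFDerivAt
  have hline : ∀ z : ℂ, HasDerivAt (fun z : ℂ => z • e0) e0 z := fun z => by
    simpa using (hasDerivAt_id z).smul_const e0
  have hlinea : AnalyticAt ℂ (fun z : ℂ => z • e0) 0 := analyticAt_id.smul analyticAt_const
  have hα : AnalyticAt ℂ (fun z : ℂ => ψ (z • e0)) 0 :=
    AnalyticAt.comp_of_eq hψ hlinea (by simp)
  have hαd : HasDerivAt (fun z : ℂ => ψ (z • e0)) (D e0) 0 :=
    HasFDerivAt.comp_hasDerivAt_of_eq (0 : ℂ) hψd.hasFDerivAt (hline 0) (by simp)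
  have hαi : AnalyticAt ℂ (fun z : ℂ => ψ (z • e0) i) 0 := analyticAt_pi_iff.1 hα i
  have hαid : deriv (fun z : ℂ => ψ (z • e0) i) 0 ≠ 0 := by
    rw [(hasDerivAt_pi.1 hαd i).deriv]
    exact hi'
  have hβ := hαi.analyticAt_localInverse hαid
  have hβ0 := HasStrictFDerivAt.localInverse_apply_image
    (hαi.hasStrictDerivAt.hasStrictFDerivAt_equiv hαid)
  have hβl := HasStrictFDerivAt.eventually_left_inverse
    (hαi.hasStrictDerivAt.hasStrictFDerivAt_equiv hαid)
  change AnalyticAt ℂ (HasStrictFDerivAt.localInverse _ _ _ _) _ at hβ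
  set β := HasStrictFDerivAt.localInverse _ _ _
    (hαi.hasStrictDerivAt.hasStrictFDerivAt_equiv hαid) with hβdef
  simp only [zero_smul, hψ0] at hβ hβ0
  let η : ℂ → Fin (d + 1) → ℂ := fun z j => ψ (z • e0) (i.succAbove j)
  have hη : AnalyticAt ℂ η 0 := AnalyticAt.pi fun j => analyticAt_pi_iff.1 hα _
  let a : ℂ → Fin (d + 1) → ℂ := fun z => η (β z)
  have ha : AnalyticAt ℂ a (γ 0 i) := AnalyticAt.comp_of_eq hη hβ hβ0
  let proj : (Fin (d + 2) → ℂ) →L[ℂ] (Fin (d + 1) → ℂ) :=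
    ContinuousLinearMap.pi fun j => ContinuousLinearMap.proj (i.succAbove j)
  let pi : (Fin (d + 2) → ℂ) →L[ℂ] ℂ := ContinuousLinearMap.proj i
  let G : (Fin (d + 2) → ℂ) → Fin (d + 1) → ℂ := fun X => proj (ψ X) - a (ψ X i)
  have hψi : AnalyticAt ℂ (fun X => ψ X i) 0 := analyticAt_pi_iff.1 hψ i
  have hG : AnalyticAt ℂ G 0 := by
    have h1 : AnalyticAt ℂ (fun X => proj (ψ X)) 0 := (proj.analyticAt _).comp hψ
    have h2 : AnalyticAt ℂ (fun X => a (ψ X i)) 0 :=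
      AnalyticAt.comp_of_eq (g := a) ha hψi (by rw [hψ0])
    exact h1.sub h2
  have hGd : HasFDerivAt G (proj.comp D - ((pi.comp D).smulRight (deriv a (γ 0 i)))) 0 := by
    have h1 : HasFDerivAt (fun X => proj (ψ X)) (proj.comp D) 0 :=
      proj.hasFDerivAt.comp 0 hψd.hasFDerivAt
    have h2 : HasFDerivAt (fun X => a (ψ X i)) ((pi.comp D).smulRight (deriv a (γ 0 i))) 0 := by
      exact hasFDerivAt_comp_smulRight ha.differentiableAt.hasDerivAt
        (pi.hasFDerivAt.comp 0 hψd.hasFDerivAt) (by rw [hψ0])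
    exact h1.sub h2
  have hGline : ∀ᶠ z : ℂ in 𝓝 0, G (z • e0) = 0 := by
    filter_upwards [hβl] with z hz
    change proj (ψ (z • e0)) - η (β (ψ (z • e0) i)) = 0
    rw [hz]
    exact sub_self _
  set G' := proj.comp D - ((pi.comp D).smulRight (deriv a (γ 0 i))) with hG'
  have hGs : HasStrictFDerivAt G G' 0 := by
    have := hG.hasStrictFDerivAt
    rwa [hGd.fderiv] at this
  have hG'e0 : G' e0 = 0 := by
    have h1 : HasDerivAt (fun z : ℂ => G (z • e0)) (G' e0) 0 :=
      HasFDerivAt.comp_hasDerivAt_of_eq (0 : ℂ) hGd (hline 0) (by simp)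
    exact h1.unique ((hasDerivAt_const (0 : ℂ) (0 : Fin (d + 1) → ℂ)).congr_of_eventuallyEq hGline)
  have hker : ∀ X, G' X = 0 → D X i = 0 → X = 0 := by
    intro X hX hXi
    apply hinj
    rw [map_zero]
    funext l
    induction l using i.succAboveCases with
    | x => exact hXi
    | p j =>
      have h1 := congrFun hX j
      have h2 : D X (i.succAbove j) - D X i * deriv a (γ 0 i) j = 0 := h1
      rw [hXi, zero_mul, sub_zero] at h2
      exact h2
  have hG'e1 : G' e1 ≠ 0 := by
    intro H
    -- Subtracting this multiple of `e0` annihilates the `i`-th component; a vector killed by that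
    -- component and by `G'` is zero.
    have h1 : e1 - (D e1 i / D e0 i) • e0 = 0 := by
      apply hker
      · rw [map_sub, map_smul, H, hG'e0]
        simp
      · rw [map_sub, map_smul]
        simp only [Pi.sub_apply, Pi.smul_apply, smul_eq_mul]
        rw [div_mul_cancel₀ _ hi', sub_self]
    have h2 := congrFun h1 1
    simp [he0, he1] at h2
  have hγi : AnalyticAt ℂ (fun t => γ t i) 0 := analyticAt_pi_iff.1 hγ i
  have hYan : AnalyticAt ℂ (fun t j => γ t (i.succAbove j)) 0 :=
    AnalyticAt.pi fun j => analyticAt_pi_iff.1 hγ _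
  have hpow0 : ∀ m : ℕ, m ≠ 0 → Tendsto (fun t : ℂ => t ^ m) (𝓝 0) (𝓝 0) := fun m hm => by
    have := (continuous_pow m).tendsto (0 : ℂ)
    rwa [zero_pow hm] at this
  refine ⟨i, ?_, a, ha, ?_⟩
  · have hcomp := analyticOrderAt_comp_of_deriv_ne_zero (f := fun t => γ t i - γ 0 i) hτ hτd
    rw [hτ0] at hcomp
    rw [← hcomp]
    have hψc : AnalyticAt ℂ (fun t => ψ (curveA (d + 1) k t) i - γ 0 i) 0 :=
      (AnalyticAt.comp_of_eq hψi hcA hcA0).sub analyticAt_const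
    have hcongr : ((fun t => γ t i - γ 0 i) ∘ τ) =ᶠ[𝓝 0]
        fun t => ψ (curveA (d + 1) k t) i - γ 0 i :=
      hγψ.mono fun t ht => by simp only [Function.comp, ht]
    rw [analyticOrderAt_congr hcongr]
    refine analyticOrderAt_eq_of_isLittleO hψc (v := D e0 i) hi' ?_
    have h1 : HasFDerivAt (fun X => ψ X i) (pi.comp D) 0 := pi.hasFDerivAt.comp 0 hψd.hasFDerivAt
    have h2 := h1.isLittleO
    have hcAt : Tendsto (curveA (d + 1) k) (𝓝 0) (𝓝 0) := by
      have := hcA.continuousAt.tendsto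
      rwa [hcA0] at this
    have h3 := h2.comp_tendsto hcAt
    have hO : (fun t => curveA (d + 1) k t - 0) =O[𝓝 0] fun t : ℂ => t ^ 2 := by
      have h4 : (fun t : ℂ => t ^ 2 • e0 + t ^ (2 * k + 1) • e1) =O[𝓝 0] fun t : ℂ => t ^ 2 := by
        refine Asymptotics.IsBigO.add ?_ ?_
        · exact ((Asymptotics.isBigO_refl _ _).smul
            (Asymptotics.isBigO_const_const e0 (one_ne_zero (α := ℂ)) _)).trans
            (by simpa using Asymptotics.isBigO_refl (fun t : ℂ => t ^ 2) (𝓝 0))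
        · have h5 : (fun t : ℂ => t ^ (2 * k + 1)) =O[𝓝 0] fun t : ℂ => t ^ 2 := by
            exact (Asymptotics.isLittleO_pow_pow (by omega)).isBigO
          exact (h5.smul (Asymptotics.isBigO_const_const e1 (one_ne_zero (α := ℂ)) _)).trans
            (by simpa using Asymptotics.isBigO_refl (fun t : ℂ => t ^ 2) (𝓝 0))
      refine h4.congr_left fun t => ?_
      rw [curveA_eq, sub_zero]
    have h6 := h3.trans_isBigO hO
    have h7 : (fun t : ℂ => t ^ (2 * k + 1) * D e1 i) =o[𝓝 0] fun t : ℂ => t ^ 2 := by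
      have h8 : (fun t : ℂ => t ^ (2 * k + 1)) =o[𝓝 0] fun t : ℂ => t ^ 2 :=
        Asymptotics.isLittleO_pow_pow (by omega)
      simpa [mul_comm] using h8.const_mul_left (D e1 i)
    refine (h6.add h7).congr_left fun t => ?_
    simp only [Function.comp, sub_zero, hψ0]
    rw [curveA_eq, map_add, map_smul, map_smul]
    change _ - (t ^ 2 * D e0 i + t ^ (2 * k + 1) * D e1 i) + _ = _ - t ^ 2 * D e0 i
    ring
  · have hcomp := analyticOrderAt_comp_of_deriv_ne_zero
      (f := fun t => (fun j => γ t (i.succAbove j)) - a (γ t i)) hτ hτd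
    rw [hτ0] at hcomp
    rw [← hcomp]
    have hGc : AnalyticAt ℂ (fun t => G (curveA (d + 1) k t)) 0 :=
      AnalyticAt.comp_of_eq hG hcA hcA0
    have hcongr : ((fun t => (fun j => γ t (i.succAbove j)) - a (γ t i)) ∘ τ) =ᶠ[𝓝 0]
        fun t => G (curveA (d + 1) k t) :=
      hγψ.mono fun t ht => by simp only [Function.comp, ht]; rfl
    rw [analyticOrderAt_congr hcongr]
    refine analyticOrderAt_eq_of_isLittleO hGc (v := G' e1) hG'e1 ?_
    -- Strict differentiability is essential: the curve is compared with its shadow `t² e0` on the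
    -- axis, from which it differs by exactly `t ^ (2k+1) e1`. Differentiability at the origin alone
    -- would give an error of size `o(t²)`.
    have hT : Tendsto (fun t : ℂ => (curveA (d + 1) k t, t ^ 2 • e0)) (𝓝 0)
        (𝓝 ((0 : Fin (d + 2) → ℂ), (0 : Fin (d + 2) → ℂ))) := by
      refine Tendsto.prodMk_nhds ?_ ?_
      · have := hcA.continuousAt.tendsto
        rwa [hcA0] at this
      · have := (hpow0 2 two_ne_zero).smul_const e0
        rwa [zero_smul] at this
    have h2 := hGs.isLittleO.comp_tendsto hT
    have hO : ((fun p : (Fin (d + 2) → ℂ) × (Fin (d + 2) → ℂ) => p.1 - p.2) ∘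
        fun t : ℂ => (curveA (d + 1) k t, t ^ 2 • e0)) =O[𝓝 0] fun t : ℂ => t ^ (2 * k + 1) := by
      have h4 : (fun t : ℂ => t ^ (2 * k + 1) • e1) =O[𝓝 0] fun t : ℂ => t ^ (2 * k + 1) :=
        ((Asymptotics.isBigO_refl _ _).smul
            (Asymptotics.isBigO_const_const e1 (one_ne_zero (α := ℂ)) _)).trans
            (by simpa using Asymptotics.isBigO_refl (fun t : ℂ => t ^ (2 * k + 1)) (𝓝 0))
      refine h4.congr_left fun t => ?_
      simp only [Function.comp, curveA_eq]
      rw [add_sub_cancel_left]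
    refine (h2.trans_isBigO hO).congr' ?_ EventuallyEq.rfl
    filter_upwards [(hpow0 2 two_ne_zero).eventually hGline] with t ht
    simp only [Function.comp, ht]
    rw [curveA_eq, add_sub_cancel_left, map_smul, sub_zero]

end Monster

/-! ### Immersed prolongations and tangent lines -/

namespace DistManifold.Framed

variable {d : ℕ} {L : DistManifold d} (h : L.Framed)
include h

omit h in
theorem frameCoord_prolong_of_ne (a : L.ι) (c₁ : ℂ → L.ProjPt) (t : ℂ) {i s : Fin (d + 1)}
    (hs : s ≠ i) : L.prolong.frameCoord (a, i) c₁ t s =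
      affineVec i (L.projAtlas.chart (a, i) (c₁ t)).2 s := by
  obtain ⟨j, rfl⟩ := Fin.exists_succAbove_eq hs
  rw [affineVec_succAbove, frameCoord_prolong_succAbove]

theorem eventually_deriv_apply_of_prolongs {c : ℂ → L.Pt} {c₁ : ℂ → L.ProjPt}
    (hp : L.Prolongs c c₁) {a : L.ι} {i : Fin (d + 1)} (ha : c₁ 0 ∈ L.projAtlas.dom (a, i))
    {s : Fin (d + 1)} (hs : s ≠ i) :
    ∀ᶠ t in 𝓝 0, deriv (L.frameCoord a c) t s =
      deriv (L.frameCoord a c) t i * L.prolong.frameCoord (a, i) c₁ t s := by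
  filter_upwards [h.eventually_deriv_of_prolongs hp ha] with t ht
  rw [frameCoord_prolong_of_ne a c₁ t hs, ht]
  simp

/-- The velocity lies in `D` off `0`, hence at `0` by analyticity, and a vector of `D` is nonzero as
soon as its coframe values are nonzero in one chart. -/
theorem deriv_frameCoord_ne_zero_of_chart {c : ℂ → L.Pt} {c₁ : ℂ → L.ProjPt}
    (hp : L.Prolongs c c₁) {a b : L.ι} (ha : c 0 ∈ L.dom a) (hb : c 0 ∈ L.dom b)
    (hne : deriv (L.frameCoord a c) 0 ≠ 0) : deriv (L.frameCoord b c) 0 ≠ 0 := by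
  have := h.completeSpace
  have hbase := base_eq_of_prolongs hp
  obtain ⟨i, hi⟩ := Function.ne_iff.1 (h.homCoord_ne_zero (q := c₁ 0) (hbase ▸ ha))
  have hm : c₁ 0 ∈ L.projAtlas.dom (a, i) := ⟨hbase ▸ ha, hi⟩
  have hX := h.analyticAt_chart_base hp hm
  have hF := h.analyticAt_frameCoord hX
  have hmem : ∀ᶠ t in 𝓝 0, c t ∈ L.dom a := by
    filter_upwards [h.eventually_mem_of_prolongs hp hm, hp.2.1] with t h1 h2
    rw [← h2]
    exact h1.1
  have hlift : AnalyticAt ℂ (fun t => h.lift a (L.chart a (c t))) 0 :=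
    AnalyticAt.comp (g := h.lift a) (f := fun t => L.chart a (c t)) (h.analyticAt_lift a _) hX
  have hev : ∀ᶠ t in 𝓝[≠] 0, deriv (fun t => L.chart a (c t)) t =
      h.lift a (L.chart a (c t)) (deriv (L.frameCoord a c) t) := by
    filter_upwards [hp.2.2, hmem.filter_mono nhdsWithin_le_nhds] with t ⟨v, hv, hvel, _⟩ ht
    have h1 := hvel.2 a ht
    rw [h1.deriv, (h.hasDerivAt_frameCoord h1).deriv]
    exact (h.mem_D a _ v.1 ht).1 v.2
  have h0 := ((hX.deriv.frequently_eq_iff_eventually_eq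
    (analyticAt_clm_apply hlift hF.deriv)).1 hev.frequently).self_of_nhds
  obtain ⟨v, hv, hv'⟩ := h.exists_D ha (deriv (L.frameCoord a c) 0)
  have hvel : L.HasVelocity c 0 (c 0) v.1 := by
    refine h.regular.hasVelocity_of_chart rfl hmem ?_
    rw [hv, ← h0]
    exact hX.differentiableAt.hasDerivAt
  have hb' := (h.hasDerivAt_frameCoord (hvel.2 b hb)).deriv
  rw [hb']
  refine h.coframe_ne_zero hb fun H => hne ?_
  rw [← hv', H]
  exact map_zero (L.coframe a)

theorem tangentLine_of_hasVelocity {c : ℂ → L.Pt} {p : L.Pt} {v : L.D p} (hv : v ≠ 0)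
    (hc : L.HasVelocity c 0 p v) : L.TangentLine c ⟨p, Projectivization.mk ℂ v hv⟩ := by
  refine ⟨hc.1.symm, fun a ha => ?_⟩
  obtain ⟨k, hk, hk'⟩ := exists_homCoord_mk hv
  rw [hc.1] at ha
  exact ⟨k, hk, by rw [hk' a, (h.hasDerivAt_frameCoord (hc.2 a ha)).deriv]⟩

theorem deriv_frameCoord_base_self {a : L.ι} {i : Fin (d + 1)} {c₁ : ℂ → L.ProjPt}
    (hc : IsIntegralIn h.prolong (a, i) c₁) :
    deriv (L.prolong.frameCoord (a, i) c₁) 0 i =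
      deriv (L.frameCoord a fun t => (c₁ t).base) 0 i := by
  have h2 : AnalyticAt ℂ (fun t => L.chart a (c₁ t).base) 0 := (h.isIntegralIn_base hc).1.2.1
  rw [deriv_frameCoord_apply (h.prolong.analyticAt_frameCoord hc.2.1),
    deriv_frameCoord_apply (h.analyticAt_frameCoord h2)]
  congr 1
  funext t
  exact prolongCoframe_self (a, i) _

theorem prolongs_of_deriv_ne_zero {a : L.ι} {i : Fin (d + 1)} {c₁ : ℂ → L.ProjPt}
    (hc : IsIntegralIn h.prolong (a, i) c₁)
    (hne : deriv (L.prolong.frameCoord (a, i) c₁) 0 i ≠ 0) :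
    L.Prolongs (fun t => (c₁ t).base) c₁ := by
  refine h.prolongs_of_isIntegralIn hc ?_
  rw [h.deriv_frameCoord_base_self hc] at hne
  have hF := analyticAt_pi_iff.1 (h.analyticAt_frameCoord (h.isIntegralIn_base hc).1.2.1).deriv i
  exact (hF.continuousAt.eventually_ne hne).filter_mono nhdsWithin_le_nhds

end DistManifold.Framed

/-! ### From the code to orders, in a chart with constant slot -/

namespace Monster

open DistManifold DistManifold.Framed

variable {d : ℕ}

/-- The chart all of whose slots are `i`. -/
def constChart (i : Fin (d + 1)) : (m : ℕ) → (Monster d m).ι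
  | 0 => ()
  | m + 1 => (constChart i m, i)

theorem nonVertical_of_mem_constChart {i : Fin (d + 1)} {m : ℕ} {q : (Monster d m).Pt}
    (hq : q ∈ (Monster d m).dom (constChart i m)) : NonVertical m q := by
  induction m with
  | zero => trivial
  | succ m ih =>
    refine ⟨ih hq.1, fun hv => ?_⟩
    rcases m with _ | m
    · exact hv
    · exact hq.2 ((isVertical_iff_homCoord (a := constChart i m) hq.1).1 hv)

/-- A slot chosen at level one remains usable: losing it at some level would mean a vertical line.
-/
theorem NonVertical.exists_constChart {m : ℕ} {q : (Monster d (m + 1)).Pt}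
    (h : NonVertical (m + 1) q) : ∃ i, q ∈ (Monster d (m + 1)).dom (constChart i (m + 1)) := by
  induction m with
  | zero =>
    obtain ⟨i, hi⟩ := Function.ne_iff.1
      ((framed d 0).homCoord_ne_zero (q := q) (a := ()) trivial)
    exact ⟨i, trivial, hi⟩
  | succ m ih =>
    obtain ⟨i, hi⟩ := ih h.1
    exact ⟨i, hi, fun H => h.2 ((isVertical_iff_homCoord (a := constChart i m) hi).2 H)⟩

/-- The components of the frame coordinates off the slot `i`. -/
noncomputable def offSlot {m : ℕ} (a : (Monster d m).ι) (i : Fin (d + 1))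
    (Γ : ℂ → (Monster d m).Pt) (t : ℂ) (j : Fin d) : ℂ :=
  (Monster d m).frameCoord a Γ t (i.succAbove j)

theorem analyticAt_offSlot {m : ℕ} {a : (Monster d m).ι} {i : Fin (d + 1)}
    {Γ : ℂ → (Monster d m).Pt} {t : ℂ} (h : AnalyticAt ℂ ((Monster d m).frameCoord a Γ) t) :
    AnalyticAt ℂ (offSlot a i Γ) t :=
  AnalyticAt.pi fun _ => analyticAt_pi_iff.1 h _

theorem deriv_offSlot {m : ℕ} {a : (Monster d m).ι} {i : Fin (d + 1)}
    {Γ : ℂ → (Monster d m).Pt} {t : ℂ} (h : AnalyticAt ℂ ((Monster d m).frameCoord a Γ) t) :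
    deriv (offSlot a i Γ) t = fun j => deriv ((Monster d m).frameCoord a Γ) t (i.succAbove j) :=
  (hasDerivAt_pi.2 fun j => hasDerivAt_pi.1 h.differentiableAt.hasDerivAt (i.succAbove j)).deriv

/-- In this chart the coframe coordinates are `x` and the `m`-th derivatives of the other
coordinates with respect to `x`; each derivative costs two units of order. -/
theorem frameCoord_constChart {γ : ℂ → Fin (d + 1) → ℂ} (hγ : AnalyticAt ℂ γ 0)
    {i : Fin (d + 1)} {m : ℕ} {Γ : ℂ → (Monster d m).Pt} (hΓ : IsProlongation m γ Γ)
    (h0 : Γ 0 ∈ (Monster d m).dom (constChart i m)) :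
    (∀ᶠ t in 𝓝 0, (Monster d m).frameCoord (constChart i m) Γ t i = γ t i) ∧
    AnalyticAt ℂ ((Monster d m).frameCoord (constChart i m) Γ) 0 ∧
    (analyticOrderAt (fun t => γ t i - γ 0 i) 0 = 2 → ∀ N,
      HalfOrder (fun t => γ t i) (offSlot (constChart i m) i Γ) N ↔
        HalfOrder (fun t => γ t i) (fun t j => γ t (i.succAbove j)) (N + 2 * m)) := by
  induction m with
  | zero =>
    have : Γ = γ := hΓ
    subst this
    exact ⟨.of_forall fun _ => rfl, hγ, fun _ N => Iff.rfl⟩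
  | succ m ih =>
    obtain ⟨Γ', hΓ', hp⟩ := hΓ
    have hb : (DistManifold.ProjPt.base (L := Monster d m) (Γ 0)) = Γ' 0 := base_eq_of_prolongs hp
    obtain ⟨h1, h2, h3⟩ := ih hΓ' (hb ▸ h0.1)
    have hF1 := (framed d m).analyticAt_frameCoord_prolong hp h0
    refine ⟨?_, hF1, fun hord N => ?_⟩
    · filter_upwards [h1, frameCoord_self_of_prolongs hp (constChart i m) i] with t t1 t2
      exact t2.trans t1
    · have hx : AnalyticAt ℂ (fun t => γ t i) 0 := analyticAt_pi_iff.1 hγ i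
      rw [show N + 2 * (m + 1) = (N + 2) + 2 * m by ring, ← h3 hord]
      refine halfOrder_iff hx hord (analyticAt_offSlot h2)
        (analyticAt_offSlot (m := m + 1) hF1) ?_ N
      filter_upwards [(framed d m).eventually_deriv_of_prolongs hp h0, h2.eventually_analyticAt,
        eventually_eventually_nhds.2 h1] with t t1 t2 t3
      have hd : deriv ((Monster d m).frameCoord (constChart i m) Γ') t i =
          deriv (fun t => γ t i) t := by
        rw [deriv_frameCoord_apply t2]
        exact EventuallyEq.deriv_eq t3
      rw [deriv_offSlot t2, t1, ← hd]
      funext j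
      have := frameCoord_prolong_succAbove (L := Monster d m) (constChart i m) i Γ t j
      simp only [Pi.smul_apply, affineVec_succAbove, smul_eq_mul]
      rw [← this]
      rfl

/-- Near a vertical point over a nonvertical one, the slot coordinate has a simple critical
point. -/
theorem order_deriv_of_vertical {i : Fin (d + 1)} {k : ℕ} {Γ' : ℂ → (Monster d (k + 1)).Pt}
    {Γ : ℂ → (Monster d (k + 2)).Pt} (hp : (Monster d (k + 1)).Prolongs Γ' Γ)
    (h0 : Γ' 0 ∈ (Monster d (k + 1)).dom (constChart i (k + 1))) (hV : IsVertical (k + 2) (Γ 0))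
    {q : (Monster d (k + 3)).Pt} (hq : (Monster d (k + 2)).TangentLine Γ q)
    (hqV : ¬ IsVertical (k + 3) q) (hqT : ¬ IsTan (k + 3) q) :
    analyticOrderAt (fun t =>
      deriv ((Monster d (k + 1)).frameCoord (constChart i (k + 1)) Γ') t i) 0 = 1 ∧
    deriv (offSlot (constChart i (k + 1)) i Γ') 0 ≠ 0 := by
  have hb : (DistManifold.ProjPt.base (L := Monster d (k + 1)) (Γ 0)) = Γ' 0 :=
    base_eq_of_prolongs hp
  have hm : DistManifold.ProjPt.base (L := Monster d (k + 1)) (Γ 0) ∈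
    (Monster d (k + 1)).dom (constChart i (k + 1)) := hb ▸ h0
  have hV' := (isVertical_iff_homCoord (a := constChart i k) (i := i) hm).1 hV
  obtain ⟨i', hi'⟩ := Function.ne_iff.1 ((framed d (k + 1)).homCoord_ne_zero (q := Γ 0) hm)
  have hm' : Γ 0 ∈ (Monster d (k + 1)).projAtlas.dom (constChart i (k + 1), i') := ⟨hm, hi'⟩
  have hii : i' ≠ i := by
    rintro rfl
    exact hi' hV'
  have hqb : down q = Γ 0 := hq.1
  have hqm : down q ∈ (Monster d (k + 2)).dom ((constChart i k, i), i') := by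
    rw [hqb]
    exact hm'
  obtain ⟨c, hc, hc'⟩ := hq.2 (constChart i (k + 1), i') hm'
  rw [isVertical_iff_homCoord hqm] at hqV
  rw [isTan_iff_homCoord hqm, hqb] at hqT
  have hqT' := fun H => hqT ⟨hV', H⟩
  set F := (Monster d (k + 1)).frameCoord (constChart i (k + 1)) Γ' with hF
  set F₁ := (Monster d (k + 2)).frameCoord (constChart i (k + 1), i') Γ with hF₁
  have hFa : AnalyticAt ℂ F 0 := (framed d (k + 1)).analyticAt_frameCoord_base hp hm'
  have hF₁a : AnalyticAt ℂ F₁ 0 := (framed d (k + 1)).analyticAt_frameCoord_prolong hp hm'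
  -- Nonverticality of `q` gives a nonzero derivative in the new slot; nontangency gives one for the
  -- coordinate that vanishes at the vertical point.
  have hd1 : deriv F₁ 0 i' ≠ 0 := fun H => hqV (by
    have := congrFun hc' i'
    exact this.trans (by rw [Pi.smul_apply]; exact (congrArg (c • ·) H).trans (smul_zero c)))
  have hd2 : deriv F₁ 0 i ≠ 0 := fun H => hqT' (by
    have := congrFun hc' i
    exact this.trans (by rw [Pi.smul_apply]; exact (congrArg (c • ·) H).trans (smul_zero c)))
  have hd3 : deriv F 0 i' ≠ 0 := by
    have := (framed d (k + 1)).deriv_frameCoord_self hp hm'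
    rw [← this]
    exact hd1
  have hF10 : F₁ 0 i = 0 := by
    exact (frameCoord_prolong_of_ne (L := Monster d (k + 1)) _ _ _ hii.symm).trans
      ((homCoord_eq_zero_iff hm').1 hV')
  have hev := (framed d (k + 1)).eventually_deriv_apply_of_prolongs hp hm' hii.symm
  constructor
  · have hi'a : AnalyticAt ℂ (fun t => deriv F t i') 0 := analyticAt_pi_iff.1 hFa.deriv i'
    have hia : AnalyticAt ℂ (fun t => F₁ t i) 0 := analyticAt_pi_iff.1 hF₁a i
    -- The relation `dx = (dx/dz) dz`: a unit times a function with a simple zero.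
    have hcongr : (fun t => deriv F t i) =ᶠ[𝓝 0] (fun t => deriv F t i') * fun t => F₁ t i := hev
    rw [analyticOrderAt_congr hcongr, analyticOrderAt_mul hi'a hia,
      hi'a.analyticOrderAt_eq_zero.2 hd3, zero_add]
    refine hia.analyticOrderAt_eq_one_of_zero_deriv_ne_zero hF10 ?_
    rwa [← deriv_frameCoord_apply (L := Monster d (k + 2)) hF₁a]
  · rw [deriv_offSlot hFa]
    obtain ⟨l, hl⟩ := Fin.exists_succAbove_eq hii
    refine Function.ne_iff.2 ⟨l, ?_⟩
    rw [hl]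
    exact hd3

/-- The tangent line `q` stands in for the point one level higher, so that the class ending in V and
those with further letters R are treated alike. The induction descends to the vertical level. -/
theorem exists_halfOrder_of_tangentLine {γ : ℂ → Fin (d + 1) → ℂ} (hγ : AnalyticAt ℂ γ 0)
    {k m : ℕ} {Γ : ℂ → (Monster d m).Pt} (hΓ : IsProlongation m γ Γ)
    (hk : OnlyVertical k m (Γ 0)) {q : (Monster d (m + 1)).Pt}
    (hq : (Monster d m).TangentLine Γ q) (hqV : ¬ IsVertical (m + 1) q)
    (hqT : ¬ IsTan (m + 1) q) :
    ∃ i, analyticOrderAt (fun t => γ t i - γ 0 i) 0 = 2 ∧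
      HalfOrder (fun t => γ t i) (fun t j => γ t (i.succAbove j)) (2 * k + 1) := by
  induction m with
  | zero => exact hk.elim
  | succ m ih =>
    obtain ⟨Γ', hΓ', hp⟩ := hΓ
    have hb : down (Γ 0) = Γ' 0 := base_eq_of_prolongs hp
    rcases hk with ⟨rfl, hn, hV⟩ | ⟨hk, hV, hT⟩
    · rcases m with _ | k
      · exact hV.elim
      obtain ⟨i, hi⟩ := hn.exists_constChart
      rw [hb] at hi
      obtain ⟨h1, h2⟩ := order_deriv_of_vertical hp hi hV hq hqV hqT
      obtain ⟨h3, h4, h5⟩ := frameCoord_constChart hγ hΓ' hi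
      have hx : AnalyticAt ℂ (fun t => γ t i) 0 := analyticAt_pi_iff.1 hγ i
      have hord : analyticOrderAt (fun t => γ t i - γ 0 i) 0 = 2 := by
        rw [← hx.analyticOrderAt_deriv_add_one, ← one_add_one_eq_two, ← h1]
        congr 1
        refine analyticOrderAt_congr ?_
        filter_upwards [eventually_eventually_nhds.2 h3, h4.eventually_analyticAt] with t t1 t2
        rw [deriv_frameCoord_apply t2]
        exact (EventuallyEq.deriv_eq t1).symm
      refine ⟨i, hord, ?_⟩
      rw [add_comm, ← h5 hord]
      -- Just below the vertical point the off-slot coordinates have nonzero derivative, hence order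
      -- one modulo a constant.
      refine ⟨fun _ => offSlot (constChart i (k + 1)) i Γ' 0, analyticAt_const, ?_⟩
      rw [Nat.cast_one]
      exact (analyticAt_offSlot h4).analyticOrderAt_sub_eq_one_of_deriv_ne_zero h2
    · rcases m with _ | m
      · exact hk.elim
      exact ih hΓ' (hb ▸ hk) ((framed d (m + 1)).tangentLine_descend hp hq hqV) hV hT

end Monster

/-! ### From orders back to the code -/

namespace Monster

open DistManifold DistManifold.Framed

variable {d : ℕ}

/-- As `x'` vanishes at `0`, subtracting a function of `x` does not change the derivative there. -/
theorem _root_.HalfOrder.deriv_eq_zero_iff {F : Type*} [NormedAddCommGroup F] [NormedSpace ℂ F]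
    [CompleteSpace F] {x : ℂ → ℂ} {Y : ℂ → F} {N : ℕ} (hY : HalfOrder x Y (N + 1))
    (hx : AnalyticAt ℂ x 0) (hYa : AnalyticAt ℂ Y 0) (hx' : deriv x 0 = 0) :
    deriv Y 0 = 0 ↔ N ≠ 0 := by
  obtain ⟨a, ha, hord⟩ := hY
  have hR : AnalyticAt ℂ (fun t => Y t - a (x t)) 0 :=
    hYa.sub (AnalyticAt.comp (g := a) (f := x) ha hx)
  have h0 : Y 0 - a (x 0) = 0 := apply_eq_zero_of_analyticOrderAt_ne_zero
    (f := fun t => Y t - a (x t)) (by rw [hord]; exact_mod_cast Nat.succ_ne_zero N)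
  have h1 := hR.analyticOrderAt_deriv_add_one
  simp only [h0, sub_zero] at h1
  rw [hord] at h1
  push_cast at h1
  have h2 : analyticOrderAt (deriv fun t => Y t - a (x t)) 0 = N :=
    (ENat.add_left_injective_of_ne_top (ENat.natCast_ne_top 1)) h1
  have h3 : deriv (fun t => Y t - a (x t)) 0 = deriv Y 0 := by
    have h4 := hYa.differentiableAt.hasDerivAt.sub
      (ha.differentiableAt.hasDerivAt.scomp (0 : ℂ) hx.differentiableAt.hasDerivAt)
    refine h4.deriv.trans ?_
    rw [hx', zero_smul, sub_zero]
  rw [← h3, ← hR.deriv.analyticOrderAt_ne_zero, h2]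
  exact_mod_cast Iff.rfl

section

variable {γ : ℂ → Fin (d + 1) → ℂ} (hγ : AnalyticAt ℂ γ 0) {k : ℕ} {i : Fin (d + 1)}
  (hord : analyticOrderAt (fun t => γ t i - γ 0 i) 0 = 2)
  (hY : HalfOrder (fun t => γ t i) (fun t j => γ t (i.succAbove j)) (2 * k + 1))
include hγ hord

theorem order_deriv_slot {m : ℕ} {Γ : ℂ → (Monster d m).Pt} (hΓ : IsProlongation m γ Γ)
    (h0 : Γ 0 ∈ (Monster d m).dom (constChart i m)) :
    analyticOrderAt (fun t => deriv ((Monster d m).frameCoord (constChart i m) Γ) t i) 0 = 1 := by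
  obtain ⟨h3, h4, -⟩ := frameCoord_constChart hγ hΓ h0
  rw [← analyticOrderAt_deriv_eq_one (analyticAt_pi_iff.1 hγ i) hord]
  refine analyticOrderAt_congr ?_
  filter_upwards [eventually_eventually_nhds.2 h3, h4.eventually_analyticAt] with t t1 t2
  rw [deriv_frameCoord_apply t2]
  exact EventuallyEq.deriv_eq t1

include hY

theorem deriv_offSlot_eq_zero_iff {m : ℕ} (hm : m ≤ k) {Γ : ℂ → (Monster d m).Pt}
    (hΓ : IsProlongation m γ Γ) (h0 : Γ 0 ∈ (Monster d m).dom (constChart i m)) :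
    deriv (offSlot (constChart i m) i Γ) 0 = 0 ↔ m ≠ k := by
  obtain ⟨-, h4, h5⟩ := frameCoord_constChart hγ hΓ h0
  have hx : AnalyticAt ℂ (fun t => γ t i) 0 := analyticAt_pi_iff.1 hγ i
  have hx' : deriv (fun t => γ t i) 0 = 0 := apply_eq_zero_of_analyticOrderAt_ne_zero (by
    rw [analyticOrderAt_deriv_eq_one hx hord]
    exact one_ne_zero)
  have hH : HalfOrder (fun t => γ t i) (offSlot (constChart i m) i Γ) (2 * (k - m) + 1) := by
    rw [h5 hord, show 2 * (k - m) + 1 + 2 * m = 2 * k + 1 by omega]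
    exact hY
  rw [hH.deriv_eq_zero_iff hx (analyticAt_offSlot h4) hx']
  omega

/-- If the slot failed in passing from a level below `k` to the next, then `dx = (dx/dz) dz` with
both factors vanishing at `0`: the first by the failure, the second since off-slot derivatives
vanish below level `k`. This contradicts the simple zero of `dx`. -/
theorem mem_constChart {m : ℕ} (hm : m ≤ k) {Γ : ℂ → (Monster d m).Pt}
    (hΓ : IsProlongation m γ Γ) : Γ 0 ∈ (Monster d m).dom (constChart i m) := by
  induction m with
  | zero => trivial
  | succ m ih =>
    obtain ⟨Γ', hΓ', hp⟩ := hΓ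
    have hb : (DistManifold.ProjPt.base (L := Monster d m) (Γ 0)) = Γ' 0 := base_eq_of_prolongs hp
    have h0 := ih (by omega) hΓ'
    have hm0 : DistManifold.ProjPt.base (L := Monster d m) (Γ 0) ∈
      (Monster d m).dom (constChart i m) := hb ▸ h0
    refine ⟨hm0, fun H => ?_⟩
    have hYz := (deriv_offSlot_eq_zero_iff hγ hord hY (by omega) hΓ' h0).2 (by omega)
    obtain ⟨j, hj⟩ := Function.ne_iff.1 ((framed d m).homCoord_ne_zero (q := Γ 0) hm0)
    have hmj : Γ 0 ∈ (Monster d m).projAtlas.dom (constChart i m, j) := ⟨hm0, hj⟩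
    have hij : i ≠ j := by
      rintro rfl
      exact hj H
    have hF1 := (framed d m).analyticAt_frameCoord_prolong hp hmj
    have hF := (framed d m).analyticAt_frameCoord_base hp hmj
    have hFj : AnalyticAt ℂ
      (fun t => deriv ((Monster d m).frameCoord (constChart i m) Γ') t j) 0 :=
      analyticAt_pi_iff.1 hF.deriv j
    have hF1i : AnalyticAt ℂ
      (fun t => (Monster d m).prolong.frameCoord (constChart i m, j) Γ t i) 0 :=
      analyticAt_pi_iff.1 hF1 i
    have hord1 := order_deriv_slot hγ hord hΓ' h0
    have hcongr : (fun t => deriv ((Monster d m).frameCoord (constChart i m) Γ') t i) =ᶠ[𝓝 0]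
      (fun t => deriv ((Monster d m).frameCoord (constChart i m) Γ') t j) *
        fun t => (Monster d m).prolong.frameCoord (constChart i m, j) Γ t i :=
      (framed d m).eventually_deriv_apply_of_prolongs hp hmj hij
    rw [analyticOrderAt_congr hcongr, analyticOrderAt_mul hFj hF1i] at hord1
    have h1 : analyticOrderAt
        (fun t => (Monster d m).prolong.frameCoord (constChart i m, j) Γ t i) 0 ≠ 0 := by
      rw [hF1i.analyticOrderAt_ne_zero]
      exact (frameCoord_prolong_of_ne _ _ _ hij).trans ((homCoord_eq_zero_iff hmj).1 H)
    have h2 : analyticOrderAt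
        (fun t => deriv ((Monster d m).frameCoord (constChart i m) Γ') t j) 0 ≠ 0 := by
      rw [hFj.analyticOrderAt_ne_zero]
      obtain ⟨l, rfl⟩ := Fin.exists_succAbove_eq hij.symm
      rw [deriv_offSlot hF] at hYz
      exact congrFun hYz l
    have h3 := add_le_add (Order.one_le_iff_ne_zero.2 h2) (Order.one_le_iff_ne_zero.2 h1)
    rw [hord1, one_add_one_eq_two] at h3
    exact absurd h3 (by decide)

/-- Level `k` is the first at which the off-slot part has order one; immersion then persists. The
further prolongation `Γ₁` serves to pass between charts. -/
theorem immersed_of_halfOrder {m : ℕ} (hm : k ≤ m) {Γ : ℂ → (Monster d m).Pt}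
    (hΓ : IsProlongation m γ Γ) {Γ₁ : ℂ → (Monster d (m + 1)).Pt}
    (hp : (Monster d m).Prolongs Γ Γ₁) (a : (Monster d m).ι) (ha : Γ 0 ∈ (Monster d m).dom a) :
    deriv ((Monster d m).frameCoord a Γ) 0 ≠ 0 := by
  induction m, hm using Nat.le_induction with
  | base =>
    have h0 := mem_constChart hγ hord hY le_rfl hΓ
    refine (framed d k).deriv_frameCoord_ne_zero_of_chart hp h0 ha fun H => ?_
    have h4 := (frameCoord_constChart hγ hΓ h0).2.1
    refine (not_iff_not.2 (deriv_offSlot_eq_zero_iff hγ hord hY le_rfl hΓ h0)).2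
      (not_not.2 rfl) ?_
    rw [deriv_offSlot h4, H]
    rfl
  | succ m hm ih =>
    obtain ⟨Γ', hΓ', hp'⟩ := hΓ
    exact (framed d m).immersed_of_prolongs hp' (fun b hb => ih hΓ' hp' b hb) a ha

/-- At level `k` the curve is immersed while `dx` vanishes at `0`, so its tangent is vertical. If
the next line were tangent to the vertical locus, `dx/dz`, and with it `dx`, would have order at
least two. -/
theorem vertical_of_halfOrder {κ : ℕ} (hk : k = κ + 1) {Γ : ℂ → (Monster d (κ + 1)).Pt}
    (hΓ : IsProlongation (κ + 1) γ Γ) {Γ₁ : ℂ → (Monster d (κ + 2)).Pt}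
    (hp : (Monster d (κ + 1)).Prolongs Γ Γ₁) : IsVertical (κ + 2) (Γ₁ 0) ∧
      ∀ Γ₂ : ℂ → (Monster d (κ + 3)).Pt, (Monster d (κ + 2)).Prolongs Γ₁ Γ₂ →
        ¬ IsTan (κ + 3) (Γ₂ 0) := by
  subst hk
  have hb : down (Γ₁ 0) = Γ 0 := base_eq_of_prolongs hp
  have h0 := mem_constChart hγ hord hY le_rfl hΓ
  have himm := immersed_of_halfOrder hγ hord hY le_rfl hΓ hp
  have hx0 : deriv ((Monster d (κ + 1)).frameCoord (constChart i (κ + 1)) Γ) 0 i = 0 :=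
    apply_eq_zero_of_analyticOrderAt_ne_zero (f := fun t => deriv ((Monster d (κ + 1)).frameCoord
      (constChart i (κ + 1)) Γ) t i) (by
        rw [order_deriv_slot hγ hord hΓ h0]
        exact one_ne_zero)
  have hm0 : DistManifold.ProjPt.base (L := Monster d (κ + 1)) (Γ₁ 0) ∈
      (Monster d (κ + 1)).dom (constChart i (κ + 1)) := by
    have : down (Γ₁ 0) ∈ (Monster d (κ + 1)).dom (constChart i (κ + 1)) := by
      rw [hb]
      exact h0
    exact this
  have hV : (Monster d (κ + 1)).homCoord (constChart i (κ + 1)) (Γ₁ 0) i = 0 := by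
    obtain ⟨c, hc, hc'⟩ := ((framed d (κ + 1)).tangentLine_of_prolongs hp himm).2 _ h0
    rw [hc', Pi.smul_apply, hx0, smul_zero]
  refine ⟨(isVertical_iff_homCoord (a := constChart i κ) hm0).2 hV, fun Γ₂ hp₂ hT => ?_⟩
  have hb₂ : down (Γ₂ 0) = Γ₁ 0 := base_eq_of_prolongs hp₂
  obtain ⟨i', hi'⟩ := Function.ne_iff.1 ((framed d (κ + 1)).homCoord_ne_zero (q := Γ₁ 0) hm0)
  have hm' : Γ₁ 0 ∈ (Monster d (κ + 1)).projAtlas.dom (constChart i (κ + 1), i') := ⟨hm0, hi'⟩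
  have hii : i ≠ i' := by
    rintro rfl
    exact hi' hV
  have hm₂ : down (Γ₂ 0) ∈ (Monster d (κ + 2)).dom ((constChart i κ, i), i') := by
    rw [hb₂]
    exact hm'
  have hT' := ((isTan_iff_homCoord hm₂).1 hT).2
  obtain ⟨c, hc, hc'⟩ := ((framed d (κ + 2)).tangentLine_of_prolongs hp₂
    (fun b hb => (framed d (κ + 1)).immersed_of_prolongs hp himm b hb)).2
      (constChart i (κ + 1), i') hm'
  have hF1 : AnalyticAt ℂ ((Monster d (κ + 2)).frameCoord (constChart i (κ + 1), i') Γ₁) 0 :=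
    (framed d (κ + 1)).analyticAt_frameCoord_prolong hp hm'
  have hd : deriv ((Monster d (κ + 2)).frameCoord (constChart i (κ + 1), i') Γ₁) 0 i = 0 := by
    have h1 := (congrFun hc' i).symm.trans hT'
    exact (mul_eq_zero.1 h1).resolve_left hc
  have hF := (framed d (κ + 1)).analyticAt_frameCoord_base hp hm'
  have hFj : AnalyticAt ℂ
    (fun t => deriv ((Monster d (κ + 1)).frameCoord (constChart i (κ + 1)) Γ) t i') 0 :=
    analyticAt_pi_iff.1 hF.deriv i'
  have hF1i : AnalyticAt ℂ
    (fun t => (Monster d (κ + 2)).frameCoord (constChart i (κ + 1), i') Γ₁ t i) 0 :=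
    analyticAt_pi_iff.1 hF1 i
  have hord1 := order_deriv_slot hγ hord hΓ h0
  have hcongr : (fun t => deriv ((Monster d (κ + 1)).frameCoord (constChart i (κ + 1)) Γ) t i)
    =ᶠ[𝓝 0] (fun t => deriv ((Monster d (κ + 1)).frameCoord (constChart i (κ + 1)) Γ) t i') *
      fun t => (Monster d (κ + 2)).frameCoord (constChart i (κ + 1), i') Γ₁ t i :=
    (framed d (κ + 1)).eventually_deriv_apply_of_prolongs hp hm' hii
  rw [analyticOrderAt_congr hcongr, analyticOrderAt_mul hFj hF1i] at hord1
  have h0' : (Monster d (κ + 2)).frameCoord (constChart i (κ + 1), i') Γ₁ 0 i = 0 :=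
    (frameCoord_prolong_of_ne (L := Monster d (κ + 1)) _ _ _ hii).trans
      ((homCoord_eq_zero_iff hm').1 hV)
  have h1 := hF1i.analyticOrderAt_deriv_add_one
  simp only [h0', sub_zero] at h1
  have h2 : analyticOrderAt (deriv fun t =>
      (Monster d (κ + 2)).frameCoord (constChart i (κ + 1), i') Γ₁ t i) 0 ≠ 0 := by
    rw [hF1i.deriv.analyticOrderAt_ne_zero, ← deriv_frameCoord_apply (L := Monster d (κ + 2)) hF1]
    exact hd
  rw [← h1] at hord1
  have h3 : (1 : ℕ∞) + 1 ≤ 1 := by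
    conv_rhs => rw [← hord1]
    exact (add_le_add (Order.one_le_iff_ne_zero.2 h2) le_rfl).trans le_add_self
  exact absurd h3 (by decide)

theorem onlyVertical_of_halfOrder (hk : 1 ≤ k) {m : ℕ} (hm : k < m) {Γ : ℂ → (Monster d m).Pt}
    (hΓ : IsProlongation m γ Γ) : OnlyVertical k m (Γ 0) := by
  induction m, hm using Nat.le_induction with
  | base =>
    obtain ⟨κ, rfl⟩ := Nat.exists_eq_add_of_le' hk
    obtain ⟨Γ', hΓ', hp⟩ := hΓ
    have hb : down (Γ 0) = Γ' 0 := base_eq_of_prolongs hp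
    have h0 := mem_constChart hγ hord hY le_rfl hΓ'
    exact .inl ⟨rfl, by rw [hb]; exact nonVertical_of_mem_constChart h0,
      (vertical_of_halfOrder hγ hord hY rfl hΓ' hp).1⟩
  | succ m hm ih =>
    obtain ⟨Γ', hΓ', hp⟩ := hΓ
    have hb : down (Γ 0) = Γ' 0 := base_eq_of_prolongs hp
    have h1 := ih hΓ'
    obtain ⟨m, rfl⟩ := Nat.exists_eq_succ_of_ne_zero (Nat.ne_zero_of_lt hm)
    obtain ⟨Γ'', hΓ'', hp'⟩ := hΓ'
    have himm := immersed_of_halfOrder hγ hord hY (Nat.lt_succ_iff.1 hm) hΓ'' hp'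
    refine .inr ⟨by rw [hb]; exact h1, (framed d m).not_vertical_of_prolongs hp' hp himm,
      fun hT => ?_⟩
    -- Tangency requires a vertical point immediately below, so it is in question only right after
    -- the V.
    rcases h1 with ⟨rfl, -, -⟩ | ⟨-, hV, -⟩
    · obtain ⟨κ, rfl⟩ := Nat.exists_eq_add_of_le' hk
      exact (vertical_of_halfOrder hγ hord hY rfl hΓ'' hp').2 Γ hp hT
    · have := hT.vertical
      rw [hb] at this
      exact hV this

end

theorem immersed_of_immersed {γ : ℂ → Fin (d + 1) → ℂ} (hγ : deriv γ 0 ≠ 0) {m : ℕ}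
    {Γ : ℂ → (Monster d m).Pt} (hΓ : IsProlongation m γ Γ) (a : (Monster d m).ι)
    (ha : Γ 0 ∈ (Monster d m).dom a) : deriv ((Monster d m).frameCoord a Γ) 0 ≠ 0 := by
  induction m with
  | zero =>
    have : Γ = γ := hΓ
    subst this
    exact hγ
  | succ m ih =>
    obtain ⟨Γ', hΓ', hp'⟩ := hΓ
    exact (framed d m).immersed_of_prolongs hp' (fun b hb => ih hΓ' b hb) a ha

theorem nonVertical_of_immersed {γ : ℂ → Fin (d + 1) → ℂ} (hγ : deriv γ 0 ≠ 0) {m : ℕ}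
    {Γ : ℂ → (Monster d m).Pt} (hΓ : IsProlongation m γ Γ) : NonVertical m (Γ 0) := by
  induction m with
  | zero => trivial
  | succ m ih =>
    obtain ⟨Γ', hΓ', hp⟩ := hΓ
    have hb : down (Γ 0) = Γ' 0 := base_eq_of_prolongs hp
    refine ⟨by rw [hb]; exact ih hΓ', ?_⟩
    rcases m with _ | m
    · exact id
    · obtain ⟨Γ'', hΓ'', hp'⟩ := hΓ'
      exact (framed d m).not_vertical_of_prolongs hp' hp (immersed_of_immersed hγ hΓ'')

end Monster

/-! ### Integral curves with prescribed coframe coordinates -/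

namespace DistManifold.Framed

variable {d : ℕ} {L : DistManifold d} (h : L.Framed)
include h

/-- An integral curve lifts to an integral curve of the prolongation with prescribed fiber
coordinates. -/
theorem exists_integral_lift {a : L.ι} {i : Fin (d + 1)} {p : L.ProjPt}
    (hp : p ∈ L.projAtlas.dom (a, i)) {f : ℂ → Fin (d + 1) → ℂ} (hf : AnalyticAt ℂ f 0)
    (hf0 : f 0 = L.prolongCoframe (a, i) (L.projAtlas.chart (a, i) p))
    (ih : ∀ g : ℂ → Fin (d + 1) → ℂ, AnalyticAt ℂ g 0 → g 0 = L.coframe a (L.chart a p.base) →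
      ∃ c : ℂ → L.Pt, c 0 = p.base ∧ IsIntegralIn h a c ∧ L.frameCoord a c =ᶠ[𝓝 0] g) :
    ∃ c₁ : ℂ → L.ProjPt, c₁ 0 = p ∧ IsIntegralIn h.prolong (a, i) c₁ ∧
      L.prolong.frameCoord (a, i) c₁ =ᶠ[𝓝 0] f := by
  have := h.completeSpace
  let U : ℂ → Fin d → ℂ := fun t j => f t (i.succAbove j)
  have hU : AnalyticAt ℂ U 0 := AnalyticAt.pi fun j => analyticAt_pi_iff.1 hf _
  have hfi : AnalyticAt ℂ (fun t => deriv f t i) 0 := analyticAt_pi_iff.1 hf.deriv i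
  -- The contact relation, solved by quadrature: with slot coordinate and fiber coordinates given,
  -- the off-slot coordinates below are primitives, with constants fixed by `p`.
  obtain ⟨g, hg, hg0, hg'⟩ := exists_primitive (hfi.smul hU)
    (fun j => L.coframe a (L.chart a p.base) (i.succAbove j))
  let G : ℂ → Fin (d + 1) → ℂ := fun t => i.insertNth (α := fun _ => ℂ) (f t i) (g t)
  have hG : AnalyticAt ℂ G 0 :=
    Monster.analyticAt_insertNth i (analyticAt_pi_iff.1 hf i) hg
  have hG' : ∀ᶠ t in 𝓝 0, deriv G t = deriv f t i • affineVec i (U t) := by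
    filter_upwards [hf.eventually_analyticAt, hg'] with t t1 t2
    refine (hasDerivAt_pi.2 fun s => ?_).deriv
    induction s using i.succAboveCases with
    | x => simpa [G] using hasDerivAt_pi.1 t1.differentiableAt.hasDerivAt i
    | p j => simpa [G] using hasDerivAt_pi.1 t2 j
  have hG0 : G 0 = L.coframe a (L.chart a p.base) := by
    funext s
    induction s using i.succAboveCases with
    | x =>
      simp only [G, Fin.insertNth_apply_same, hf0]
      exact prolongCoframe_self (a, i) _
    | p j =>
      simp only [G, Fin.insertNth_apply_succAbove, hg0]
  obtain ⟨c, hc0, ⟨hc1, hc2, hc3⟩, hcG⟩ := ih G hG hG0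
  let c₁ : ℂ → L.ProjPt := fun t => h.regular_prolong.point (a, i) (L.chart a (c t), U t)
  have hchart : ∀ t, L.projAtlas.chart (a, i) (c₁ t) = (L.chart a (c t), U t) :=
    fun t => h.regular_prolong.chart_point (a, i) _
  have hchart' : (fun t => L.projAtlas.chart (a, i) (c₁ t)) = fun t => (L.chart a (c t), U t) :=
    funext hchart
  have hFf : ∀ᶠ t in 𝓝 0, L.prolong.frameCoord (a, i) c₁ t = f t := by
    filter_upwards [hcG] with t ht
    funext s
    have h1 : L.prolong.frameCoord (a, i) c₁ t =
      L.prolongCoframe (a, i) (L.chart a (c t), U t) := congrArg (L.prolongCoframe (a, i)) (hchart t)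
    rw [h1]
    induction s using i.succAboveCases with
    | x =>
      refine (prolongCoframe_self (a, i) _).trans ?_
      change L.frameCoord a c t i = f t i
      rw [ht]
      simp [G]
    | p j => exact prolongCoframe_succAbove (a, i) _ j
  refine ⟨c₁, ?_, ⟨.of_forall fun t => h.regular_prolong.point_mem (a, i) _, ?_, ?_⟩, hFf⟩
  · refine h.injOn_projChart a i (h.regular_prolong.point_mem (a, i) _) hp ?_
    refine (hchart 0).trans ?_
    rw [hc0]
    refine Prod.ext rfl (funext fun j => ?_)
    simp only [U, hf0]
    exact prolongCoframe_succAbove (a, i) _ j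
  · exact (congrArg (fun φ : ℂ → L.E × (Fin d → ℂ) => AnalyticAt ℂ φ 0) hchart').mpr
      (hc2.prod hU)
  · filter_upwards [hc3, hG', eventually_eventually_nhds.2 hcG, eventually_eventually_nhds.2 hFf,
      hc2.eventually_analyticAt, hf.eventually_analyticAt] with t t1 t2 t3 t4 t5 t6
    have hUd : HasDerivAt U (fun j => deriv f t (i.succAbove j)) t :=
      hasDerivAt_pi.2 fun j => hasDerivAt_pi.1 t6.differentiableAt.hasDerivAt _
    have h1 : deriv (fun t => (L.chart a (c t), U t)) t =
        (deriv (fun t => L.chart a (c t)) t, fun j => deriv f t (i.succAbove j)) :=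
      (t5.differentiableAt.hasDerivAt.prodMk hUd).deriv
    have h2 := (congrArg (fun φ : ℂ → L.E × (Fin d → ℂ) => deriv φ t) hchart').trans h1
    have h3 : deriv (L.prolong.frameCoord (a, i) c₁) t = deriv f t := EventuallyEq.deriv_eq t4
    have h4 : deriv (L.frameCoord a c) t = deriv G t := EventuallyEq.deriv_eq t3
    refine h2.trans ?_
    rw [h3, t1, h4, t2]
    refine Eq.trans ?_ (h.liftProlong_apply a i (L.projAtlas.chart (a, i) (c₁ t))
      (deriv f t)).symm
    rw [hchart]

end DistManifold.Framed

namespace Monster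

open DistManifold DistManifold.Framed

variable {d : ℕ}

theorem exists_isIntegralIn {m : ℕ} {a : (Monster d m).ι} {p : (Monster d m).Pt}
    (hp : p ∈ (Monster d m).dom a) {f : ℂ → Fin (d + 1) → ℂ} (hf : AnalyticAt ℂ f 0)
    (hf0 : f 0 = (Monster d m).coframe a ((Monster d m).chart a p)) :
    ∃ Γ : ℂ → (Monster d m).Pt, Γ 0 = p ∧ IsIntegralIn (framed d m) a Γ ∧
      (Monster d m).frameCoord a Γ =ᶠ[𝓝 0] f := by
  induction m generalizing f with
  | zero => exact ⟨f, hf0, ⟨.of_forall fun _ => trivial, hf, .of_forall fun _ => rfl⟩, .rfl⟩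
  | succ m ih =>
    exact (framed d m).exists_integral_lift hp hf hf0 fun g hg hg0 => ih hp.1 hg hg0

/-- Every line of the distribution is tangent to an integral curve. -/
theorem exists_isIntegralIn_tangent {m : ℕ} {a : (Monster d m).ι} (q : (Monster d (m + 1)).Pt)
    (ha : down q ∈ (Monster d m).dom a) :
    ∃ Γ : ℂ → (Monster d m).Pt, Γ 0 = down q ∧ IsIntegralIn (framed d m) a Γ ∧
      (Monster d m).HasVelocity Γ 0 (down q) (line q).rep.1 ∧
      deriv ((Monster d m).frameCoord a Γ) 0 = (Monster d m).homCoord a q := by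
  have hlin : HasDerivAt (fun t : ℂ => (Monster d m).coframe a ((Monster d m).chart a (down q)) +
      t • (Monster d m).homCoord a q) ((Monster d m).homCoord a q) 0 := by
    simpa using ((hasDerivAt_id (0 : ℂ)).smul_const ((Monster d m).homCoord a q)).const_add
      ((Monster d m).coframe a ((Monster d m).chart a (down q)))
  obtain ⟨Γ, h0, hΓ, hF⟩ := exists_isIntegralIn ha
    (analyticAt_const.add (analyticAt_id.smul analyticAt_const) : AnalyticAt ℂ
      (fun t : ℂ => (Monster d m).coframe a ((Monster d m).chart a (down q)) +
      t • (Monster d m).homCoord a q) 0) (by simp)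
  have hd : deriv ((Monster d m).frameCoord a Γ) 0 = (Monster d m).homCoord a q :=
    hF.deriv_eq.trans hlin.deriv
  refine ⟨Γ, h0, hΓ, (framed d m).regular.hasVelocity_of_chart h0 hΓ.1 ?_, hd⟩
  have h1 := hΓ.2.1.differentiableAt.hasDerivAt
  rw [hΓ.2.2.self_of_nhds, hd, h0] at h1
  have h2 := (framed d m).apply_rep (q := q) ha
  exact h2 ▸ h1

/-- All levels share the slot coordinate, so its nonvanishing derivative off `0` gives every
projection a nonzero velocity there. -/
theorem exists_isProlongation_of_constChart {i : Fin (d + 1)} {m : ℕ} {Γ : ℂ → (Monster d m).Pt}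
    (hΓ : IsIntegralIn (framed d m) (constChart i m) Γ)
    (hne : ∀ᶠ t in 𝓝[≠] 0,
      deriv (fun t => (Monster d m).frameCoord (constChart i m) Γ t i) t ≠ 0) :
    ∃ γ : ℂ → Fin (d + 1) → ℂ, AnalyticAt ℂ γ 0 ∧ IsProlongation m γ Γ ∧
      ∀ t, γ t i = (Monster d m).frameCoord (constChart i m) Γ t i := by
  induction m with
  | zero => exact ⟨Γ, hΓ.2.1, rfl, fun _ => rfl⟩
  | succ m ih =>
    have hslot : ∀ t, (Monster d (m + 1)).frameCoord (constChart i (m + 1)) Γ t i =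
        (Monster d m).frameCoord (constChart i m) (fun t => down (Γ t)) t i :=
      fun t => prolongCoframe_self (L := Monster d m) (constChart i m, i) _
    simp only [hslot] at hne ⊢
    have hΓ' : IsIntegralIn (framed d m) (constChart i m) fun t => down (Γ t) :=
      ((framed d m).isIntegralIn_base hΓ).1
    obtain ⟨γ, hγ, hγΓ, hγi⟩ := ih hΓ' hne
    refine ⟨γ, hγ, ⟨_, hγΓ, (framed d m).prolongs_of_isIntegralIn hΓ ?_⟩, hγi⟩
    filter_upwards [hne, ((framed d m).analyticAt_frameCoord
      hΓ'.2.1).eventually_analyticAt.filter_mono nhdsWithin_le_nhds] with t t1 t2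
    have := deriv_frameCoord_apply (L := Monster d m) t2 i
    exact fun H => t1 (this.symm.trans H)

theorem not_eventually_const_of_deriv {γ : ℂ → Fin (d + 1) → ℂ} {i : Fin (d + 1)}
    (hne : ∀ᶠ t in 𝓝[≠] 0, deriv (fun t => γ t i) t ≠ 0) : ¬ ∀ᶠ t in 𝓝 0, γ t = γ 0 := by
  intro H
  obtain ⟨t, h1, h2⟩ := (hne.and ((eventually_eventually_nhds.2 H).filter_mono
    nhdsWithin_le_nhds)).exists
  refine h1 ?_
  have h3 : (fun t => γ t i) =ᶠ[𝓝 t] fun _ => γ 0 i := h2.mono fun s hs => congrFun hs i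
  rw [h3.deriv_eq, deriv_const]

theorem eventually_deriv_ne_zero_of_order {F : ℂ → Fin (d + 1) → ℂ} (hF : AnalyticAt ℂ F 0)
    {i : Fin (d + 1)} (h : analyticOrderAt (fun t => deriv F t i) 0 ≠ ⊤) :
    ∀ᶠ t in 𝓝[≠] 0, deriv (fun t => F t i) t ≠ 0 := by
  have h1 : AnalyticAt ℂ (fun t => deriv F t i) 0 := analyticAt_pi_iff.1 hF.deriv i
  have h2 := h1.eventually_eq_zero_or_eventually_ne_zero.resolve_left
    fun H => h (analyticOrderAt_eq_top.2 H)
  filter_upwards [h2, hF.eventually_analyticAt.filter_mono nhdsWithin_le_nhds] with t t1 t2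
  rwa [(hasDerivAt_pi.1 t2.differentiableAt.hasDerivAt i).deriv]

end Monster

/-! ### Realization of points, Cartan points and the singular locus -/

namespace Monster

open DistManifold DistManifold.Framed

variable {d : ℕ}

theorem deriv_slot_ne_zero_of_tangentLine {m : ℕ} {a : (Monster d m).ι} {i : Fin (d + 1)}
    {Γ : ℂ → (Monster d (m + 1)).Pt} (h0 : Γ 0 ∈ (Monster d (m + 1)).dom (a, i))
    {q : (Monster d (m + 2)).Pt} (hq : (Monster d (m + 1)).TangentLine Γ q)
    (hqV : ¬ IsVertical (m + 2) q) :
    deriv ((Monster d (m + 1)).frameCoord (a, i) Γ) 0 i ≠ 0 := by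
  have hqb : down q = Γ 0 := hq.1
  have hqm : down q ∈ (Monster d (m + 1)).dom (a, i) := hqb ▸ h0
  obtain ⟨c, -, hc⟩ := hq.2 (a, i) h0
  intro H
  refine hqV ((isVertical_iff_homCoord hqm).2 ?_)
  exact (congrFun hc i).trans
    (by rw [Pi.smul_apply]; exact (congrArg (c • ·) H).trans (smul_zero c))

theorem isIntegralIn_down {m : ℕ} {a : (Monster d m).ι} {i : Fin (d + 1)}
    {Γ : ℂ → (Monster d (m + 1)).Pt} (hΓ : IsIntegralIn (framed d (m + 1)) (a, i) Γ) :
    IsIntegralIn (framed d m) a fun t => down (Γ t) :=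
  ((framed d m).isIntegralIn_base hΓ).1

theorem prolongs_down {m : ℕ} {a : (Monster d m).ι} {i : Fin (d + 1)}
    {Γ : ℂ → (Monster d (m + 1)).Pt} (hΓ : IsIntegralIn (framed d (m + 1)) (a, i) Γ)
    (hne : deriv ((Monster d (m + 1)).frameCoord (a, i) Γ) 0 i ≠ 0) :
    (Monster d m).Prolongs (fun t => down (Γ t)) Γ :=
  (framed d m).prolongs_of_deriv_ne_zero hΓ hne

/-- Integral curves with noncritical tangent at a point of the class project to nonconstant curve
germs in the base. -/
theorem OnlyVertical.exists_isProlongation {k m : ℕ} {p : (Monster d m).Pt}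
    (h : OnlyVertical k m p) : ∃ a, p ∈ (Monster d m).dom a ∧
      ∀ Γ : ℂ → (Monster d m).Pt, IsIntegralIn (framed d m) a Γ → Γ 0 = p →
      ∀ q : (Monster d (m + 1)).Pt, (Monster d m).TangentLine Γ q →
      ¬ IsVertical (m + 1) q → ¬ IsTan (m + 1) q →
      ∃ γ : ℂ → Fin (d + 1) → ℂ, AnalyticAt ℂ γ 0 ∧ (¬ ∀ᶠ t in 𝓝 0, γ t = γ 0) ∧
        IsProlongation m γ Γ := by
  induction m with
  | zero => exact h.elim
  | succ m ih =>
    rcases h with ⟨rfl, hn, hV⟩ | ⟨h, hV, hT⟩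
    · rcases m with _ | m
      · exact hV.elim
      obtain ⟨i, hi⟩ := hn.exists_constChart
      obtain ⟨i', hi'⟩ := Function.ne_iff.1 ((framed d (m + 1)).homCoord_ne_zero (q := p) hi)
      refine ⟨(constChart i (m + 1), i'), ⟨hi, hi'⟩, fun Γ hΓ h0 q hq hqV hqT => ?_⟩
      subst h0
      have hp := prolongs_down hΓ (deriv_slot_ne_zero_of_tangentLine ⟨hi, hi'⟩ hq hqV)
      have hΓ' := isIntegralIn_down hΓ
      -- Below the vertical point the curve need not be immersed; the simple zero of `dx` still
      -- makes its velocity nonzero off `0`.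
      have hord := (order_deriv_of_vertical hp hi hV hq hqV hqT).1
      have hne := eventually_deriv_ne_zero_of_order
        ((framed d (m + 1)).analyticAt_frameCoord hΓ'.2.1) (i := i)
        (by rw [hord]; exact ENat.one_ne_top)
      obtain ⟨γ, hγ, hγΓ, hγi⟩ := exists_isProlongation_of_constChart hΓ' hne
      refine ⟨γ, hγ, not_eventually_const_of_deriv (i := i) ?_, ⟨_, hγΓ, hp⟩⟩
      rw [funext hγi]
      exact hne
    · rcases m with _ | m
      · exact h.elim
      obtain ⟨a, ha, H⟩ := ih h
      obtain ⟨i, hi⟩ := Function.ne_iff.1 ((framed d (m + 1)).homCoord_ne_zero (q := p) ha)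
      refine ⟨(a, i), ⟨ha, hi⟩, fun Γ hΓ h0 q hq hqV _ => ?_⟩
      subst h0
      have hp := prolongs_down hΓ (deriv_slot_ne_zero_of_tangentLine ⟨ha, hi⟩ hq hqV)
      obtain ⟨γ, hγ, hγ', hγΓ⟩ := H _ (isIntegralIn_down hΓ) rfl (Γ 0)
        ((framed d (m + 1)).tangentLine_descend hp hq hqV) hV hT
      exact ⟨γ, hγ, hγ', ⟨_, hγΓ, hp⟩⟩

theorem rep_ne_zero {m : ℕ} (q : (Monster d (m + 1)).Pt) : (line q).rep ≠ 0 :=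
  Projectivization.rep_nonzero _

theorem mk_rep_line {m : ℕ} (q : (Monster d (m + 1)).Pt) :
    (Projectivization.mk ℂ (line q).rep (rep_ne_zero q)) = line q :=
  Projectivization.mk_rep _

theorem tangentLine_of_hasVelocity_rep {m : ℕ} {Γ : ℂ → (Monster d m).Pt}
    {q : (Monster d (m + 1)).Pt}
    (h : (Monster d m).HasVelocity Γ 0 (down q) (line q).rep.1) :
    (Monster d m).TangentLine Γ q := by
  have h1 := (framed d m).tangentLine_of_hasVelocity (rep_ne_zero q) h
  have h2 := congrArg (fun l => (⟨down q, l⟩ : (Monster d m).ProjPt)) (mk_rep_line q)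
  exact (congrArg ((Monster d m).TangentLine Γ) h2).mp h1

theorem OnlyVertical.germ_nonempty {k m : ℕ} {p : (Monster d m).Pt} (h : OnlyVertical k m p) :
    (Germ p).Nonempty := by
  obtain ⟨a, ha, H⟩ := h.exists_isProlongation
  obtain ⟨q, -, rfl, -, hV, hT⟩ := exists_regular_lift ha 0 isOpen_univ univ_nonempty
  obtain ⟨Γ, h0, hΓ, hvel, -⟩ := exists_isIntegralIn_tangent q ha
  obtain ⟨γ, hγ, hγ', hγΓ⟩ := H Γ hΓ h0 q (tangentLine_of_hasVelocity_rep hvel) hV hT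
  refine ⟨γ, hγ, hγ', Γ, hγΓ, (line q).rep, rep_ne_zero q, hvel, ?_⟩
  rw [mk_rep_line]
  exact fun hc => (h.isCritical_iff.1 hc).elim hV hT

/-- A nonvertical line over `p` keeps one slot `i` at all levels. A curve tangent to it has nonzero
derivative in that slot, and this derivative is shared by its projection to ℂⁿ. -/
theorem NonVertical.isCartan {m : ℕ} {p : (Monster d m).Pt} (h : NonVertical m p) :
    IsCartan p := by
  obtain ⟨a, ha⟩ := (framed d m).regular.cover p
  obtain ⟨q, -, rfl, -, hV, -⟩ := exists_regular_lift ha 0 isOpen_univ univ_nonempty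
  have hn : NonVertical (m + 1) q := ⟨h, hV⟩
  obtain ⟨i, hi⟩ := hn.exists_constChart
  obtain ⟨Γ, h0, hΓ, hvel, hderiv⟩ := exists_isIntegralIn_tangent q (a := constChart i m) hi.1
  have hF := (framed d m).analyticAt_frameCoord hΓ.2.1
  have hFi : deriv ((Monster d m).frameCoord (constChart i m) Γ) 0 i ≠ 0 := by
    rw [hderiv]
    exact hi.2
  have hFd : AnalyticAt ℂ
      (fun t => deriv ((Monster d m).frameCoord (constChart i m) Γ) t i) 0 :=
    analyticAt_pi_iff.1 hF.deriv i
  have hne := eventually_deriv_ne_zero_of_order hF (i := i)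
    (by rw [hFd.analyticOrderAt_eq_zero.2 hFi]; exact ENat.zero_ne_top)
  obtain ⟨γ, hγ, hγΓ, hγi⟩ := exists_isProlongation_of_constChart hΓ hne
  refine ⟨γ, ⟨hγ, not_eventually_const_of_deriv (i := i) ?_, Γ, hγΓ, (line q).rep, rep_ne_zero q,
    hvel, ?_⟩, fun H => hFi ?_⟩
  · rw [funext hγi]
    exact hne
  · rw [mk_rep_line]
    exact hn.not_isCritical
  · rw [deriv_frameCoord_apply hF, ← funext hγi,
      ← hasDerivAt_pi.1 hγ.differentiableAt.hasDerivAt i |>.deriv.symm, H]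
    rfl

theorem isCartan_iff {m : ℕ} {p : (Monster d m).Pt} : IsCartan p ↔ NonVertical m p := by
  refine ⟨?_, NonVertical.isCartan⟩
  rintro ⟨γ, ⟨-, -, Γ, hΓ, v, hv, hvel, -⟩, hγ⟩
  rw [← hvel.1]
  exact nonVertical_of_immersed hγ hΓ

theorem OnlyVertical.exists_halfOrder {k m : ℕ} {p : (Monster d m).Pt} (h : OnlyVertical k m p)
    {γ : ℂ → Fin (d + 1) → ℂ} (hγ : γ ∈ Germ p) :
    ∃ i, analyticOrderAt (fun t => γ t i - γ 0 i) 0 = 2 ∧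
      HalfOrder (fun t => γ t i) (fun t j => γ t (i.succAbove j)) (2 * k + 1) := by
  obtain ⟨hγa, -, Γ, hΓ, v, hv, hvel, hcrit⟩ := hγ
  let q : (Monster d (m + 1)).Pt :=
    (⟨p, Projectivization.mk ℂ v hv⟩ : (Monster d m).ProjPt)
  have hq : ¬ IsCritical (m + 1) q := hcrit
  rw [OnlyVertical.isCritical_iff (q := q) h, not_or] at hq
  exact exists_halfOrder_of_tangentLine hγa hΓ (hvel.1.symm ▸ h)
    (q := q) ((framed d m).tangentLine_of_hasVelocity hv hvel) hq.1 hq.2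

theorem OnlyVertical.isA2k (hd : 1 ≤ d) {k m : ℕ} {p : (Monster d m).Pt} (h : OnlyVertical k m p)
    {γ : ℂ → Fin (d + 1) → ℂ} (hγ : γ ∈ Germ p) : IsA2k k γ := by
  obtain ⟨i, h1, h2⟩ := h.exists_halfOrder hγ
  exact isA2k_of_halfOrder hd hγ.1 h1 h2

theorem mem_locusA_iff (hd : 1 ≤ d) {k j : ℕ} (hk : 1 ≤ k) (hkj : k < j)
    {p : (Monster d j).Pt} : p ∈ locusA d k j ↔ OnlyVertical k j p := by
  constructor
  · rintro ⟨γ, hγ, hA⟩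
    obtain ⟨i, h1, h2⟩ := exists_halfOrder_of_isA2k hd hk hγ.1 hA
    obtain ⟨hγa, -, Γ, hΓ, v, hv, hvel, -⟩ := hγ
    rw [← hvel.1]
    exact onlyVertical_of_halfOrder hγa h1 h2 hk hkj hΓ
  · intro h
    obtain ⟨γ, hγ⟩ := h.germ_nonempty
    exact ⟨γ, hγ, h.isA2k hd hγ⟩

theorem isSmoothQuasiprojectiveHypersurface_onlyVertical (hd : 1 ≤ d) {k j : ℕ} (hk : 1 ≤ k)
    (hkj : k < j) : (Monster d j).IsSmoothQuasiprojectiveHypersurface {p | OnlyVertical k j p} := by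
  refine ⟨exists_onlyVertical hd hk hkj, ⟨_, _, isZariskiClosed_verticalAt k j,
    isZariskiClosed_otherVertical k j, Set.ext fun p => onlyVertical_iff⟩, fun p hp => ?_⟩
  have hp' := onlyVertical_iff.1 hp
  have := (framed d j).regular.finiteDimensional
  obtain ⟨a, ha, φ, hφ, hφa⟩ := hp'.1.exists_linear
  obtain ⟨F, hF, hFa⟩ := isZariskiClosed_otherVertical (d := d) k j a
  -- An equation of `OtherVertical` that does not vanish at `p`: where it is nonzero, the class
  -- coincides with the linear locus `VerticalAt`.
  have hg : ∃ g ∈ F, g ((Monster d j).chart a p) ≠ 0 := by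
    by_contra! hcon
    exact hp'.2 ((hFa p ha).2 hcon)
  obtain ⟨g, hgF, hgp⟩ := hg
  refine ⟨a, ha, φ, Atlas.linear_mem_polynomialFunctions φ, g, hF hgF, hgp, ?_,
    fun q hq hgq => ?_⟩
  · have h1 : fderiv ℂ φ ((Monster d j).chart a p) = LinearMap.toContinuousLinearMap φ :=
      (LinearMap.toContinuousLinearMap φ).hasFDerivAt.fderiv
    rw [h1]
    exact fun H => hφ (LinearMap.toContinuousLinearMap.injective (H.trans (map_zero _).symm))
  · refine onlyVertical_iff.trans ((and_iff_left fun H => hgq ?_).trans (hφa q hq))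
    exact (hFa q hq).1 H g hgF

theorem rvtClass_wordRVR {k j : ℕ} (hkj : k < j) :
    rvtClass d j (wordRVR k (j - k - 1)) = {p | OnlyVertical k j p} :=
  Set.ext fun _ => code_eq_wordRVR_iff.trans (and_iff_right (by omega))

theorem locusA_eq (hd : 1 ≤ d) {k j : ℕ} (hk : 1 ≤ k) (hkj : k < j) :
    locusA d k j = {p | OnlyVertical k j p} :=
  Set.ext fun _ => mem_locusA_iff hd hk hkj

theorem not_nonVertical_of_mem_singularLocus {j : ℕ} (p : singularLocus d j) :
    ¬ NonVertical j p.1 :=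
  fun H => p.2 (isCartan_iff.2 H)

theorem OnlyVertical.mem_singularLocus {k j : ℕ} {p : (Monster d j).Pt} (h : OnlyVertical k j p) :
    p ∈ singularLocus d j :=
  fun H => h.not_nonVertical (isCartan_iff.1 H)

/-- Within the singular locus each class is the complement of the closed set `OtherVertical`, by
`verticalAt_of_not`. -/
theorem isOpen_locusA (hd : 1 ≤ d) (j : ℕ) :
    IsOpen {p : singularLocus d j | ∃ k, 1 ≤ k ∧ k < j ∧ p.1 ∈ locusA d k j} := by
  have h1 : {p : singularLocus d j | ∃ k, 1 ≤ k ∧ k < j ∧ p.1 ∈ locusA d k j} =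
      ⋃ k ∈ Ico 1 j, Subtype.val ⁻¹' {p : (Monster d j).Pt | OtherVertical k j p}ᶜ := by
    ext p
    simp only [mem_ofPred_eq, mem_iUnion, mem_preimage, mem_compl_iff, mem_Ico, exists_prop,
      and_assoc]
    refine exists_congr fun k => and_congr_right fun hk => and_congr_right fun hkj => ?_
    rw [mem_locusA_iff hd hk hkj, onlyVertical_iff]
    exact and_iff_right_of_imp (verticalAt_of_not (not_nonVertical_of_mem_singularLocus p))
  rw [h1]
  refine isOpen_biUnion fun k _ => IsOpen.preimage continuous_subtype_val ?_
  exact ((framed d j).regular.isClosed_of_isZariskiClosed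
    (isZariskiClosed_otherVertical k j)).isOpen_compl

theorem dense_locusA (hd : 1 ≤ d) (j : ℕ) :
    Dense {p : singularLocus d j | ∃ k, 1 ≤ k ∧ k < j ∧ p.1 ∈ locusA d k j} := by
  rw [dense_iff_inter_open]
  rintro U hU ⟨p, hp⟩
  obtain ⟨O, hO, rfl⟩ := isOpen_induced_iff.1 hU
  obtain ⟨q, hqO, k, hk⟩ :=
    exists_onlyVertical_mem (not_nonVertical_of_mem_singularLocus p) hO hp
  exact ⟨⟨q, hk.mem_singularLocus⟩, hqO, k, hk.pos, hk.lt,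
    (mem_locusA_iff hd hk.pos hk.lt).2 hk⟩

end Monster

theorem theorem3 (d : ℕ) (hd : 1 ≤ d) :
    (∀ k q j : ℕ, 1 ≤ k → ∀ p ∈ Monster.rvtClass d j (Monster.wordRVR k q),
      ∀ γ ∈ Monster.Germ p, Monster.IsA2k k γ) ∧
    (∀ k j : ℕ, 1 ≤ k → k < j →
      Monster.locusA d k j = Monster.rvtClass d j (Monster.wordRVR k (j - k - 1)) ∧
      (Monster d j).IsSmoothQuasiprojectiveHypersurface (Monster.locusA d k j) ∧
      Monster.locusA d k j ⊆ Monster.singularLocus d j) ∧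
    (∀ j : ℕ,
      IsOpen {p : Monster.singularLocus d j | ∃ k, 1 ≤ k ∧ k < j ∧ p.1 ∈ Monster.locusA d k j} ∧
      Dense {p : Monster.singularLocus d j |
        ∃ k, 1 ≤ k ∧ k < j ∧ p.1 ∈ Monster.locusA d k j}) := by
  refine ⟨fun k q j _ p hp γ hγ => (Monster.code_eq_wordRVR_iff.1 hp).2.isA2k hd hγ,
    fun k j hk hkj => ?_, fun j => ⟨Monster.isOpen_locusA hd j, Monster.dense_locusA hd j⟩⟩
  rw [Monster.locusA_eq hd hk hkj, Monster.rvtClass_wordRVR hkj]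
  exact ⟨rfl, Monster.isSmoothQuasiprojectiveHypersurface_onlyVertical hd hk hkj,
    fun p hp => Monster.OnlyVertical.mem_singularLocus hp⟩
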